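/- Let $V\subset\mathbb R^d$ be a locally finite lattice (a discrete additive subgroup) which is positively generated by $s_1,\dots,s_v$, i.e. every element of $V$ is a finite sum of $s_i$'s. Let $\mathfrak h$ be a finite-dimensional complex Hilbert space, and let $L_1,\dots,L_v$ be operators on $\mathfrak h$ with $\sum_i L_i^*L_i=1$. The local channel is $\mathfrak L(\sigma)=\sum_i L_i\sigma L_i^*$, with dual $\mathfrak L^*(x)=\sum_i L_i^*xL_i$. For a positive operator $x$ put $\mathrm{supp}(x)=\ker(x)^\perp$. An enclosure is a subspace $\mathcal V\subset\mathfrak h$ such that, for every positive $\omega$, $\mathrm{supp}(\omega)\subset\mathcal V$ implies $\mathrm{supp}(\mathfrak L(\omega))\subset\mathcal V$. It is minimal if $\mathcal V\ne\{0\}$ and the only enclosures contained in $\mathcal V$ are $\{0\}$ and $\mathcal V$. With $p_{\mathcal V}$ the orthogonal projection onto $\mathcal V$, the absorption operator is $A(\mathcal V)=\lim_n\mathfrak L^{*n}(p_{\mathcal V})$; let $\tilde p$ be the orthogonal projection onto its support. The initial state is given by positive operators $\rho(k)$ on $\mathfrak h$, $k\in V$, with $\sum_k\mathrm{Tr}\,\rho(k)=1$.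 On $\Omega=V\times\{1,\dots,v\}^{\mathbb N}$ let $\mathbb P_\rho$ be the probability measure with $\mathbb P_\rho(\{k\}\times\{1,\dots,v\}^{\mathbb N})=\mathrm{Tr}\,\rho(k)$ and $\mathbb P_\rho(\{(k,j_1,\dots,j_n)\}\times\{1,\dots,v\}^{\mathbb N})=\mathrm{Tr}(L_{j_n}\cdots L_{j_1}\rho(k)L_{j_1}^*\cdots L_{j_n}^*)$. For $\omega=(k,j_1,j_2,\dots)$ put $X_0=k$, $X_{n+1}=X_n+s_{j_{n+1}}$, $\rho_0=\rho(k)/\mathrm{Tr}\,\rho(k)$ and $\rho_{n+1}=L_{j_{n+1}}\rho_nL_{j_{n+1}}^*/\mathrm{Tr}(L_{j_{n+1}}\rho_nL_{j_{n+1}}^*)$; these are defined $\mathbb P_\rho$-almost surely. Fix a minimal enclosure $\mathcal V$, put $Y_n=\mathrm{Tr}(A(\mathcal V)\rho_n)$ and let $Y_\infty$ be the $\mathbb P_\rho$-almost sure limit of the martingale $Y_n$. Assume $\mathbb E_\rho[Y_0]>0$, and let $\mathbb P'_\rho$ be the measure with $d\mathbb P'_\rho/d\mathbb P_\rho=Y_\infty/\mathbb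 E_\rho[Y_0]$. For $u\in\mathbb R^d$ let $\lambda_u$ be the spectral radius of the map $$\sigma\mapsto\sum_i \tilde L_i^{(u)}\sigma \tilde L_i^{(u)*},\qquad \tilde L_i^{(u)}=e^{u\cdot s_i/2}\,\tilde pL_i\tilde p .$$ Then $\mathbb P'_\rho$ is a probability measure. There is exactly one invariant state of $\mathfrak L$ (a positive trace-one operator fixed by $\mathfrak L$) with support contained in $\mathcal V$; denote it by $\tau_0$. Its support is $\mathcal V$. For every $u\in\mathbb R^d$ the function $t\mapsto\lambda_{tu}$ is twice continuously differentiable near $0$. Put $$m=\sum_{i=1}^v\mathrm{Tr}(L_i\tau_0L_i^*)\,s_i,\qquad \lambda'_u=\frac{d}{dt}\lambda_{tu}\Big|_{t=0},\qquad \lambda''_u=\frac{d^2}{dt^2}\lambda_{tu}\Big|_{t=0}.$$ There is a unique real symmetric matrix $D$ with $\langle u,Du\rangle=\lambda''_u-(\lambda'_u)^2$ for all $u\in\mathbb R^d$, and $D$ is positive semidefinite. Under $\mathbb P'_\rho$, $$\frac{(X_n-X_0)-nm}{\sqrt n}\longrightarrow\mathcal N(0,D)\quad\text{in law},$$ and each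 $X_n-X_0$ is $\mathbb P'_\rho$-integrable, with $$\left|\frac{\mathbb E'_\rho[X_n-X_0]}{n}-m\right|=O\!\left(\frac1n\right).$$ -/

import Mathlib

open MeasureTheory ProbabilityTheory Filter Topology
open scoped ENNReal NNReal InnerProductSpace

set_option linter.unusedSectionVars false

noncomputable section

namespace OQW

section Channel

variable {h : Type*} [NormedAddCommGroup h] [InnerProductSpace ℂ h] [FiniteDimensional ℂ h]
  [CompleteSpace h]

/-- The trace of an operator on the finite-dimensional space `h`. -/
def tr (x : h →L[ℂ] h) : ℂ := LinearMap.trace ℂ h (x : h →ₗ[ℂ] h)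

/-- The map `σ ↦ ∑ i, K i σ (K i)*` with Kraus operators `K i`. -/
def krausMap {v : ℕ} (K : Fin v → h →L[ℂ] h) : Module.End ℂ (h →L[ℂ] h) where
  toFun σ := ∑ i, K i * σ * ContinuousLinearMap.adjoint (K i)
  map_add' x y := by simp [mul_add, add_mul, Finset.sum_add_distrib]
  map_smul' c x := by simp [Finset.smul_sum]

/-- The dual map `x ↦ ∑ i, (K i)* x (K i)`; see `tr_mul_krausDual`. -/
def krausDual {v : ℕ} (K : Fin v → h →L[ℂ] h) : Module.End ℂ (h →L[ℂ] h) where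
  toFun x := ∑ i, ContinuousLinearMap.adjoint (K i) * x * K i
  map_add' x y := by simp [mul_add, add_mul, Finset.sum_add_distrib]
  map_smul' c x := by simp [Finset.smul_sum]


theorem tr_mul_comm (x y : h →L[ℂ] h) : tr (x * y) = tr (y * x) :=
  LinearMap.trace_mul_comm ℂ _ _

theorem tr_mul_krausDual {v : ℕ} (K : Fin v → h →L[ℂ] h) (ω x : h →L[ℂ] h) :
    tr (ω * krausDual K x) = tr (krausMap K ω * x) := by
  have tr_sum : ∀ f : Fin v → h →L[ℂ] h, tr (∑ i, f i) = ∑ i, tr (f i) := by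
    intro f
    simp [tr]
  simp only [krausDual, krausMap, LinearMap.coe_mk, AddHom.coe_mk, Finset.mul_sum, Finset.sum_mul,
    tr_sum]
  refine Finset.sum_congr rfl fun i _ => ?_
  rw [← mul_assoc, ← mul_assoc, tr_mul_comm, ← mul_assoc, ← mul_assoc]

/-- The support of a positive operator: the orthogonal complement of its kernel. -/
def supp (x : h →L[ℂ] h) : Submodule ℂ h := (LinearMap.ker (x : h →ₗ[ℂ] h))ᗮ

/-- A state: a positive operator with trace one. -/
def IsState (τ : h →L[ℂ] h) : Prop := τ.IsPositive ∧ tr τ = 1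

/-- Enclosures (invariant domains) of a map `Φ` on the operators on `h`. -/
def IsEnclosure (Φ : Module.End ℂ (h →L[ℂ] h)) (𝓥 : Submodule ℂ h) : Prop :=
  ∀ ω : h →L[ℂ] h, ω.IsPositive → supp ω ≤ 𝓥 → supp (Φ ω) ≤ 𝓥

/-- Minimal enclosures: nonzero enclosures which contain no other nonzero enclosure. -/
def IsMinimalEnclosure (Φ : Module.End ℂ (h →L[ℂ] h)) (𝓥 : Submodule ℂ h) : Prop :=
  IsEnclosure Φ 𝓥 ∧ 𝓥 ≠ ⊥ ∧ ∀ 𝓦 : Submodule ℂ h, IsEnclosure Φ 𝓦 → 𝓦 ≤ 𝓥 → 𝓦 = ⊥ ∨ 𝓦 = 𝓥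

/-- The absorption operator `A(𝓥) = lim Φ*ⁿ(p_𝓥)` of an enclosure `𝓥` for the map `Φ` with Kraus
operators `K i`. -/
def absorption {v : ℕ} (K : Fin v → h →L[ℂ] h) (𝓥 : Submodule ℂ h) : h →L[ℂ] h :=
  limUnder atTop (fun n : ℕ => (krausDual K ^ n) 𝓥.starProjection)

end Channel

/-- The data of a homogeneous open quantum random walk on a locally finite lattice `V ⊂ ℝ^d`,
positively generated by the shifts `s i`, with local space `h` and local operators `L i`. -/
structure HOQRW (d v : ℕ) (h : Type*) [NormedAddCommGroup h] [InnerProductSpace ℂ h]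
    [FiniteDimensional ℂ h] [CompleteSpace h] where
  V : AddSubgroup (EuclideanSpace ℝ (Fin d))
  discrete : DiscreteTopology V
  s : Fin v → EuclideanSpace ℝ (Fin d)
  generates : AddSubmonoid.closure (Set.range s) = V.toAddSubmonoid
  L : Fin v → h →L[ℂ] h
  normalized : ∑ i, ContinuousLinearMap.adjoint (L i) * L i = 1

/-- Existence of a measure on sequences with prescribed masses of the cylinders. -/
theorem exists_measure_cylinder {ι : Type*} [Fintype ι] [Nonempty ι] [MeasurableSpace ι]
    [MeasurableSingletonClass ι] (p : ℕ → (ℕ → ι) → ℝ≥0∞)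
    (hdep : ∀ n j j', (∀ i < n, j i = j' i) → p n j = p n j')
    (hsum : ∀ n j, ∑ i, p (n + 1) (Function.update j n i) = p n j)
    (h0 : ∀ j, p 0 j = 1) :
    ∃ Q : Measure (ℕ → ι), IsProbabilityMeasure Q ∧
      ∀ n j, Q {x | ∀ i < n, x i = j i} = p n j := by
  classical
  have hfin : ∀ n j, p n j ≠ ∞ := by
    intro n
    induction n with
    | zero => intro j; simp [h0]
    | succ n ih =>
      intro j hj
      apply ih j
      rw [← hsum n j, ENNReal.sum_eq_top]
      exact ⟨j n, Finset.mem_univ _, by simpa using hj⟩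
  let i₀ : ι := Classical.arbitrary ι
  let ext : (n : ℕ) → (Finset.Iic n → ι) → ℕ → ι :=
    fun n x k => if hk : k ∈ Finset.Iic n then x ⟨k, hk⟩ else i₀
  let kf : (n : ℕ) → (Finset.Iic n → ι) → Measure ι := fun n x =>
    if p (n + 1) (ext n x) = 0 then Measure.dirac i₀ else
      ∑ i, (p (n + 2) (Function.update (ext n x) (n + 1) i) / p (n + 1) (ext n x)) •
        Measure.dirac i
  let κ : (n : ℕ) → Kernel (Finset.Iic n → ι) ι := fun n => Kernel.ofFunOfCountable (kf n)
  have hκ : ∀ n, IsMarkovKernel (κ n) := by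
    intro n
    refine ⟨fun x => ⟨?_⟩⟩
    change kf n x Set.univ = 1
    by_cases hx : p (n + 1) (ext n x) = 0
    · simp [kf, hx]
    · simp only [kf, hx, if_false]
      simp only [Measure.coe_finsetSum, Finset.sum_apply, Measure.smul_apply, measure_univ,
        smul_eq_mul, mul_one]
      simp only [div_eq_mul_inv]
      rw [← Finset.sum_mul, hsum]
      exact ENNReal.mul_inv_cancel hx (hfin _ _)
  let μ₀ : Measure ι := ∑ i, p 1 (fun _ => i) • Measure.dirac i
  have hp1 : ∀ (j : ℕ → ι), p 1 (fun _ => j 0) = p 1 j :=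
    fun j => hdep 1 _ _ (by intro i hi; interval_cases i; rfl)
  have hμ₀ : IsProbabilityMeasure μ₀ := by
    refine ⟨?_⟩
    simp only [μ₀, Measure.coe_finsetSum, Finset.sum_apply, Measure.smul_apply, measure_univ,
        smul_eq_mul, mul_one]
    rw [← h0 (fun _ => i₀), ← hsum]
    refine Finset.sum_congr rfl fun i _ => hdep 1 _ _ ?_
    intro k hk; interval_cases k; simp
  let Q : Measure (ℕ → ι) := Kernel.trajMeasure (X := fun _ => ι) μ₀ κ
  have hQ : IsProbabilityMeasure Q := by
    change IsProbabilityMeasure (Kernel.trajMeasure (X := fun _ => ι) μ₀ κ)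
    infer_instance
  refine ⟨Q, hQ, ?_⟩
  have hQ0 : Q.map (fun x => x 0) = μ₀ := by
    have h1 : Q.map (Preorder.frestrictLe (π := fun _ => ι) 0)
        = μ₀.map (MeasurableEquiv.piUnique (fun _ : Finset.Iic 0 => ι)).symm := by
      change (Kernel.trajMeasure (X := fun _ => ι) μ₀ κ).map _ = _
      rw [Kernel.trajMeasure, Measure.map_comp _ _ (by fun_prop), Kernel.traj_map_frestrictLe,
        Kernel.partialTraj_self, Measure.id_comp]
    have h2 : (fun x : ℕ → ι => x 0) = (fun y : Finset.Iic 0 → ι => y ⟨0, by simp⟩) ∘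
        (Preorder.frestrictLe (π := fun _ => ι) 0) := rfl
    rw [h2, ← Measure.map_map (by fun_prop) (by fun_prop), h1,
      Measure.map_map (by fun_prop) (by fun_prop)]
    exact Measure.map_id
  have hcyl : ∀ (n : ℕ) (j : ℕ → ι), {x : ℕ → ι | ∀ i < n + 1, x i = j i} =
      Preorder.frestrictLe (π := fun _ => ι) n ⁻¹' {Preorder.frestrictLe (π := fun _ => ι) n j} := by
    intro n j
    ext x
    simp only [Set.mem_ofPred_eq, Set.mem_preimage, Set.mem_singleton_iff, funext_iff,
      Preorder.frestrictLe_apply, Subtype.forall, Finset.mem_Iic, Nat.lt_succ_iff]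
  intro n j
  induction n with
  | zero => simp [h0]
  | succ n ih =>
    cases n with
    | zero =>
      have h3 : {x : ℕ → ι | ∀ i < 0 + 1, x i = j i} = (fun x : ℕ → ι => x 0) ⁻¹' {j 0} := by
        ext x; simp
      rw [h3, ← Measure.map_apply (by fun_prop) (measurableSet_singleton _), hQ0]
      simp only [μ₀, Measure.coe_finsetSum, Finset.sum_apply, Measure.smul_apply, smul_eq_mul]
      rw [Finset.sum_eq_single (j 0)]
      · simp [hp1]
      · intro b _ hb
        simp [hb]
      · simp
    | succ n =>
      have h4 := Kernel.map_frestrictLe_trajMeasure_compProd_eq_map_trajMeasure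
        (X := fun _ => ι) (μ₀ := μ₀) (κ := κ) (a := n)
      have h5 : {x : ℕ → ι | ∀ i < n + 1 + 1, x i = j i} =
          (fun x : ℕ → ι => (Preorder.frestrictLe (π := fun _ => ι) n x, x (n + 1))) ⁻¹'
            ({Preorder.frestrictLe (π := fun _ => ι) n j} ×ˢ {j (n + 1)}) := by
        ext x
        rw [Set.mk_preimage_prod, ← hcyl]
        simp only [Set.mem_ofPred_eq, Set.mem_inter_iff, Set.mem_preimage, Set.mem_singleton_iff]
        exact Nat.forall_lt_succ_right
      have h6 : ∀ i < n + 1, ext n (Preorder.frestrictLe (π := fun _ => ι) n j) i = j i := by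
        intro i hi
        simp [ext, Nat.lt_succ_iff.1 hi]
      rw [h5, ← Measure.map_apply (by fun_prop)
        ((measurableSet_singleton _).prod (measurableSet_singleton _))]
      change (Kernel.trajMeasure (X := fun _ => ι) μ₀ κ).map _ _ = _
      rw [← h4, Measure.compProd_apply_prod (measurableSet_singleton _) (measurableSet_singleton _),
        lintegral_singleton, Measure.map_apply (by fun_prop) (measurableSet_singleton _), ← hcyl]
      change kf n _ _ * Q _ = _
      rw [ih]
      have h7 : p (n + 1) (ext n (Preorder.frestrictLe (π := fun _ => ι) n j)) = p (n + 1) j :=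
        hdep _ _ _ h6
      by_cases hz : p (n + 1) j = 0
      · rw [hz, mul_zero]
        have := hsum (n + 1) j
        rw [hz, Finset.sum_eq_zero_iff] at this
        simpa using (this (j (n + 1)) (Finset.mem_univ _)).symm
      · have h8 : p (n + 2) (Function.update
            (ext n (Preorder.frestrictLe (π := fun _ => ι) n j)) (n + 1) (j (n + 1)))
            = p (n + 2) j := by
          apply hdep
          intro i hi
          rcases Nat.lt_succ_iff_lt_or_eq.1 hi with hi | rfl
          · rw [Function.update_of_ne hi.ne, h6 i hi]
          · simp
        simp only [kf, h7, hz, if_false, Measure.coe_finsetSum, Finset.sum_apply,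
          Measure.smul_apply, smul_eq_mul]
        rw [Finset.sum_eq_single (j (n + 1))]
        · rw [h8]
          simp only [Measure.dirac_apply, Set.indicator_of_mem, Set.mem_singleton_iff, Pi.one_apply,
            mul_one]
          exact ENNReal.div_mul_cancel hz (hfin _ _)
        · intro b _ hb
          simp [hb]
        · simp

namespace HOQRW

variable {d v : ℕ} {h : Type*} [NormedAddCommGroup h] [InnerProductSpace ℂ h]
  [FiniteDimensional ℂ h] [CompleteSpace h]

/-- An initial state `∑ k, ρ(k) ⊗ |k⟩⟨k|` of the walk, diagonal with respect to the position. -/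
structure InitialState (W : HOQRW d v h) where
  ρ : W.V → h →L[ℂ] h
  isPositive : ∀ k, (ρ k).IsPositive
  hasSum_tr : HasSum (fun k => tr (ρ k)) 1

/-- The sample space `V × J^ℕ`. In `ω = (k, j)`, `j n` is the index of the `(n + 1)`-st shift. -/
abbrev Omega (W : HOQRW d v h) : Type := W.V × (ℕ → Fin v)

/-- `L_{j_n} ⋯ L_{j_1} σ L_{j_1}* ⋯ L_{j_n}*`. -/
def branch (W : HOQRW d v h) (σ : h →L[ℂ] h) (j : ℕ → Fin v) : ℕ → h →L[ℂ] h
  | 0 => σ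
  | n + 1 => W.L (j n) * branch W σ j n * ContinuousLinearMap.adjoint (W.L (j n))

variable {W : HOQRW d v h}

theorem branch_congr (σ : h →L[ℂ] h) {j j' : ℕ → Fin v} :
    ∀ {n : ℕ}, (∀ i < n, j i = j' i) → W.branch σ j n = W.branch σ j' n
  | 0, _ => rfl
  | n + 1, hj => by
    rw [branch, branch, branch_congr σ (fun i hi => hj i (hi.trans n.lt_succ_self)),
      hj n n.lt_succ_self]

theorem branch_isPositive {σ : h →L[ℂ] h} (hσ : σ.IsPositive) (j : ℕ → Fin v) :
    ∀ n : ℕ, (W.branch σ j n).IsPositive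
  | 0 => hσ
  | n + 1 => (branch_isPositive hσ j n).conj_adjoint (W.L (j n))

theorem tr_re_nonneg {σ : h →L[ℂ] h} (hσ : σ.IsPositive) : 0 ≤ (tr σ).re :=
  (Complex.le_def.1 ((ContinuousLinearMap.isPositive_toLinearMap_iff σ).2 hσ).trace_nonneg).1

theorem sum_tr_conj (σ : h →L[ℂ] h) :
    ∑ i, (tr (W.L i * σ * ContinuousLinearMap.adjoint (W.L i))).re = (tr σ).re := by
  have tr_sum : ∀ f : Fin v → h →L[ℂ] h, tr (∑ i, f i) = ∑ i, tr (f i) := by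
    intro f
    simp [tr]
  have h1 : tr σ = ∑ i, tr (σ * (ContinuousLinearMap.adjoint (W.L i) * W.L i)) := by
    rw [← tr_sum, ← Finset.mul_sum, W.normalized, mul_one]
  rw [← Complex.re_sum, h1]
  congr 1
  refine Finset.sum_congr rfl fun i _ => ?_
  rw [mul_assoc, tr_mul_comm, mul_assoc]

/-- The defining property of the measure `ℙ_ρ`: the masses of the cylinders. -/
def IsPathMeasure (ρ : W.InitialState) (P : Measure W.Omega) : Prop :=
  ∀ (k : W.V) (n : ℕ) (j : ℕ → Fin v),
    P {ω | ω.1 = k ∧ ∀ i < n, ω.2 i = j i} = ENNReal.ofReal (tr (W.branch (ρ.ρ k) j n)).re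

theorem exists_isPathMeasure (ρ : W.InitialState) :
    ∃ P : Measure W.Omega, IsProbabilityMeasure P ∧ IsPathMeasure ρ P := by
  classical
  have hre : HasSum (fun k => (tr (ρ.ρ k)).re) 1 := by
    simpa using Complex.hasSum_re ρ.hasSum_tr
  have hnn : ∀ k, 0 ≤ (tr (ρ.ρ k)).re := fun k => tr_re_nonneg (ρ.isPositive k)
  have hne : Nonempty (Fin v) := by
    by_contra hv
    rw [not_nonempty_iff] at hv
    have h0 : ∀ k, (tr (ρ.ρ k)).re = 0 := fun k => by
      rw [← sum_tr_conj (W := W)]; simp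
    simp only [h0] at hre
    exact zero_ne_one (hasSum_zero.unique hre)
  have key : ∀ k, ∃ Q : Measure (ℕ → Fin v), IsProbabilityMeasure Q ∧ ∀ n j,
      ENNReal.ofReal (tr (ρ.ρ k)).re * Q {x | ∀ i < n, x i = j i}
        = ENNReal.ofReal (tr (W.branch (ρ.ρ k) j n)).re := by
    intro k
    by_cases hk : ENNReal.ofReal (tr (ρ.ρ k)).re = 0
    · refine ⟨Measure.dirac (fun _ => Classical.arbitrary _), inferInstance, fun n j => ?_⟩
      rw [hk, zero_mul, eq_comm]
      induction n with
      | zero => exact hk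
      | succ n ih =>
        rw [ENNReal.ofReal_eq_zero] at ih ⊢
        rw [← sum_tr_conj (W := W)] at ih
        refine le_trans ?_ ih
        exact Finset.single_le_sum (f := fun i => (tr (W.L i * W.branch (ρ.ρ k) j n *
          ContinuousLinearMap.adjoint (W.L i))).re) (fun i _ => tr_re_nonneg
            ((branch_isPositive (ρ.isPositive k) j n).conj_adjoint (W.L i))) (Finset.mem_univ (j n))
    · obtain ⟨Q, hQ, hc⟩ := exists_measure_cylinder
        (fun n j => ENNReal.ofReal (tr (W.branch (ρ.ρ k) j n)).re /
          ENNReal.ofReal (tr (ρ.ρ k)).re)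
        (fun n j j' hj => by simp only [branch_congr _ hj])
        (fun n j => by
          simp only [div_eq_mul_inv]
          rw [← Finset.sum_mul, ← ENNReal.ofReal_sum_of_nonneg
            (fun i _ => tr_re_nonneg (branch_isPositive (ρ.isPositive k) _ _))]
          congr 2
          rw [← sum_tr_conj (W := W)]
          refine Finset.sum_congr rfl fun i _ => ?_
          rw [branch, Function.update_self,
            branch_congr (W := W) (ρ.ρ k) (j := Function.update j n i) (j' := j)
              (fun l hl => Function.update_of_ne hl.ne _ _)])
        (fun j => ENNReal.div_self hk ENNReal.ofReal_ne_top)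
      refine ⟨Q, hQ, fun n j => ?_⟩
      rw [hc, ENNReal.mul_div_cancel hk ENNReal.ofReal_ne_top]
  choose Q hQ hc using key
  have hcyl : IsPathMeasure ρ (Measure.sum fun k =>
      ENNReal.ofReal (tr (ρ.ρ k)).re • (Measure.dirac k).prod (Q k)) := by
    intro k n j
    have hset : {ω : W.Omega | ω.1 = k ∧ ∀ i < n, ω.2 i = j i} =
        {k} ×ˢ {x | ∀ i < n, x i = j i} := by
      ext ω; simp
    have hm : MeasurableSet {x : ℕ → Fin v | ∀ i < n, x i = j i} := by
      measurability
    rw [hset, Measure.sum_apply _ ((measurableSet_singleton k).prod hm), tsum_eq_single k]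
    · simp only [Measure.smul_apply, Measure.prod_prod, smul_eq_mul, Measure.dirac_apply,
        Set.indicator_of_mem, Set.mem_singleton_iff, Pi.one_apply, one_mul, hc]
    · intro k' hk'
      simp [Measure.prod_prod, hk']
  refine ⟨_, ⟨?_⟩, hcyl⟩
  rw [Measure.sum_apply _ MeasurableSet.univ]
  simp only [Measure.smul_apply, measure_univ, smul_eq_mul, mul_one]
  rw [← ENNReal.ofReal_tsum_of_nonneg hnn hre.summable, hre.tsum_eq, ENNReal.ofReal_one]

/-- The law `ℙ_ρ` of the walk with initial state `ρ`: the measure on `V × J^ℕ` with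
`ℙ_ρ({k}) = Tr ρ(k)` and
`ℙ_ρ({(k, j_1, …, j_n)}) = Tr(L_{j_n} ⋯ L_{j_1} ρ(k) L_{j_1}* ⋯ L_{j_n}*)`. -/
def pathMeasure (ρ : W.InitialState) : Measure W.Omega := (exists_isPathMeasure ρ).choose

instance (ρ : W.InitialState) : IsProbabilityMeasure (pathMeasure ρ) :=
  (exists_isPathMeasure ρ).choose_spec.1

theorem isPathMeasure_pathMeasure (ρ : W.InitialState) : IsPathMeasure ρ (pathMeasure ρ) :=
  (exists_isPathMeasure ρ).choose_spec.2

/-- The position process. -/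
def X (W : HOQRW d v h) : ℕ → W.Omega → EuclideanSpace ℝ (Fin d)
  | 0, ω => ω.1
  | n + 1, ω => X W n ω + W.s (ω.2 n)

/-- The internal state process. -/
def rho (ρ : W.InitialState) : ℕ → W.Omega → h →L[ℂ] h
  | 0, ω => (tr (ρ.ρ ω.1))⁻¹ • ρ.ρ ω.1
  | n + 1, ω =>
    (tr (W.L (ω.2 n) * rho ρ n ω * ContinuousLinearMap.adjoint (W.L (ω.2 n))))⁻¹ •
      (W.L (ω.2 n) * rho ρ n ω * ContinuousLinearMap.adjoint (W.L (ω.2 n)))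

/-- The martingale `Y_n = Tr(A(𝓥) ρ_n)`. -/
def Y (ρ : W.InitialState) (𝓥 : Submodule ℂ h) (n : ℕ) (ω : W.Omega) : ℝ :=
  (tr (absorption W.L 𝓥 * rho ρ n ω)).re

/-- The (almost sure) limit `Y_∞` of the martingale `Y_n`. -/
def Yinf (ρ : W.InitialState) (𝓥 : Submodule ℂ h) (ω : W.Omega) : ℝ :=
  limUnder atTop (fun n => Y ρ 𝓥 n ω)

/-- The measure `ℙ'_ρ` with density `Y_∞ / 𝔼_ρ[Y_0]` with respect to `ℙ_ρ`. -/
def absorbedMeasure (ρ : W.InitialState) (𝓥 : Submodule ℂ h) : Measure W.Omega :=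
  (pathMeasure ρ).withDensity
    (fun ω => ENNReal.ofReal (Yinf ρ 𝓥 ω / ∫ ω', Y ρ 𝓥 0 ω' ∂pathMeasure ρ))

/-- The deformed Kraus operators `e^{u·s_i/2} p̃ L_i p̃`, where `p̃` is the support projection of
`A(𝓥)`. -/
def tilt (W : HOQRW d v h) (𝓥 : Submodule ℂ h) (u : EuclideanSpace ℝ (Fin d)) (i : Fin v) :
    h →L[ℂ] h :=
  (Real.exp (⟪u, W.s i⟫_ℝ / 2) : ℂ) •
    ((supp (absorption W.L 𝓥)).starProjection * W.L i *
      (supp (absorption W.L 𝓥)).starProjection)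

/-- The spectral radius `λ_u` of the deformed map. -/
def lam (W : HOQRW d v h) (𝓥 : Submodule ℂ h) (u : EuclideanSpace ℝ (Fin d)) : ℝ :=
  (spectralRadius ℂ (krausMap (W.tilt 𝓥 u))).toReal

/-- `λ''_u - (λ'_u)²`, where `λ'_u` and `λ''_u` are the first two derivatives of `t ↦ λ_{tu}`
at `t = 0`. -/
def quadForm (W : HOQRW d v h) (𝓥 : Submodule ℂ h) (u : EuclideanSpace ℝ (Fin d)) : ℝ :=
  iteratedDeriv 2 (fun t : ℝ => W.lam 𝓥 (t • u)) 0 - deriv (fun t : ℝ => W.lam 𝓥 (t • u)) 0 ^ 2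

/-- The vector `∑ i, Tr(L_i τ L_i*) s_i`. -/
def drift (W : HOQRW d v h) (τ : h →L[ℂ] h) : EuclideanSpace ℝ (Fin d) :=
  ∑ i, (tr (W.L i * τ * ContinuousLinearMap.adjoint (W.L i))).re • W.s i

end HOQRW

end OQW
end

noncomputable section

namespace OQW

/-! ### Trace pairing, positivity, and Kraus maps -/

section Operators

variable {h : Type*} [NormedAddCommGroup h] [InnerProductSpace ℂ h] [FiniteDimensional ℂ h]
  [CompleteSpace h]

/-! Write A for the absorption operator of V, P for its support projection, and T_i = P L_i P. The
kernel of A is invariant under every L_i, so P L_i P = P L_i. Hence the compressed dual map b ↦ ∑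
T_i* b T_i agrees with the original dual map on operators b = PbP, and in particular it fixes A.

The algebraic core is `MinimalInvariant.exists_eq_smul`: the fixed points of the compressed dual map
are the multiples of A. For a self-adjoint fixed point b, let l be the minimum of its quadratic form
on the unit sphere of V. The form of c = b - lA is nonnegative on V and has a null vector there. Its
null vectors in V form an invariant subspace, so by minimality it vanishes on V
(`inner_eq_zero_of_fixed`). Then |c| ≤ εA + C(A - p_V) as forms for every ε > 0. Iterating the dual
map fixes c and A and sends A - p_V to 0, so c = 0 (`eq_zero_of_fixed`).

An invariant state τ on V gives the left eigenvector b ↦ tr(τ b), normalized by tr(τ A) = 1. So 1 is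
a simple eigenvalue, and the inverse function theorem yields an analytic branch (α(z), μ(z)) of
eigenpairs of ∑ exp(z u·s_i) T_i* · T_i through (A, 1) (`SimpleFixed.exists_perturbation`). For
small real t, α(t) is strictly positive on the support of A, which forces |μ(t)| to be the spectral
radius (`spectralRadius_krausMap`); local uniqueness makes μ(t) real, so μ(t) = λ_{tu}. The
perturbation formulas give λ'_u = u·m and show that λ''_u - (λ'_u)² is a quadratic form in u, which
defines D.

On the probabilistic side, Y_n is a bounded martingale, so integrating a function of the first n
steps against the new measure amounts to weighting it by tr(A ρ_n) and dividing by the mean of Y_0.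
The numbers w_n(b) = E[exp(z u·(X_n - X_0)) tr(b ρ_n)] evolve by the tilted dual map applied to b,
so w_n(α(z)) = μ(z)^n w_0(α(z)). With z = i/√n, replacing A by α(z) costs o(1) uniformly, and a
second-order expansion of μ gives the Gaussian characteristic function. No spectral gap is needed,
since α(z) is an exact eigenvector. That characteristic functions have modulus at most 1 also shows
D ≥ 0. The rate for the mean comes from telescoping a Poisson equation for the compressed dual map
(`integral_inner_mul_tr`). -/

theorem op_mul_apply (x y : h →L[ℂ] h) (φ : h) : (x * y) φ = x (y φ) := rfl

theorem tr_add (x y : h →L[ℂ] h) : tr (x + y) = tr x + tr y := by simp [tr]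

theorem tr_sub (x y : h →L[ℂ] h) : tr (x - y) = tr x - tr y := by simp [tr]

theorem tr_smul (c : ℂ) (x : h →L[ℂ] h) : tr (c • x) = c * tr x := by simp [tr]

theorem tr_sum {ι : Type*} (s : Finset ι) (f : ι → h →L[ℂ] h) :
    tr (∑ i ∈ s, f i) = ∑ i ∈ s, tr (f i) := by simp [tr]

theorem tr_zero : tr (0 : h →L[ℂ] h) = 0 := by simp [tr]

/-- The trace as a continuous linear functional. -/
def trL : (h →L[ℂ] h) →L[ℂ] ℂ :=
  LinearMap.toContinuousLinearMap
    { toFun := tr, map_add' := tr_add, map_smul' := tr_smul }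

@[simp] theorem trL_apply (x : h →L[ℂ] h) : trL x = tr x := rfl

/-- The functional `x ↦ tr (σ x)`. -/
def trMulL (σ : h →L[ℂ] h) : (h →L[ℂ] h) →L[ℂ] ℂ :=
  trL.comp (ContinuousLinearMap.mul ℂ (h →L[ℂ] h) σ)

@[simp] theorem trMulL_apply (σ x : h →L[ℂ] h) : trMulL σ x = tr (σ * x) := rfl

theorem tr_mul_rankOne (x : h →L[ℂ] h) (φ ψ : h) :
    tr (x * InnerProductSpace.rankOne ℂ φ ψ) = ⟪ψ, x φ⟫_ℂ := by
  have : x * InnerProductSpace.rankOne ℂ φ ψ = InnerProductSpace.rankOne ℂ (x φ) ψ :=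
    InnerProductSpace.comp_rankOne ..
  rw [this]
  exact InnerProductSpace.trace_rankOne _ _

theorem ext_inner_map_self {x y : h →L[ℂ] h} (hxy : ∀ φ, ⟪φ, x φ⟫_ℂ = ⟪φ, y φ⟫_ℂ) : x = y := by
  have := (ext_inner_map (x : h →ₗ[ℂ] h) (y : h →ₗ[ℂ] h)).1 (fun φ => by
    have := congrArg (starRingEnd ℂ) (hxy φ)
    simpa only [inner_conj_symm, ContinuousLinearMap.coe_coe] using this)
  exact ContinuousLinearMap.coe_injective this

/-- The trace pairing is nondegenerate: rank-one test operators recover the quadratic form, which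
over ℂ determines the operator. -/
theorem eq_of_tr_mul {x y : h →L[ℂ] h} (hxy : ∀ σ, tr (x * σ) = tr (y * σ)) : x = y :=
  ext_inner_map_self fun φ => by
    rw [← tr_mul_rankOne, hxy, tr_mul_rankOne]

theorem tr_mul_re_nonneg {x σ : h →L[ℂ] h} (hx : x.IsPositive) (hσ : σ.IsPositive) :
    0 ≤ (tr (x * σ)).re := by
  obtain ⟨m, u, rfl⟩ := ContinuousLinearMap.isPositive_iff_eq_sum_rankOne.1 hσ
  rw [Finset.mul_sum, tr_sum, Complex.re_sum]
  refine Finset.sum_nonneg fun i _ => ?_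
  rw [tr_mul_rankOne]
  exact hx.re_inner_nonneg_right _

theorem tr_rankOne (φ ψ : h) : tr (InnerProductSpace.rankOne ℂ φ ψ : h →L[ℂ] h) = ⟪ψ, φ⟫_ℂ :=
  InnerProductSpace.trace_rankOne _ _

theorem norm_le_tr {σ : h →L[ℂ] h} (hσ : σ.IsPositive) : ‖σ‖ ≤ (tr σ).re := by
  obtain ⟨m, u, rfl⟩ := ContinuousLinearMap.isPositive_iff_eq_sum_rankOne.1 hσ
  rw [tr_sum, Complex.re_sum]
  refine (norm_sum_le _ _).trans (Finset.sum_le_sum fun i _ => ?_)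
  rw [tr_rankOne, InnerProductSpace.norm_rankOne, inner_self_eq_norm_mul_norm (𝕜 := ℂ) (u i) |>.symm]
  rfl

theorem tr_eq_ofReal {σ : h →L[ℂ] h} (hσ : σ.IsPositive) : tr σ = ((tr σ).re : ℂ) := by
  obtain ⟨m, u, rfl⟩ := ContinuousLinearMap.isPositive_iff_eq_sum_rankOne.1 hσ
  rw [tr_sum, Complex.re_sum, Complex.ofReal_sum]
  refine Finset.sum_congr rfl fun i _ => ?_
  rw [tr_rankOne]
  exact (inner_self_ofReal_re (u i)).symm

theorem eq_zero_of_tr_eq_zero {σ : h →L[ℂ] h} (hσ : σ.IsPositive) (h0 : tr σ = 0) : σ = 0 := by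
  have := norm_le_tr hσ
  rw [h0] at this
  simpa using this

/-- In a decomposition of x into rank-one terms, the form at φ is the sum of the |⟪u i, φ⟫|², so all
these inner products vanish together. -/
theorem apply_eq_zero_of_inner_eq_zero {x : h →L[ℂ] h} (hx : x.IsPositive) {φ : h}
    (hφ : ⟪φ, x φ⟫_ℂ = 0) : x φ = 0 := by
  obtain ⟨m, u, rfl⟩ := ContinuousLinearMap.isPositive_iff_eq_sum_rankOne.1 hx
  have h1 : ∀ i, ⟪u i, φ⟫_ℂ = 0 := by
    simp only [sum_apply, InnerProductSpace.rankOne_apply, inner_sum,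
      inner_smul_right] at hφ
    have h2 : ∀ i, ⟪u i, φ⟫_ℂ * ⟪φ, u i⟫_ℂ = ((‖⟪u i, φ⟫_ℂ‖ ^ 2 : ℝ) : ℂ) := fun i => by
      rw [← inner_conj_symm φ, Complex.mul_conj']; norm_cast
    simp only [h2] at hφ
    norm_cast at hφ
    rw [Finset.sum_eq_zero_iff_of_nonneg (fun i _ => by positivity)] at hφ
    intro i
    simpa using hφ i (Finset.mem_univ _)
  simp [h1]

variable {v : ℕ} (K : Fin v → h →L[ℂ] h)

theorem krausMap_apply (σ : h →L[ℂ] h) :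
    krausMap K σ = ∑ i, K i * σ * ContinuousLinearMap.adjoint (K i) := rfl

theorem krausDual_apply (x : h →L[ℂ] h) :
    krausDual K x = ∑ i, ContinuousLinearMap.adjoint (K i) * x * K i := rfl

theorem inner_krausDual (x : h →L[ℂ] h) (φ ψ : h) :
    ⟪φ, krausDual K x ψ⟫_ℂ = ∑ i, ⟪K i φ, x (K i ψ)⟫_ℂ := by
  simp [krausDual_apply, sum_apply, ContinuousLinearMap.adjoint_inner_right]

theorem krausDual_adjoint (x : h →L[ℂ] h) :
    ContinuousLinearMap.adjoint (krausDual K x) = krausDual K (ContinuousLinearMap.adjoint x) := by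
  simp only [krausDual_apply, map_sum, ← ContinuousLinearMap.star_eq_adjoint, star_mul, star_star,
    mul_assoc]

theorem krausDual_isPositive {x : h →L[ℂ] h} (hx : x.IsPositive) :
    (krausDual K x).IsPositive := by
  rw [krausDual_apply]
  exact ContinuousLinearMap.isPositive_sum _ fun i _ => hx.adjoint_conj (K i)

theorem krausMap_isPositive {x : h →L[ℂ] h} (hx : x.IsPositive) :
    (krausMap K x).IsPositive := by
  rw [krausMap_apply]
  exact ContinuousLinearMap.isPositive_sum _ fun i _ => hx.conj_adjoint (K i)

theorem krausDual_pow_isPositive {x : h →L[ℂ] h} (hx : x.IsPositive) (n : ℕ) :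
    ((krausDual K ^ n) x).IsPositive := by
  induction n with
  | zero => exact hx
  | succ n ih => rw [pow_succ', Module.End.mul_apply]; exact krausDual_isPositive K ih

/-- The quadratic form of `x` is bounded in modulus by that of `G`. -/
def Dominated (x G : h →L[ℂ] h) : Prop := ∀ φ, ‖⟪φ, x φ⟫_ℂ‖ ≤ (⟪φ, G φ⟫_ℂ).re

variable {K}

/-- The form of the dual image at φ is the sum of the forms at the K i φ, so domination passes
through term by term. This replaces order preservation when x need not be self-adjoint. -/
theorem Dominated.krausDual {x G : h →L[ℂ] h} (hx : Dominated x G) :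
    Dominated (krausDual K x) (OQW.krausDual K G) := fun φ => by
  rw [inner_krausDual, inner_krausDual, Complex.re_sum]
  exact (norm_sum_le _ _).trans (Finset.sum_le_sum fun i _ => hx _)

theorem Dominated.krausDual_pow {x G : h →L[ℂ] h} (hx : Dominated x G) (n : ℕ) :
    Dominated ((OQW.krausDual K ^ n) x) ((OQW.krausDual K ^ n) G) := by
  induction n with
  | zero => exact hx
  | succ n ih =>
    rw [pow_succ', Module.End.mul_apply, Module.End.mul_apply]; exact ih.krausDual

end Operators

/-! ### Enclosures as invariant subspaces; positive operators and their supports -/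

section Enclosures

variable {h : Type*} [NormedAddCommGroup h] [InnerProductSpace ℂ h] [FiniteDimensional ℂ h]
  [CompleteSpace h] {v : ℕ}

theorem supp_le_iff {x : h →L[ℂ] h} {V : Submodule ℂ h} :
    supp x ≤ V ↔ ∀ φ ∈ Vᗮ, x φ = 0 := by
  rw [supp, Submodule.orthogonal_le_iff_orthogonal_le]
  rfl

theorem mem_of_forall_orthogonal {V : Submodule ℂ h} {x : h} (hx : ∀ φ ∈ Vᗮ, ⟪φ, x⟫_ℂ = 0) :
    x ∈ V := by
  rw [← Submodule.orthogonal_orthogonal V, Submodule.mem_orthogonal]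
  exact hx

/-- Test on the rank-one operator of x ∈ V: for φ ⊥ V, the form of its image at φ is the sum of the
|⟪φ, K i x⟫|², so every K i x is orthogonal to φ. -/
theorem isEnclosure_iff (K : Fin v → h →L[ℂ] h) (V : Submodule ℂ h) :
    IsEnclosure (krausMap K) V ↔ ∀ i, ∀ x ∈ V, K i x ∈ V := by
  constructor
  · intro hV i x hx
    have h1 := supp_le_iff.1 (hV (InnerProductSpace.rankOne ℂ x x)
      (InnerProductSpace.isPositive_rankOne_self x) (supp_le_iff.2 fun φ hφ => by
        rw [InnerProductSpace.rankOne_apply, (Submodule.mem_orthogonal _ _).1 hφ x hx, zero_smul]))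
    refine mem_of_forall_orthogonal fun φ hφ => ?_
    have h2 : ⟪φ, krausMap K (InnerProductSpace.rankOne ℂ x x) φ⟫_ℂ
        = ((∑ i, ‖⟪φ, K i x⟫_ℂ‖ ^ 2 : ℝ) : ℂ) := by
      rw [krausMap_apply, sum_apply, inner_sum, Complex.ofReal_sum]
      refine Finset.sum_congr rfl fun i _ => ?_
      simp only [op_mul_apply, InnerProductSpace.rankOne_apply, map_smul,
        inner_smul_right, ContinuousLinearMap.adjoint_inner_right]
      rw [← inner_conj_symm (K i x) φ, Complex.conj_mul']
      norm_cast
    rw [h1 φ hφ, inner_zero_right, eq_comm, Complex.ofReal_eq_zero,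
      Finset.sum_eq_zero_iff_of_nonneg (fun i _ => by positivity)] at h2
    simpa using h2 i (Finset.mem_univ _)
  · intro hV ω _ hω
    rw [supp_le_iff] at hω ⊢
    intro φ hφ
    rw [krausMap_apply, sum_apply]
    refine Finset.sum_eq_zero fun i _ => ?_
    simp only [op_mul_apply]
    rw [hω, map_zero]
    rw [Submodule.mem_orthogonal]
    intro x hx
    rw [ContinuousLinearMap.adjoint_inner_right]
    exact (Submodule.mem_orthogonal _ _).1 hφ _ (hV i x hx)

theorem krausDual_one {L : Fin v → h →L[ℂ] h}
    (hL : ∑ i, ContinuousLinearMap.adjoint (L i) * L i = 1) : krausDual L 1 = 1 := by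
  simp [krausDual_apply, hL]

theorem tr_krausMap {L : Fin v → h →L[ℂ] h}
    (hL : ∑ i, ContinuousLinearMap.adjoint (L i) * L i = 1) (σ : h →L[ℂ] h) :
    tr (krausMap L σ) = tr σ := by
  have := tr_mul_krausDual L σ 1
  rwa [krausDual_one hL, mul_one, mul_one, eq_comm] at this

theorem continuous_krausDual (K : Fin v → h →L[ℂ] h) : Continuous (krausDual K) :=
  LinearMap.continuous_of_finiteDimensional _

theorem continuous_krausMap (K : Fin v → h →L[ℂ] h) : Continuous (krausMap K) :=
  LinearMap.continuous_of_finiteDimensional _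

theorem tendsto_inner_apply {ι : Type*} {l : Filter ι} {a : ι → h →L[ℂ] h} {x : h →L[ℂ] h}
    (ha : Tendsto a l (𝓝 x)) (φ ψ : h) :
    Tendsto (fun n => ⟪φ, a n ψ⟫_ℂ) l (𝓝 ⟪φ, x ψ⟫_ℂ) := by
  have hc : Continuous fun y : h →L[ℂ] h => ⟪φ, y ψ⟫_ℂ := by fun_prop
  exact (hc.tendsto x).comp ha

theorem isPositive_iff_inner (x : h →L[ℂ] h) :
    x.IsPositive ↔ ∀ φ, ⟪φ, x φ⟫_ℂ = ((⟪φ, x φ⟫_ℂ).re : ℂ) ∧ 0 ≤ (⟪φ, x φ⟫_ℂ).re := by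
  have hsymm : ∀ φ, ⟪x φ, φ⟫_ℂ = (starRingEnd ℂ) ⟪φ, x φ⟫_ℂ := fun φ => (inner_conj_symm _ _).symm
  rw [ContinuousLinearMap.isPositive_iff_complex]
  refine forall_congr' fun φ => ?_
  rw [hsymm]
  simp only [RCLike.re_to_complex, Complex.conj_re]
  refine and_congr_left fun _ => ⟨fun h => ?_, fun h => ?_⟩
  · have := congrArg (starRingEnd ℂ) h
    simpa using this.symm
  · rw [h]; simp

theorem isPositive_of_tendsto {ι : Type*} {l : Filter ι} [l.NeBot] {a : ι → h →L[ℂ] h}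
    {x : h →L[ℂ] h} (ha : Tendsto a l (𝓝 x)) (hp : ∀ n, (a n).IsPositive) : x.IsPositive := by
  rw [isPositive_iff_inner]
  intro φ
  have h1 := tendsto_inner_apply ha φ φ
  have h2 := (Complex.continuous_re.tendsto _).comp h1
  refine ⟨tendsto_nhds_unique h1 ?_, ge_of_tendsto' h2 fun n =>
    ((isPositive_iff_inner _).1 (hp n) φ).2⟩
  refine (((Complex.continuous_ofReal.tendsto _).comp h2)).congr fun n => ?_
  exact ((isPositive_iff_inner _).1 (hp n) φ).1.symm

theorem inner_starProjection_self (V : Submodule ℂ h) (φ : h) :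
    ⟪φ, V.starProjection φ⟫_ℂ = ((‖V.starProjection φ‖ ^ 2 : ℝ) : ℂ) := by
  have h1 : ⟪φ, V.starProjection φ⟫_ℂ = ⟪V.starProjection φ, V.starProjection φ⟫_ℂ := by
    rw [Submodule.inner_starProjection_left_eq_right, Submodule.starProjection_eq_self_iff.2
      (Submodule.starProjection_apply_mem V φ)]
  rw [h1, inner_self_eq_norm_sq_to_K]
  norm_cast

/-- A positive operator acting as the identity on `V` is block diagonal with respect to `V`. -/
theorem inner_eq_add_of_eqOn {G : h →L[ℂ] h} (hG : G.IsPositive) {V : Submodule ℂ h}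
    (hV : ∀ x ∈ V, G x = x) (φ : h) :
    (⟪φ, G φ⟫_ℂ).re = ‖V.starProjection φ‖ ^ 2 +
      (⟪φ - V.starProjection φ, G (φ - V.starProjection φ)⟫_ℂ).re := by
  set x := V.starProjection φ with hx
  have hxV : x ∈ V := Submodule.starProjection_apply_mem V φ
  have hGx : G x = x := hV x hxV
  have h1 : ⟪φ, x⟫_ℂ = ((‖x‖ ^ 2 : ℝ) : ℂ) := inner_starProjection_self V φ
  have h2 : ⟪x, φ⟫_ℂ = ((‖x‖ ^ 2 : ℝ) : ℂ) := by
    rw [← inner_conj_symm, h1, Complex.conj_ofReal]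
  have h3 : ⟪x, G φ⟫_ℂ = ((‖x‖ ^ 2 : ℝ) : ℂ) := by
    rw [← hG.inner_left_eq_inner_right, hGx, h2]
  have h4 : ⟪x, x⟫_ℂ = ((‖x‖ ^ 2 : ℝ) : ℂ) := by
    rw [inner_self_eq_norm_sq_to_K]; norm_cast
  rw [map_sub, hGx, inner_sub_left, inner_sub_right, inner_sub_right, h1, h3, h4]
  simp only [Complex.sub_re, Complex.ofReal_re]
  ring

theorem isPositive_sub_starProjection {G : h →L[ℂ] h} (hG : G.IsPositive) {V : Submodule ℂ h}
    (hV : ∀ x ∈ V, G x = x) : (G - V.starProjection).IsPositive := by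
  rw [isPositive_iff_inner]
  intro φ
  have h1 := inner_eq_add_of_eqOn hG hV φ
  have h2 := ((isPositive_iff_inner _).1 hG φ).1
  have h3 := ((isPositive_iff_inner _).1 hG (φ - V.starProjection φ)).2
  rw [sub_apply, inner_sub_right, inner_starProjection_self]
  constructor
  · rw [Complex.sub_re, Complex.ofReal_re, Complex.ofReal_sub, ← h2]
  · rw [Complex.sub_re, Complex.ofReal_re]; linarith

/-- A positive operator is bounded below on its support. -/
theorem exists_lower_bound_supp {x : h →L[ℂ] h} (hx : x.IsPositive) :
    ∃ δ > 0, ∀ φ, δ * ‖(supp x).starProjection φ‖ ^ 2 ≤ (⟪φ, x φ⟫_ℂ).re := by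
  have hker : ∀ φ : h, x (φ - (supp x).starProjection φ) = 0 := fun φ => by
    have := Submodule.sub_starProjection_mem_orthogonal (K := supp x) φ
    rw [supp, Submodule.orthogonal_orthogonal] at this
    exact this
  have hred : ∀ φ : h, ⟪φ, x φ⟫_ℂ
      = ⟪(supp x).starProjection φ, x ((supp x).starProjection φ)⟫_ℂ := fun φ => by
    have h1 : x φ = x ((supp x).starProjection φ) := by
      rw [← sub_eq_zero, ← map_sub, hker]
    rw [h1, ← sub_eq_zero, ← inner_sub_left, ← hx.inner_left_eq_inner_right, hker, inner_zero_left]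
  -- The constant is the minimum of the form over the unit sphere of the support; it is positive
  -- because a null vector would lie in the kernel, hence be orthogonal to itself.
  have hcomp : IsCompact (Metric.sphere (0 : h) 1 ∩ (supp x : Set h)) :=
    haveI := FiniteDimensional.proper_rclike ℂ h
    (isCompact_sphere 0 1).inter_right (Submodule.closed_of_finiteDimensional _)
  have hcont : Continuous fun φ : h => (⟪φ, x φ⟫_ℂ).re := by fun_prop
  by_cases hne : (Metric.sphere (0 : h) 1 ∩ (supp x : Set h)).Nonempty
  · obtain ⟨φ₀, hφ₀, hmin⟩ := hcomp.exists_isMinOn hne hcont.continuousOn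
    refine ⟨(⟪φ₀, x φ₀⟫_ℂ).re, ?_, fun φ => ?_⟩
    · refine lt_of_le_of_ne ((isPositive_iff_inner _).1 hx φ₀).2 fun h0 => ?_
      have h1 : ⟪φ₀, x φ₀⟫_ℂ = 0 := by
        rw [((isPositive_iff_inner _).1 hx φ₀).1, ← h0, Complex.ofReal_zero]
      have h2 : φ₀ ∈ LinearMap.ker (x : h →ₗ[ℂ] h) := apply_eq_zero_of_inner_eq_zero hx h1
      have h3 := (Submodule.mem_orthogonal _ _).1 hφ₀.2 φ₀ h2
      rw [inner_self_eq_zero] at h3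
      simpa [h3] using hφ₀.1
    · rw [hred φ]
      have hψ := ((isPositive_iff_inner _).1 hx ((supp x).starProjection φ)).2
      have hmemψ := Submodule.starProjection_apply_mem (supp x) φ
      generalize (supp x).starProjection φ = ψ at hψ hmemψ ⊢
      by_cases h0 : ψ = 0
      · simp [h0]
      · have hn : ‖ψ‖ ≠ 0 := norm_ne_zero_iff.2 h0
        have hmem : ((‖ψ‖⁻¹ : ℝ) : ℂ) • ψ ∈ Metric.sphere (0 : h) 1 ∩ (supp x : Set h) := by
          refine ⟨by simp [norm_smul, hn], Submodule.smul_mem _ _ hmemψ⟩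
        have h1 := hmin hmem
        simp only [Set.mem_ofPred_eq, map_smul, inner_smul_left, inner_smul_right,
          Complex.conj_ofReal, Complex.re_ofReal_mul] at h1
        calc _ ≤ (‖ψ‖⁻¹ * (‖ψ‖⁻¹ * (⟪ψ, x ψ⟫_ℂ).re)) * ‖ψ‖ ^ 2 := by gcongr
          _ = _ := by field_simp
  -- The support is trivial here, so any positive constant works.
  · refine ⟨1, one_pos, fun φ => ?_⟩
    have h0 : (supp x).starProjection φ = 0 := by
      by_contra h0
      refine hne ⟨((‖(supp x).starProjection φ‖⁻¹ : ℝ) : ℂ) • (supp x).starProjection φ, ?_, ?_⟩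
      · simp [norm_smul, h0]
      · exact Submodule.smul_mem _ _ (Submodule.starProjection_apply_mem _ _)
    simpa [h0] using ((isPositive_iff_inner _).1 hx φ).2

end Enclosures

/-! ### The absorption operator and the fixed points of the dual map -/

section Absorption

variable {h : Type*} [NormedAddCommGroup h] [InnerProductSpace ℂ h] [FiniteDimensional ℂ h]
  [CompleteSpace h] {v : ℕ} {L : Fin v → h →L[ℂ] h} {V : Submodule ℂ h}

theorem starProjection_isPositive (V : Submodule ℂ h) : V.starProjection.IsPositive := by
  rw [isPositive_iff_inner]
  intro φ
  rw [inner_starProjection_self]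
  exact ⟨rfl, by rw [Complex.ofReal_re]; positivity⟩

/-- Invariance keeps L i x in V, where G is the identity, and the normalization then collapses the
sum. -/
theorem krausDual_eqOn (hL : ∑ i, ContinuousLinearMap.adjoint (L i) * L i = 1)
    (hV : ∀ i, ∀ x ∈ V, L i x ∈ V) {G : h →L[ℂ] h} (hG : ∀ x ∈ V, G x = x) :
    ∀ x ∈ V, krausDual L G x = x := by
  intro x hx
  have h1 : krausDual L G x = (∑ i, ContinuousLinearMap.adjoint (L i) * L i) x := by
    rw [krausDual_apply, sum_apply, sum_apply]
    refine Finset.sum_congr rfl fun i _ => ?_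
    simp only [op_mul_apply]
    rw [hG _ (hV i x hx)]
  rw [h1, hL]
  rfl

theorem krausDual_pow_eqOn (hL : ∑ i, ContinuousLinearMap.adjoint (L i) * L i = 1)
    (hV : ∀ i, ∀ x ∈ V, L i x ∈ V) (n : ℕ) :
    ∀ x ∈ V, (krausDual L ^ n) V.starProjection x = x := by
  induction n with
  | zero => intro x hx; exact Submodule.starProjection_eq_self_iff.2 hx
  | succ n ih => rw [pow_succ', Module.End.mul_apply]; exact krausDual_eqOn hL hV ih

theorem krausDual_pow_one (hL : ∑ i, ContinuousLinearMap.adjoint (L i) * L i = 1) (n : ℕ) :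
    (krausDual L ^ n) 1 = 1 := by
  induction n with
  | zero => rfl
  | succ n ih => rw [pow_succ', Module.End.mul_apply, ih, krausDual_one hL]

/-- The image of p_V is positive and the identity on V, hence dominates p_V; applying a positive map
n times keeps the inequality. The sequence defining the absorption operator is therefore increasing.
-/
theorem isPositive_krausDual_pow_succ_sub
    (hL : ∑ i, ContinuousLinearMap.adjoint (L i) * L i = 1)
    (hV : ∀ i, ∀ x ∈ V, L i x ∈ V) (n : ℕ) :
    ((krausDual L ^ (n + 1)) V.starProjection - (krausDual L ^ n) V.starProjection).IsPositive := by
  rw [pow_succ, Module.End.mul_apply, ← map_sub]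
  apply krausDual_pow_isPositive
  apply isPositive_sub_starProjection (krausDual_isPositive L (starProjection_isPositive V))
  exact krausDual_eqOn hL hV fun x hx => Submodule.starProjection_eq_self_iff.2 hx

theorem isPositive_one_sub_krausDual_pow
    (hL : ∑ i, ContinuousLinearMap.adjoint (L i) * L i = 1) (V : Submodule ℂ h) (n : ℕ) :
    (1 - (krausDual L ^ n) V.starProjection).IsPositive := by
  have h1 : 1 - (krausDual L ^ n) V.starProjection
      = (krausDual L ^ n) (1 - V.starProjection) := by
    rw [map_sub, krausDual_pow_one hL]
  rw [h1]
  apply krausDual_pow_isPositive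
  apply isPositive_sub_starProjection ContinuousLinearMap.isPositive_one
  exact fun x _ => rfl

/-- An increasing sequence bounded by 1 has convergent traces, and for positive differences the
trace bounds the norm, so the sequence is Cauchy. -/
theorem tendsto_absorption (hL : ∑ i, ContinuousLinearMap.adjoint (L i) * L i = 1)
    (hV : ∀ i, ∀ x ∈ V, L i x ∈ V) :
    Tendsto (fun n : ℕ => (krausDual L ^ n) V.starProjection) atTop (𝓝 (absorption L V)) := by
  set a : ℕ → h →L[ℂ] h := fun n => (krausDual L ^ n) V.starProjection with ha
  have hmono : ∀ m n, m ≤ n → (a n - a m).IsPositive := by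
    intro m n hmn
    induction n, hmn using Nat.le_induction with
    | base => simp
    | succ n _ ih =>
      have := (isPositive_krausDual_pow_succ_sub hL hV n).add ih
      rwa [sub_add_sub_cancel] at this
  have hdist : ∀ m n, m ≤ n → dist (a m) (a n) ≤ (tr (a n)).re - (tr (a m)).re := by
    intro m n hmn
    rw [dist_comm, dist_eq_norm, ← Complex.sub_re, ← tr_sub]
    exact norm_le_tr (hmono m n hmn)
  have htmono : Monotone fun n => (tr (a n)).re := fun m n hmn => by
    have := dist_nonneg.trans (hdist m n hmn)
    simpa using this
  have hbdd : BddAbove (Set.range fun n => (tr (a n)).re) := by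
    refine ⟨(tr (1 : h →L[ℂ] h)).re, ?_⟩
    rintro _ ⟨n, rfl⟩
    have := (norm_nonneg _).trans (norm_le_tr (isPositive_one_sub_krausDual_pow hL V n))
    rw [tr_sub, Complex.sub_re] at this
    simpa using this
  have hcs : CauchySeq fun n => (tr (a n)).re :=
    (tendsto_atTop_ciSup htmono hbdd).cauchySeq
  have hca : CauchySeq a := by
    rw [Metric.cauchySeq_iff'] at hcs ⊢
    intro ε hε
    obtain ⟨N, hN⟩ := hcs ε hε
    refine ⟨N, fun n hn => ?_⟩
    have h1 := hdist N n hn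
    have h2 := hN n hn
    rw [Real.dist_eq] at h2
    rw [dist_comm]
    exact (h1.trans (le_abs_self _)).trans_lt h2
  exact tendsto_nhds_limUnder (cauchySeq_tendsto_of_complete hca)

/-- Hypotheses on the Kraus operators `L` and the invariant subspace `V`. -/
structure Invariant (L : Fin v → h →L[ℂ] h) (V : Submodule ℂ h) : Prop where
  normalized : ∑ i, ContinuousLinearMap.adjoint (L i) * L i = 1
  map_mem : ∀ i, ∀ x ∈ V, L i x ∈ V

namespace Invariant

variable (H : Invariant L V)
include H

theorem tendsto : Tendsto (fun n : ℕ => (krausDual L ^ n) V.starProjection) atTop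
    (𝓝 (absorption L V)) := tendsto_absorption H.normalized H.map_mem

theorem krausDual_absorption : krausDual L (absorption L V) = absorption L V := by
  have h1 := ((continuous_krausDual L).tendsto _).comp H.tendsto
  refine tendsto_nhds_unique h1 ?_
  refine (H.tendsto.comp (tendsto_add_atTop_nat 1)).congr fun n => ?_
  simp only [Function.comp_apply, pow_succ', Module.End.mul_apply]

theorem absorption_isPositive : (absorption L V).IsPositive :=
  isPositive_of_tendsto H.tendsto fun n => krausDual_pow_isPositive L (starProjection_isPositive V) n

theorem one_sub_absorption_isPositive : (1 - absorption L V).IsPositive :=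
  isPositive_of_tendsto (tendsto_const_nhds.sub H.tendsto)
    fun n => isPositive_one_sub_krausDual_pow H.normalized V n

theorem absorption_eqOn {x : h} (hx : x ∈ V) : absorption L V x = x := by
  have h1 : Tendsto (fun n : ℕ => (krausDual L ^ n) V.starProjection x) atTop
      (𝓝 (absorption L V x)) := by
    have hc : Continuous fun y : h →L[ℂ] h => y x := by fun_prop
    exact (hc.tendsto _).comp H.tendsto
  refine tendsto_nhds_unique h1 ?_
  simp only [krausDual_pow_eqOn H.normalized H.map_mem _ x hx]
  exact tendsto_const_nhds

/-- Since A is fixed, its form at x is the sum of its nonnegative values at the L j x; if the sum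
vanishes, so does each term. -/
theorem map_ker_absorption {x : h} (hx : absorption L V x = 0) (i : Fin v) :
    absorption L V (L i x) = 0 := by
  have h1 : ⟪x, krausDual L (absorption L V) x⟫_ℂ = 0 := by
    rw [H.krausDual_absorption, hx, inner_zero_right]
  rw [inner_krausDual] at h1
  have h2 := congrArg Complex.re h1
  have hp := H.absorption_isPositive
  rw [Complex.re_sum, Complex.zero_re, Finset.sum_eq_zero_iff_of_nonneg
    (fun i _ => ((isPositive_iff_inner _).1 hp _).2)] at h2
  apply apply_eq_zero_of_inner_eq_zero hp
  rw [((isPositive_iff_inner _).1 hp _).1, h2 i (Finset.mem_univ _), Complex.ofReal_zero]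

theorem le_supp : V ≤ supp (absorption L V) := by
  intro x hx
  rw [supp, Submodule.mem_orthogonal]
  intro φ hφ
  rw [← H.absorption_eqOn hx, ← H.absorption_isPositive.inner_left_eq_inner_right]
  have : absorption L V φ = 0 := hφ
  rw [this, inner_zero_left]

end Invariant

/-- The support projection of the absorption operator. -/
def suppProj (L : Fin v → h →L[ℂ] h) (V : Submodule ℂ h) : h →L[ℂ] h :=
  (supp (absorption L V)).starProjection

local notation "P" => suppProj L V
local notation "A" => absorption L V

theorem suppProj_mul_self : P * P = P := by
  ext φ
  exact Submodule.starProjection_eq_self_iff.2 (Submodule.starProjection_apply_mem _ φ)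

theorem suppProj_adjoint : ContinuousLinearMap.adjoint P = P :=
  (starProjection_isPositive _).isSelfAdjoint.adjoint_eq

theorem mul_suppProj_of_ker {x : h →L[ℂ] h} (hx : ∀ φ, A φ = 0 → x φ = 0) : x * P = x := by
  ext φ
  rw [op_mul_apply, eq_comm, ← sub_eq_zero, ← map_sub]
  apply hx
  have := Submodule.sub_starProjection_mem_orthogonal (K := supp A) φ
  rw [supp, Submodule.orthogonal_orthogonal] at this
  exact this

theorem suppProj_apply_of_ker {φ : h} (hφ : A φ = 0) : P φ = 0 := by
  refine (Submodule.starProjection_apply_eq_zero_iff _).2 ?_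
  rw [supp, Submodule.orthogonal_orthogonal]
  exact hφ

theorem absorption_mul_suppProj : A * P = A := mul_suppProj_of_ker fun _ h => h

namespace Invariant

variable (H : Invariant L V)
include H

theorem suppProj_mul_absorption : P * A = A := by
  have h1 := congrArg ContinuousLinearMap.adjoint (absorption_mul_suppProj (L := L) (V := V))
  rw [← ContinuousLinearMap.star_eq_adjoint, star_mul, ContinuousLinearMap.star_eq_adjoint,
    ContinuousLinearMap.star_eq_adjoint, suppProj_adjoint,
    H.absorption_isPositive.isSelfAdjoint.adjoint_eq] at h1
  exact h1

theorem suppProj_mul_mul (i : Fin v) : P * L i * P = P * L i :=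
  mul_suppProj_of_ker fun φ hφ => by
    rw [op_mul_apply]; exact suppProj_apply_of_ker (H.map_ker_absorption hφ i)

theorem suppProj_eqOn {x : h} (hx : x ∈ V) : P x = x :=
  Submodule.starProjection_eq_self_iff.2 (H.le_supp hx)

/-- An operator on the support of `A(V)` whose compression to `V` vanishes is dominated by a small
multiple of `A(V)` up to a multiple of `A(V) - p_V`. -/
theorem exists_dominated {c : h →L[ℂ] h} (hc : ∀ φ, ⟪φ, c φ⟫_ℂ = ⟪P φ, c (P φ)⟫_ℂ)
    (hcV : ∀ x ∈ V, ⟪x, c x⟫_ℂ = 0) {ε : ℝ} (hε : 0 < ε) :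
    ∃ C : ℝ, 0 ≤ C ∧ Dominated c ((ε : ℂ) • A + (C : ℂ) • (A - V.starProjection)) := by
  obtain ⟨δ, hδ, hlow⟩ := exists_lower_bound_supp H.absorption_isPositive
  -- Write Pφ = x + y with x = p_V φ. Since c vanishes on V, its form at φ is at most 2‖c‖‖x‖‖y‖ +
  -- ‖c‖‖y‖². Young's inequality with weight ε absorbs the cross term, and the form of A - p_V at φ
  -- is at least δ‖y‖².
  refine ⟨((2 * ‖c‖) ^ 2 / (4 * ε) + ‖c‖) / δ, by positivity, fun φ => ?_⟩
  set x := V.starProjection φ with hx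
  have hxV : x ∈ V := Submodule.starProjection_apply_mem V φ
  set y := P φ - x with hy
  have hxy : P φ = x + y := by rw [hy]; abel
  have h1 : ‖⟪φ, c φ⟫_ℂ‖ ≤ 2 * ‖c‖ * ‖x‖ * ‖y‖ + ‖c‖ * ‖y‖ ^ 2 := by
    rw [hc, hxy, map_add, inner_add_left, inner_add_right, inner_add_right, hcV x hxV, zero_add]
    have e1 : ‖⟪x, c y⟫_ℂ‖ ≤ ‖x‖ * (‖c‖ * ‖y‖) := (norm_inner_le_norm _ _).trans (by
      gcongr; exact c.le_opNorm _)
    have e2 : ‖⟪y, c x⟫_ℂ‖ ≤ ‖y‖ * (‖c‖ * ‖x‖) := (norm_inner_le_norm _ _).trans (by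
      gcongr; exact c.le_opNorm _)
    have e3 : ‖⟪y, c y⟫_ℂ‖ ≤ ‖y‖ * (‖c‖ * ‖y‖) := (norm_inner_le_norm _ _).trans (by
      gcongr; exact c.le_opNorm _)
    have e4 := norm_add_le (⟪x, c y⟫_ℂ) (⟪y, c x⟫_ℂ + ⟪y, c y⟫_ℂ)
    have e5 := norm_add_le (⟪y, c x⟫_ℂ) (⟪y, c y⟫_ℂ)
    linarith
  have h2 := inner_eq_add_of_eqOn H.absorption_isPositive (fun x hx => H.absorption_eqOn hx) φ
  have h3 := hlow (φ - x)
  have h4 : (supp A).starProjection (φ - x) = y := by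
    rw [map_sub, hy]
    congr 1
    exact H.suppProj_eqOn hxV
  rw [h4] at h3
  rw [← hx] at h2
  have h5 : (⟪φ, ((ε : ℂ) • A + (((((2 * ‖c‖) ^ 2 / (4 * ε) + ‖c‖) / δ : ℝ)) : ℂ) •
      (A - V.starProjection)) φ⟫_ℂ).re = ε * (⟪φ, A φ⟫_ℂ).re +
        ((2 * ‖c‖) ^ 2 / (4 * ε) + ‖c‖) / δ * ((⟪φ, A φ⟫_ℂ).re - ‖x‖ ^ 2) := by
    simp only [add_apply, smul_apply, sub_apply, inner_add_right, inner_smul_right,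
      inner_sub_right, Complex.add_re, Complex.re_ofReal_mul, Complex.sub_re,
      inner_starProjection_self, Complex.ofReal_re, hx]
  rw [h5]
  have h6 : 0 ≤ (⟪φ - x, A (φ - x)⟫_ℂ).re :=
    ((isPositive_iff_inner _).1 H.absorption_isPositive _).2
  have h7 : ε * ‖x‖ ^ 2 ≤ ε * (⟪φ, A φ⟫_ℂ).re := by
    gcongr; linarith
  have h8 : ((2 * ‖c‖) ^ 2 / (4 * ε) + ‖c‖) * ‖y‖ ^ 2 ≤
      ((2 * ‖c‖) ^ 2 / (4 * ε) + ‖c‖) / δ * ((⟪φ, A φ⟫_ℂ).re - ‖x‖ ^ 2) := by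
    rw [div_mul_eq_mul_div, le_div_iff₀ hδ, mul_assoc]
    gcongr
    linarith
  have h9 : 2 * ‖c‖ * ‖x‖ * ‖y‖ ≤ ε * ‖x‖ ^ 2 + (2 * ‖c‖) ^ 2 / (4 * ε) * ‖y‖ ^ 2 := by
    have : 0 ≤ (2 * ε * ‖x‖ - 2 * ‖c‖ * ‖y‖) ^ 2 / (4 * ε) := by positivity
    have e : (2 * ε * ‖x‖ - 2 * ‖c‖ * ‖y‖) ^ 2 / (4 * ε) = ε * ‖x‖ ^ 2 +
      (2 * ‖c‖) ^ 2 / (4 * ε) * ‖y‖ ^ 2 - 2 * ‖c‖ * ‖x‖ * ‖y‖ := by field_simp; ring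
    linarith
  linarith

/-- A fixed point of the dual map living on the support of `A(V)` is determined by its compression
to `V`. -/
theorem eq_zero_of_fixed {c : h →L[ℂ] h} (hfix : krausDual L c = c)
    (hc : ∀ φ, ⟪φ, c φ⟫_ℂ = ⟪P φ, c (P φ)⟫_ℂ) (hcV : ∀ x ∈ V, ⟪x, c x⟫_ℂ = 0) : c = 0 := by
  have hpow : ∀ (x : h →L[ℂ] h) n, krausDual L x = x → (krausDual L ^ n) x = x := by
    intro x n hx
    induction n with
    | zero => rfl
    | succ n ih => rw [pow_succ', Module.End.mul_apply, ih, hx]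
  refine ext_inner_map_self fun φ => ?_
  rw [zero_apply, inner_zero_right, ← norm_eq_zero]
  have key : ∀ ε : ℝ, 0 < ε → ‖⟪φ, c φ⟫_ℂ‖ ≤ ε * (⟪φ, A φ⟫_ℂ).re := by
    intro ε hε
    obtain ⟨C, _, hdom⟩ := H.exists_dominated hc hcV hε
    -- Iterating the dual map fixes c and A and turns p_V into the iterates converging to A, so the
    -- term with the possibly huge constant C disappears in the limit.
    have h1 : ∀ n, ‖⟪φ, c φ⟫_ℂ‖ ≤ ε * (⟪φ, A φ⟫_ℂ).re + C * ((⟪φ, A φ⟫_ℂ).re -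
        (⟪φ, (krausDual L ^ n) V.starProjection φ⟫_ℂ).re) := by
      intro n
      have := (hdom.krausDual_pow (K := L) n) φ
      rw [hpow c n hfix, map_add, map_smul, map_smul, map_sub, hpow A n H.krausDual_absorption]
        at this
      simpa only [add_apply, smul_apply, sub_apply, inner_add_right, inner_smul_right,
        inner_sub_right, Complex.add_re, Complex.re_ofReal_mul, Complex.sub_re] using this
    have h2 : Tendsto (fun n => ε * (⟪φ, A φ⟫_ℂ).re + C * ((⟪φ, A φ⟫_ℂ).re -
        (⟪φ, (krausDual L ^ n) V.starProjection φ⟫_ℂ).re)) atTop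
        (𝓝 (ε * (⟪φ, A φ⟫_ℂ).re + C * ((⟪φ, A φ⟫_ℂ).re - (⟪φ, A φ⟫_ℂ).re))) := by
      have h3 := (Complex.continuous_re.tendsto _).comp (tendsto_inner_apply H.tendsto φ φ)
      exact ((tendsto_const_nhds.sub h3).const_mul C).const_add _
    have := ge_of_tendsto' h2 h1
    simpa using this
  refine le_antisymm (le_of_forall_pos_le_add fun η hη => ?_) (norm_nonneg _)
  have hA : 0 ≤ (⟪φ, A φ⟫_ℂ).re := ((isPositive_iff_inner _).1 H.absorption_isPositive _).2
  have := key (η / ((⟪φ, A φ⟫_ℂ).re + 1)) (by positivity)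
  refine this.trans ?_
  rw [zero_add, div_mul_eq_mul_div, div_le_iff₀ (by positivity)]
  nlinarith

end Invariant

end Absorption

/-! ### Consequences of minimality: one-dimensional fixed space and invariant states -/

section Irreducible

variable {h : Type*} [NormedAddCommGroup h] [InnerProductSpace ℂ h] [FiniteDimensional ℂ h]
  [CompleteSpace h] {v : ℕ} {L : Fin v → h →L[ℂ] h} {V : Submodule ℂ h}

local notation "P" => suppProj L V
local notation "A" => absorption L V

/-- The compressions of the Kraus operators to the support of the absorption operator. -/
def compressed (L : Fin v → h →L[ℂ] h) (V : Submodule ℂ h) (i : Fin v) : h →L[ℂ] h :=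
  suppProj L V * L i * suppProj L V

theorem adjoint_compressed_mul (b : h →L[ℂ] h) (i : Fin v) :
    P * (ContinuousLinearMap.adjoint (compressed L V i) * b * compressed L V i) * P =
      ContinuousLinearMap.adjoint (compressed L V i) * b * compressed L V i := by
  have hP := suppProj_mul_self (L := L) (V := V)
  have h1 : compressed L V i * P = compressed L V i := by
    rw [compressed, mul_assoc _ P P, hP]
  have h2 : P * ContinuousLinearMap.adjoint (compressed L V i) =
      ContinuousLinearMap.adjoint (compressed L V i) := by
    conv_rhs => rw [← h1, ← ContinuousLinearMap.star_eq_adjoint, star_mul,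
      ContinuousLinearMap.star_eq_adjoint, ContinuousLinearMap.star_eq_adjoint, suppProj_adjoint]
  rw [← mul_assoc, ← mul_assoc, h2, mul_assoc _ (compressed L V i), h1]

/-- This bridges the compressed and the original maps: one projection is absorbed by P L i P = P L
i, the other by b = P b P. -/
theorem Invariant.adjoint_compressed_mul_eq (H : Invariant L V) {b : h →L[ℂ] h}
    (hb : P * b * P = b) (i : Fin v) :
    ContinuousLinearMap.adjoint (compressed L V i) * b * compressed L V i =
      ContinuousLinearMap.adjoint (L i) * b * L i := by
  rw [compressed, H.suppProj_mul_mul, ← ContinuousLinearMap.star_eq_adjoint, star_mul,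
    ContinuousLinearMap.star_eq_adjoint, ContinuousLinearMap.star_eq_adjoint, suppProj_adjoint]
  conv_rhs => rw [← hb]
  simp only [mul_assoc]

theorem Invariant.suppProj_absorption (H : Invariant L V) : P * A * P = A := by
  rw [H.suppProj_mul_absorption, absorption_mul_suppProj]

theorem inner_suppProj {b : h →L[ℂ] h} (hb : P * b * P = b) (φ : h) :
    ⟪φ, b φ⟫_ℂ = ⟪P φ, b (P φ)⟫_ℂ := by
  conv_lhs => rw [← hb]
  exact (Submodule.inner_starProjection_left_eq_right _ _ _).symm

theorem Invariant.krausDual_compressed (H : Invariant L V) {b : h →L[ℂ] h} (hb : P * b * P = b) :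
    krausDual (compressed L V) b = krausDual L b := by
  rw [krausDual_apply, krausDual_apply]
  exact Finset.sum_congr rfl fun i _ => H.adjoint_compressed_mul_eq hb i

theorem suppProj_mul_of_fixed {b : h →L[ℂ] h} (hb : krausDual (compressed L V) b = b) :
    P * b * P = b := by
  rw [← hb, krausDual_apply, Finset.mul_sum, Finset.sum_mul]
  exact Finset.sum_congr rfl fun i _ => adjoint_compressed_mul b i

/-- A nonzero invariant subspace without proper nonzero invariant subspaces. -/
structure MinimalInvariant (L : Fin v → h →L[ℂ] h) (V : Submodule ℂ h) : Prop
    extends Invariant L V where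
  ne_bot : V ≠ ⊥
  minimal : ∀ W : Submodule ℂ h, (∀ i, ∀ x ∈ W, L i x ∈ W) → W ≤ V → W = ⊥ ∨ W = V

theorem IsMinimalEnclosure.minimalInvariant
    (hL : ∑ i, ContinuousLinearMap.adjoint (L i) * L i = 1)
    (hV : IsMinimalEnclosure (krausMap L) V) : MinimalInvariant L V where
  normalized := hL
  map_mem := (isEnclosure_iff L V).1 hV.1
  ne_bot := hV.2.1
  minimal W hW := hV.2.2 W ((isEnclosure_iff L W).2 hW)

theorem inner_re_of_isSelfAdjoint {c : h →L[ℂ] h} (hc : IsSelfAdjoint c) (φ : h) :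
    ⟪φ, c φ⟫_ℂ = ((⟪φ, c φ⟫_ℂ).re : ℂ) := by
  have h1 : (starRingEnd ℂ) ⟪φ, c φ⟫_ℂ = ⟪φ, c φ⟫_ℂ := by
    rw [inner_conj_symm, ← ContinuousLinearMap.adjoint_inner_right, hc.adjoint_eq]
  exact (Complex.conj_eq_iff_re.1 h1).symm

namespace MinimalInvariant

variable (H : MinimalInvariant L V)
include H

/-- Perron–Frobenius argument: null vectors of a nonnegative form on V form a subspace, and c being
fixed writes the zero value at such an x as a sum of nonnegative values at the L i x. The subspace
is thus invariant and nonzero, and minimality makes it all of V. -/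
theorem inner_eq_zero_of_fixed {c : h →L[ℂ] h} (hc : IsSelfAdjoint c) (hfix : krausDual L c = c)
    (hpos : ∀ x ∈ V, 0 ≤ (⟪x, c x⟫_ℂ).re) (hzero : ∃ x ∈ V, x ≠ 0 ∧ ⟪x, c x⟫_ℂ = 0) :
    ∀ x ∈ V, ⟪x, c x⟫_ℂ = 0 := by
  set y := V.starProjection * c * V.starProjection with hy
  have hyin : ∀ φ, ⟪φ, y φ⟫_ℂ = ⟪V.starProjection φ, c (V.starProjection φ)⟫_ℂ := fun φ =>
    (Submodule.inner_starProjection_left_eq_right _ _ _).symm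
  have hyV : ∀ x ∈ V, ⟪x, y x⟫_ℂ = ⟪x, c x⟫_ℂ := fun x hx => by
    rw [hyin, Submodule.starProjection_eq_self_iff.2 hx]
  have hypos : y.IsPositive := by
    rw [isPositive_iff_inner]
    intro φ
    rw [hyin]
    exact ⟨inner_re_of_isSelfAdjoint hc _, hpos _ (Submodule.starProjection_apply_mem _ _)⟩
  have hN : V ⊓ LinearMap.ker (y : h →ₗ[ℂ] h) = V := by
    refine (H.minimal _ ?_ inf_le_left).resolve_left ?_
    · rintro i x ⟨hxV, hx⟩
      refine ⟨H.map_mem i x hxV, ?_⟩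
      have hx' : y x = 0 := hx
      have h1 : ⟪x, krausDual L c x⟫_ℂ = 0 := by
        rw [hfix, ← hyV x hxV, hx', inner_zero_right]
      rw [inner_krausDual] at h1
      have h2 := congrArg Complex.re h1
      rw [Complex.re_sum, Complex.zero_re, Finset.sum_eq_zero_iff_of_nonneg
        (fun i _ => hpos _ (H.map_mem i x hxV))] at h2
      refine apply_eq_zero_of_inner_eq_zero hypos ?_
      rw [hyV _ (H.map_mem i x hxV), inner_re_of_isSelfAdjoint hc, h2 i (Finset.mem_univ _),
        Complex.ofReal_zero]
    · obtain ⟨x, hxV, hx0, hx⟩ := hzero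
      refine (Submodule.ne_bot_iff _).2 ⟨x, ⟨hxV, apply_eq_zero_of_inner_eq_zero hypos (by rw [hyV x hxV, hx])⟩, hx0⟩
  intro x hx
  have hx' : y x = 0 := by
    rw [← hN] at hx
    exact hx.2
  rw [← hyV x hx, hx', inner_zero_right]

/-- The scalar is the minimum l of the form of b on the unit sphere of V, attained at x₀. As A is
the identity on V, b - l A is nonnegative there with null vector x₀, so it vanishes on V and hence
everywhere. -/
theorem exists_eq_smul_of_isSelfAdjoint {b : h →L[ℂ] h} (hb : IsSelfAdjoint b)
    (hfix : krausDual L b = b) (hP : P * b * P = b) : ∃ c : ℂ, b = c • A := by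
  have := FiniteDimensional.proper_rclike ℂ h
  have hcomp : IsCompact (Metric.sphere (0 : h) 1 ∩ (V : Set h)) :=
    (isCompact_sphere 0 1).inter_right (Submodule.closed_of_finiteDimensional _)
  have hcont : Continuous fun φ : h => (⟪φ, b φ⟫_ℂ).re := by fun_prop
  have hmem : ∀ x ∈ V, x ≠ 0 →
      ((‖x‖⁻¹ : ℝ) : ℂ) • x ∈ Metric.sphere (0 : h) 1 ∩ (V : Set h) := fun x hx h0 =>
    ⟨by simp [norm_smul, h0], Submodule.smul_mem _ _ hx⟩
  have hne : (Metric.sphere (0 : h) 1 ∩ (V : Set h)).Nonempty := by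
    obtain ⟨x, hx, h0⟩ := (Submodule.ne_bot_iff _).1 H.ne_bot
    exact ⟨_, hmem x hx h0⟩
  obtain ⟨x₀, hx₀, hmin⟩ := hcomp.exists_isMinOn hne hcont.continuousOn
  set l : ℝ := (⟪x₀, b x₀⟫_ℂ).re with hl
  have hx₀n : ‖x₀‖ = 1 := by simpa using hx₀.1
  have hAV : ∀ x ∈ V, ⟪x, (b - (l : ℂ) • A) x⟫_ℂ = ((⟪x, b x⟫_ℂ).re - l * ‖x‖ ^ 2 : ℝ) := by
    intro x hx
    rw [sub_apply, smul_apply, H.absorption_eqOn hx, inner_sub_right, inner_smul_right,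
      inner_re_of_isSelfAdjoint hb, inner_self_eq_norm_sq_to_K]
    push_cast
    rfl
  refine ⟨l, sub_eq_zero.1 (H.eq_zero_of_fixed ?_ (inner_suppProj ?_) ?_)⟩
  · rw [map_sub, map_smul, hfix, H.krausDual_absorption]
  · rw [mul_sub, sub_mul, hP, mul_smul_comm, smul_mul_assoc, H.suppProj_absorption]
  · apply H.inner_eq_zero_of_fixed
    · refine hb.sub ?_
      rw [Complex.coe_smul]
      exact (IsSelfAdjoint.all l).smul H.absorption_isPositive.isSelfAdjoint
    · rw [map_sub, map_smul, hfix, H.krausDual_absorption]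
    · intro x hx
      rw [hAV x hx, Complex.ofReal_re, sub_nonneg]
      by_cases h0 : x = 0
      · simp [h0]
      · have h1 := hmin (hmem x hx h0)
        have hn : ‖x‖ ≠ 0 := norm_ne_zero_iff.2 h0
        simp only [Set.mem_ofPred_eq, map_smul, inner_smul_left, inner_smul_right,
          Complex.conj_ofReal, Complex.re_ofReal_mul] at h1
        rw [← hl] at h1
        calc l * ‖x‖ ^ 2 ≤ (‖x‖⁻¹ * (‖x‖⁻¹ * (⟪x, b x⟫_ℂ).re)) * ‖x‖ ^ 2 := by gcongr
          _ = _ := by field_simp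
    · refine ⟨x₀, hx₀.2, fun h0 => by simp [h0] at hx₀n, ?_⟩
      rw [hAV x₀ hx₀.2, hx₀n]
      simp [hl]

/-- The fixed points of the compressed dual map are the multiples of the absorption operator. -/
theorem exists_eq_smul {b : h →L[ℂ] h} (hb : krausDual (compressed L V) b = b) :
    ∃ c : ℂ, b = c • A := by
  have hP := suppProj_mul_of_fixed hb
  have hfix : krausDual L b = b := by rw [← H.krausDual_compressed hP, hb]
  have hfix' : krausDual L (star b) = star b := by
    rw [ContinuousLinearMap.star_eq_adjoint, ← krausDual_adjoint, hfix]
  have hP' : P * star b * P = star b := by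
    have := congrArg star hP
    rw [star_mul, star_mul, ContinuousLinearMap.star_eq_adjoint (suppProj L V), suppProj_adjoint,
      ← mul_assoc] at this
    exact this
  -- Split b into self-adjoint parts b + b* and i(b - b*), each again a fixed point supported by P.
  obtain ⟨c₁, h₁⟩ := H.exists_eq_smul_of_isSelfAdjoint (b := b + star b)
    (IsSelfAdjoint.add_star_self b) (by rw [map_add, hfix, hfix'])
    (by rw [mul_add, add_mul, hP, hP'])
  obtain ⟨c₂, h₂⟩ := H.exists_eq_smul_of_isSelfAdjoint (b := Complex.I • (b - star b))
    (by
      rw [IsSelfAdjoint, star_smul, star_sub, star_star, Complex.star_def, Complex.conj_I,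
        neg_smul, ← smul_neg, neg_sub])
    (by rw [map_smul, map_sub, hfix, hfix'])
    (by rw [mul_smul_comm, smul_mul_assoc, mul_sub, sub_mul, hP, hP'])
  refine ⟨(1 / 2 : ℂ) * (c₁ - Complex.I * c₂), ?_⟩
  have e : b = (1 / 2 : ℂ) • ((b + star b) - Complex.I • (Complex.I • (b - star b))) := by
    rw [smul_smul, Complex.I_mul_I]
    module
  rw [e, h₁, h₂]
  module

end MinimalInvariant

theorem krausMap_pow_isState (hL : ∑ i, ContinuousLinearMap.adjoint (L i) * L i = 1)
    {σ : h →L[ℂ] h} (hσ : IsState σ) (n : ℕ) : IsState ((krausMap L ^ n) σ) := by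
  induction n with
  | zero => exact hσ
  | succ n ih =>
    rw [pow_succ', Module.End.mul_apply]
    exact ⟨krausMap_isPositive L ih.1, by rw [tr_krausMap hL, ih.2]⟩

theorem krausMap_pow_eq_zero (hV : ∀ i, ∀ x ∈ V, L i x ∈ V)
    {σ : h →L[ℂ] h} (hσ : ∀ φ ∈ Vᗮ, σ φ = 0) (n : ℕ) : ∀ φ ∈ Vᗮ, (krausMap L ^ n) σ φ = 0 := by
  induction n with
  | zero => exact hσ
  | succ n ih =>
    intro φ hφ
    rw [pow_succ', Module.End.mul_apply, krausMap_apply, sum_apply]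
    refine Finset.sum_eq_zero fun i _ => ?_
    simp only [op_mul_apply]
    rw [ih, map_zero]
    rw [Submodule.mem_orthogonal]
    intro x hx
    rw [ContinuousLinearMap.adjoint_inner_right]
    exact (Submodule.mem_orthogonal _ _).1 hφ _ (hV i x hx)

/-- Krylov–Bogoliubov: start from a pure state on a unit vector of V, take Cesàro averages of its
orbit, and extract a limit by compactness. Telescoping bounds the defect of invariance of the nth
average by 2/(n + 1). -/
theorem Invariant.exists_fixed_state (H : Invariant L V) (hne : V ≠ ⊥) :
    ∃ τ : h →L[ℂ] h, IsState τ ∧ krausMap L τ = τ ∧ ∀ φ ∈ Vᗮ, τ φ = 0 := by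
  obtain ⟨x, hx, hx0⟩ := (Submodule.ne_bot_iff _).1 hne
  have hn : (‖x‖ : ℂ) ≠ 0 := by simpa using hx0
  set e : h := ((‖x‖ : ℂ))⁻¹ • x with he
  have heV : e ∈ V := Submodule.smul_mem _ _ hx
  have hen : ‖e‖ = 1 := by rw [he, norm_smul, norm_inv, Complex.norm_real, norm_norm,
    inv_mul_cancel₀ (norm_ne_zero_iff.2 hx0)]
  set σ : h →L[ℂ] h := InnerProductSpace.rankOne ℂ e e with hσ
  have hσs : IsState σ := ⟨InnerProductSpace.isPositive_rankOne_self e, by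
    rw [hσ, tr_rankOne, inner_self_eq_norm_sq_to_K, hen]; simp⟩
  have hσV : ∀ φ ∈ Vᗮ, σ φ = 0 := fun φ hφ => by
    rw [hσ, InnerProductSpace.rankOne_apply, (Submodule.mem_orthogonal _ _).1 hφ e heV, zero_smul]
  set S : ℕ → h →L[ℂ] h := fun n =>
    ((n + 1 : ℝ)⁻¹ : ℂ) • ∑ k ∈ Finset.range (n + 1), (krausMap L ^ k) σ with hS
  have hSpos : ∀ n, (S n).IsPositive := fun n => by
    refine ContinuousLinearMap.IsPositive.smul_of_nonneg
      (ContinuousLinearMap.isPositive_sum _ fun k _ =>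
        (krausMap_pow_isState H.normalized hσs k).1) ?_
    rw [Complex.le_def]
    norm_cast
    constructor
    · positivity
    · simp
  have hStr : ∀ n, tr (S n) = 1 := fun n => by
    simp only [hS, tr_smul, tr_sum, (krausMap_pow_isState H.normalized hσs _).2]
    have : ((n : ℂ) + 1) ≠ 0 := by exact_mod_cast n.succ_ne_zero
    simp [this]
  have hSV : ∀ n, ∀ φ ∈ Vᗮ, S n φ = 0 := fun n φ hφ => by
    simp only [hS, smul_apply, sum_apply, krausMap_pow_eq_zero H.map_mem hσV _ φ hφ]
    simp
  have hSdiff : ∀ n, krausMap L (S n) - S n =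
      ((n + 1 : ℝ)⁻¹ : ℂ) • ((krausMap L ^ (n + 1)) σ - σ) := fun n => by
    simp only [hS, map_smul, map_sum]
    rw [← smul_sub, ← Finset.sum_sub_distrib]
    congr 1
    have := Finset.sum_range_sub (fun k => (krausMap L ^ k) σ) (n + 1)
    simpa only [pow_succ' _, Module.End.mul_apply, pow_zero, Module.End.one_apply] using this
  have hbd : ∀ y : h →L[ℂ] h, IsState y → ‖y‖ ≤ 1 := fun y hy => by
    have := norm_le_tr hy.1
    rwa [hy.2, Complex.one_re] at this
  have hprop : ProperSpace (h →L[ℂ] h) := FiniteDimensional.proper_rclike ℂ _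
  obtain ⟨τ, -, k, hk, hτ⟩ := tendsto_subseq_of_bounded (Metric.isBounded_closedBall
    (x := (0 : h →L[ℂ] h)) (r := 1)) (x := S) fun n => by
      rw [mem_closedBall_zero_iff]; exact hbd _ ⟨hSpos n, hStr n⟩
  refine ⟨τ, ⟨isPositive_of_tendsto hτ fun n => hSpos _, ?_⟩, ?_, fun φ hφ => ?_⟩
  · have h1 := ((trL (h := h)).continuous.tendsto τ).comp hτ
    refine tendsto_nhds_unique h1 ?_
    simp only [Function.comp_def, trL_apply, hStr]
    exact tendsto_const_nhds
  · have h1 := (((continuous_krausMap L).tendsto τ).comp hτ).sub hτ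
    rw [← sub_eq_zero]
    refine tendsto_nhds_unique h1 ?_
    rw [tendsto_zero_iff_norm_tendsto_zero]
    have h2 : Tendsto (fun n : ℕ => 1 / ((n : ℝ) + 1) * 2) atTop (𝓝 (0 * 2)) :=
      tendsto_one_div_add_atTop_nhds_zero_nat.mul_const 2
    rw [zero_mul] at h2
    refine squeeze_zero (fun _ => norm_nonneg _) (fun n => ?_) (h2.comp hk.tendsto_atTop)
    simp only [Function.comp_apply, hSdiff, norm_smul]
    have h3 : ‖(((k n : ℕ) + 1 : ℝ)⁻¹ : ℂ)‖ = 1 / ((k n : ℝ) + 1) := by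
      rw [norm_inv, Complex.norm_real, Real.norm_of_nonneg (by positivity), one_div]
    push_cast at h3 ⊢
    rw [h3]
    gcongr
    have h4 := norm_sub_le ((krausMap L ^ (k n + 1)) σ) σ
    have h5 := hbd _ (krausMap_pow_isState H.normalized hσs (k n + 1))
    have h6 := hbd _ hσs
    linarith
  · have hc : Continuous fun y : h →L[ℂ] h => y φ := by fun_prop
    have h1 := (hc.tendsto τ).comp hτ
    refine tendsto_nhds_unique h1 ?_
    simp only [Function.comp_def, hSV _ φ hφ]
    exact tendsto_const_nhds

/-- The support of an invariant positive operator is an invariant subspace. -/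
theorem map_supp_of_fixed {τ : h →L[ℂ] h} (hτ : τ.IsPositive) (hfix : krausMap L τ = τ) (i : Fin v) :
    ∀ x ∈ supp τ, L i x ∈ supp τ := by
  intro x hx
  rw [supp, Submodule.mem_orthogonal] at hx ⊢
  intro φ hφ
  have hφ' : τ φ = 0 := hφ
  rw [← ContinuousLinearMap.adjoint_inner_left]
  refine hx _ ?_
  have h1 : ⟪φ, krausMap L τ φ⟫_ℂ = 0 := by rw [hfix, hφ', inner_zero_right]
  rw [krausMap_apply, sum_apply, inner_sum] at h1
  have e : ∀ j, ⟪φ, (L j * τ * ContinuousLinearMap.adjoint (L j)) φ⟫_ℂ =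
      ⟪ContinuousLinearMap.adjoint (L j) φ, τ (ContinuousLinearMap.adjoint (L j) φ)⟫_ℂ := fun j => by
    rw [ContinuousLinearMap.adjoint_inner_left]; rfl
  simp only [e] at h1
  have h2 := congrArg Complex.re h1
  rw [Complex.re_sum, Complex.zero_re, Finset.sum_eq_zero_iff_of_nonneg
    (fun i _ => ((isPositive_iff_inner _).1 hτ _).2)] at h2
  refine apply_eq_zero_of_inner_eq_zero hτ ?_
  rw [((isPositive_iff_inner _).1 hτ _).1, h2 i (Finset.mem_univ _), Complex.ofReal_zero]

theorem MinimalInvariant.exists_fixed_state (H : MinimalInvariant L V) :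
    ∃ τ : h →L[ℂ] h, IsState τ ∧ krausMap L τ = τ ∧ supp τ = V := by
  obtain ⟨τ, hτ, hfix, hV⟩ := H.toInvariant.exists_fixed_state H.ne_bot
  refine ⟨τ, hτ, hfix, (H.minimal _ (map_supp_of_fixed hτ.1 hfix) (supp_le_iff.2 hV)).resolve_left
    fun h0 => ?_⟩
  have : τ = 0 := by
    ext φ
    refine supp_le_iff.1 h0.le φ ?_
    simp
  have h1 := hτ.2
  rw [this, tr_zero] at h1
  exact zero_ne_one h1

end Irreducible

/-! ### Analytic perturbation of a simple eigenvalue -/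

section Perturbation

variable {E : Type*} [NormedAddCommGroup E] [NormedSpace ℂ E] [FiniteDimensional ℂ E]
  {ι : Type*} [Fintype ι]

/-- A sum of operators with a simple eigenvalue `1`, with right eigenvector `a` and left
eigenvector `f`. -/
structure SimpleFixed (S : ι → E →L[ℂ] E) (a : E) (f : E →L[ℂ] ℂ) : Prop where
  sum_apply : ∑ i, S i a = a
  map_sum : ∀ b, f (∑ i, S i b) = f b
  map_self : f a = 1
  ker : ∀ b, ∑ i, S i b = b → ∃ k : ℂ, b = k • a

/-- The bordered operator `(b, ν) ↦ (∑ S i b - b - ν a, f b)`. -/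
def bordered (S : ι → E →L[ℂ] E) (a : E) (f : E →L[ℂ] ℂ) : Module.End ℂ (E × ℂ) :=
  (((∑ i, S i - 1).comp (ContinuousLinearMap.fst ℂ E ℂ) -
    (ContinuousLinearMap.snd ℂ E ℂ).smulRight a).prod
      (f.comp (ContinuousLinearMap.fst ℂ E ℂ)) : E × ℂ →L[ℂ] E × ℂ)

theorem bordered_apply (S : ι → E →L[ℂ] E) (a : E) (f : E →L[ℂ] ℂ) (b : E) (ν : ℂ) :
    bordered S a f (b, ν) = (∑ i, S i b - b - ν • a, f b) := by
  simp [bordered]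

variable {S : ι → E →L[ℂ] E} {a : E} {f : E →L[ℂ] ℂ}

/-- Applying f to the first component leaves -ν, so ν = 0; then b is a multiple of a, and f b = 0
with f a = 1 kills it. The condition f a = 1 is what rules out a Jordan block. -/
theorem SimpleFixed.bordered_injective (H : SimpleFixed S a f) :
    Function.Injective (bordered S a f) := by
  rw [injective_iff_map_eq_zero]
  rintro ⟨b, ν⟩ h0
  rw [bordered_apply, Prod.mk_eq_zero] at h0
  obtain ⟨h1, h2⟩ := h0
  have h3 := congrArg f h1
  rw [_root_.map_sub, _root_.map_sub, H.map_sum, sub_self, map_smul, H.map_self, map_zero] at h3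
  have hν : ν = 0 := by simpa using h3
  rw [hν, zero_smul, sub_zero, sub_eq_zero] at h1
  obtain ⟨k, rfl⟩ := H.ker b h1
  rw [map_smul, H.map_self, smul_eq_mul, mul_one] at h2
  simp [h2, hν]

/-- The bordered operator as an equivalence. -/
def SimpleFixed.equiv (H : SimpleFixed S a f) : (E × ℂ) ≃ₗ[ℂ] (E × ℂ) :=
  LinearEquiv.ofInjectiveEndo _ H.bordered_injective

theorem SimpleFixed.equiv_apply (H : SimpleFixed S a f) (b : E) (ν : ℂ) :
    H.equiv (b, ν) = (∑ i, S i b - b - ν • a, f b) := bordered_apply S a f b ν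

/-- The solution `b` with `f b = 0` of `∑ S i b - b = f x • a - x`. -/
def SimpleFixed.poisson (H : SimpleFixed S a f) : E →ₗ[ℂ] E :=
  LinearMap.fst ℂ E ℂ ∘ₗ H.equiv.symm.toLinearMap ∘ₗ LinearMap.inl ℂ E ℂ ∘ₗ (-LinearMap.id)

theorem SimpleFixed.equiv_symm (H : SimpleFixed S a f) (x : E) :
    H.equiv.symm (-x, 0) = (H.poisson x, f x) := by
  obtain ⟨⟨b, ν⟩, h1⟩ : ∃ q, q = H.equiv.symm (-x, 0) := ⟨_, rfl⟩
  have h2 : H.equiv (b, ν) = (-x, 0) := by rw [h1, LinearEquiv.apply_symm_apply]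
  rw [H.equiv_apply, Prod.mk.injEq] at h2
  have h3 := congrArg f h2.1
  rw [_root_.map_sub, _root_.map_sub, H.map_sum, sub_self, map_smul, H.map_self, map_neg] at h3
  have h4 : ν = f x := by simpa using h3
  have h5 : H.poisson x = b := by
    have : H.poisson x = (H.equiv.symm (-x, 0)).1 := rfl
    rw [this, ← h1]
  rw [h5, ← h1, h4]

/-- Every x is a multiple of a plus a coboundary. This decomposition gives both the uniqueness of
the invariant state and the telescoping of the mean. -/
theorem SimpleFixed.sum_poisson (H : SimpleFixed S a f) (x : E) :
    x = f x • a + H.poisson x - ∑ i, S i (H.poisson x) := by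
  have h2 : H.equiv (H.poisson x, f x) = (-x, 0) := by
    rw [← H.equiv_symm, LinearEquiv.apply_symm_apply]
  rw [H.equiv_apply, Prod.mk.injEq] at h2
  have h3 : x = -(∑ i, S i (H.poisson x) - H.poisson x - f x • a) := by rw [h2.1, neg_neg]
  exact h3.trans (by abel)

open scoped ContDiff in
/-- Perturbation of a simple eigenvalue: the eigenvalue `1` and the eigenvector `a` of `∑ S i`
extend analytically to those of `∑ exp (z c i) S i`. -/
theorem SimpleFixed.exists_perturbation (H : SimpleFixed S a f) (c : ι → ℂ) :
    ∃ (α : ℂ → E) (μ : ℂ → ℂ), AnalyticAt ℂ α 0 ∧ AnalyticAt ℂ μ 0 ∧ α 0 = a ∧ μ 0 = 1 ∧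
      (∀ᶠ z in 𝓝 0, ∑ i, Complex.exp (z * c i) • S i (α z) = μ z • α z ∧ f (α z) = 1) ∧
      (∀ᶠ q : ℂ × E × ℂ in 𝓝 (0, a, 1),
        ∑ i, Complex.exp (q.1 * c i) • S i q.2.1 = q.2.2 • q.2.1 → f q.2.1 = 1 →
          q.2.1 = α q.1 ∧ q.2.2 = μ q.1) := by
  have hcE : CompleteSpace E := FiniteDimensional.complete ℂ E
  -- Keeping z as a coordinate lets the inverse function theorem act as an implicit one: normalized
  -- eigenpairs at parameter z are exactly the preimages of (z, 0, 1), which gives both existence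
  -- and local uniqueness.
  set G : ℂ × E × ℂ → ℂ × E × ℂ := fun q =>
    (q.1, ∑ i, Complex.exp (q.1 * c i) • S i q.2.1 - q.2.2 • q.2.1, f q.2.1) with hG
  have hGc : ContDiff ℂ ω G := by
    have h1 : ∀ i, ContDiff ℂ ω fun q : ℂ × E × ℂ => S i q.2.1 := fun i =>
      (S i).contDiff.comp (contDiff_fst.comp contDiff_snd)
    have h2 : ∀ i, ContDiff ℂ ω fun q : ℂ × E × ℂ => Complex.exp (q.1 * c i) := fun i =>
      Complex.contDiff_exp.comp (contDiff_fst.mul contDiff_const)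
    refine contDiff_fst.prodMk (ContDiff.prodMk (ContDiff.sub (ContDiff.sum fun i _ =>
      (h2 i).smul (h1 i)) ?_) (f.contDiff.comp (contDiff_fst.comp contDiff_snd)))
    exact (contDiff_snd.comp contDiff_snd).smul (contDiff_fst.comp contDiff_snd)
  have hG0 : G (0, a, 1) = (0, 0, 1) := by
    simp [hG, H.sum_apply, H.map_self]
  set G' : ℂ × E × ℂ →L[ℂ] ℂ × E × ℂ := fderiv ℂ G (0, a, 1) with hG'
  have hGd : HasFDerivAt G G' (0, a, 1) :=
    (hGc.differentiable (by simp)).differentiableAt.hasFDerivAt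
  have hG'fst : ∀ q, (G' q).1 = q.1 := by
    intro q
    have h1 : HasFDerivAt (fun q => (G q).1) ((ContinuousLinearMap.fst ℂ ℂ (E × ℂ)).comp G')
      (0, a, 1) := 
        HasFDerivAt.comp (f := G) _ (ContinuousLinearMap.fst ℂ ℂ (E × ℂ)).hasFDerivAt hGd
    have h2 : HasFDerivAt (fun q : ℂ × E × ℂ => (G q).1) (ContinuousLinearMap.fst ℂ ℂ (E × ℂ))
      (0, a, 1) := (ContinuousLinearMap.fst ℂ ℂ (E × ℂ)).hasFDerivAt
    exact congrArg (fun T => T q) (h1.unique h2)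
  -- At z = 0 the partial derivative in the pair (vector, eigenvalue) is the bordered operator,
  -- which is invertible by simplicity.
  have hG'snd : ∀ b ν, (G' (0, b, ν)).2 = H.equiv (b, ν) := by
    intro b ν
    have h1 : HasFDerivAt (fun q : E × ℂ => (G (0, q)).2)
        ((ContinuousLinearMap.snd ℂ ℂ (E × ℂ)).comp (G'.comp (ContinuousLinearMap.inr ℂ ℂ (E × ℂ))))
        (a, 1) := by
      refine HasFDerivAt.comp (f := fun q : E × ℂ => G (0, q)) (a, (1 : ℂ))
        (ContinuousLinearMap.snd ℂ ℂ (E × ℂ)).hasFDerivAt ?_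
      exact HasFDerivAt.comp (f := fun q : E × ℂ => ((0 : ℂ), q)) (g := G) (a, (1 : ℂ)) hGd
        (ContinuousLinearMap.inr ℂ ℂ (E × ℂ)).hasFDerivAt
    have h2 : HasFDerivAt (fun q : E × ℂ => (G (0, q)).2)
        (((∑ i, (S i).comp (ContinuousLinearMap.fst ℂ E ℂ)) -
          (ContinuousLinearMap.fst ℂ E ℂ +
            (ContinuousLinearMap.snd ℂ E ℂ).smulRight a)).prod
          (f.comp (ContinuousLinearMap.fst ℂ E ℂ))) (a, 1) := by
      simp only [hG, zero_mul, Complex.exp_zero, one_smul]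
      refine HasFDerivAt.prodMk (HasFDerivAt.sub (HasFDerivAt.fun_sum fun i _ => ?_) ?_) ?_
      · exact ((S i).comp (ContinuousLinearMap.fst ℂ E ℂ)).hasFDerivAt
      · exact (HasFDerivAt.fun_smul (𝕜 := ℂ) (c := fun q : E × ℂ => q.2)
          (f := fun q : E × ℂ => q.1) (x := (a, (1 : ℂ))) hasFDerivAt_snd hasFDerivAt_fst).congr_fderiv
            (by simp)
      · exact (f.comp (ContinuousLinearMap.fst ℂ E ℂ)).hasFDerivAt
    have h3 := congrArg (fun T => T (b, ν)) (h1.unique h2)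
    simp only [ContinuousLinearMap.comp_apply, ContinuousLinearMap.inr_apply,
      ContinuousLinearMap.coe_snd'] at h3
    rw [h3, H.equiv_apply]
    simp [_root_.sum_apply, sub_sub]
  have hinj : Function.Injective (G' : ℂ × E × ℂ →ₗ[ℂ] ℂ × E × ℂ) := by
    rw [injective_iff_map_eq_zero]
    rintro ⟨z, b, ν⟩ h0
    have h1 : z = 0 := by
      have := congrArg Prod.fst h0
      simpa [hG'fst] using this
    subst h1
    have h2 : H.equiv (b, ν) = 0 := by
      rw [← hG'snd]; exact congrArg Prod.snd h0
    rw [LinearEquiv.map_eq_zero_iff] at h2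
    rw [h2]; rfl
  let e : (ℂ × E × ℂ) ≃L[ℂ] (ℂ × E × ℂ) :=
    (LinearEquiv.ofInjectiveEndo _ hinj).toContinuousLinearEquiv
  have hGe : HasFDerivAt G (e : ℂ × E × ℂ →L[ℂ] ℂ × E × ℂ) (0, a, 1) := by
    have : (e : ℂ × E × ℂ →L[ℂ] ℂ × E × ℂ) = G' := by ext q <;> rfl
    rw [this]; exact hGd
  have hstrict : HasStrictFDerivAt G (e : ℂ × E × ℂ →L[ℂ] ℂ × E × ℂ) (0, a, 1) :=
    hGc.contDiffAt.hasStrictFDerivAt' hGe (by simp)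
  set g := hGc.contDiffAt.localInverse hGe (by simp : (ω : WithTop ℕ∞) ≠ 0) with hg
  have hgc : ContDiffAt ℂ ω g (0, 0, 1) := by
    have := hGc.contDiffAt.to_localInverse hGe (by simp : (ω : WithTop ℕ∞) ≠ 0)
    rwa [hG0] at this
  have hg0 : g (0, 0, 1) = (0, a, 1) := by
    rw [← hG0]; exact hGc.contDiffAt.localInverse_apply_image hGe (by simp)
  have hright : ∀ᶠ y in 𝓝 (0, 0, 1), G (g y) = y := by
    have := hstrict.eventually_right_inverse
    rwa [hG0] at this
  have hleft : ∀ᶠ q in 𝓝 (0, a, 1), g (G q) = q := hstrict.eventually_left_inverse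
  have hj : ContDiffAt ℂ ω (fun z : ℂ => g (z, 0, 1)) 0 :=
    ContDiffAt.comp (g := g) (f := fun z : ℂ => (z, (0 : E), (1 : ℂ))) 0 hgc
      (contDiffAt_id.prodMk contDiffAt_const)
  have hjc : Tendsto (fun z : ℂ => (z, (0 : E), (1 : ℂ))) (𝓝 0) (𝓝 (0, 0, 1)) :=
    (Continuous.prodMk continuous_id continuous_const).tendsto 0
  refine ⟨fun z => (g (z, 0, 1)).2.1, fun z => (g (z, 0, 1)).2.2, ?_, ?_, by simp [hg0],
    by simp [hg0], ?_, ?_⟩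
  · exact (contDiffAt_fst.comp (0 : ℂ) (contDiffAt_snd.comp (0 : ℂ) hj)).analyticAt
  · exact (contDiffAt_snd.comp (0 : ℂ) (contDiffAt_snd.comp (0 : ℂ) hj)).analyticAt
  · filter_upwards [hjc.eventually hright] with z hz
    have h1 : (g (z, 0, 1)).1 = z := congrArg Prod.fst hz
    have h2 := congrArg (fun q => q.2.1) hz
    have h3 := congrArg (fun q => q.2.2) hz
    simp only [hG, h1] at h2 h3
    exact ⟨sub_eq_zero.1 h2, h3⟩
  · filter_upwards [hleft] with q hq h1 h2
    have h3 : G q = (q.1, 0, 1) := by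
      simp only [hG, h1, h2, sub_self]
    rw [h3] at hq
    constructor
    · exact (congrArg (fun q => q.2.1) hq).symm
    · exact (congrArg (fun q => q.2.2) hq).symm

/-- First and second order perturbation formulas. -/
theorem SimpleFixed.perturbation_deriv (H : SimpleFixed S a f) (c : ι → ℂ) {α : ℂ → E} {μ : ℂ → ℂ}
    (hα : AnalyticAt ℂ α 0) (hμ : AnalyticAt ℂ μ 0) (hα0 : α 0 = a) (hμ0 : μ 0 = 1)
    (heq : ∀ᶠ z in 𝓝 0, ∑ i, Complex.exp (z * c i) • S i (α z) = μ z • α z ∧ f (α z) = 1) :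
    deriv μ 0 = ∑ i, c i * f (S i a) ∧
      deriv (deriv μ) 0 = ∑ i, c i ^ 2 * f (S i a) +
        2 * ∑ i, c i * f (S i (H.poisson (∑ i, c i • S i a))) := by
  have hexp : ∀ i z, HasDerivAt (fun z : ℂ => Complex.exp (z * c i))
      (c i * Complex.exp (z * c i)) z := fun i z => by
    have := ((hasDerivAt_id z).mul_const (c i)).cexp
    simpa [mul_comm] using this
  have hSα : ∀ (T : E →L[ℂ] E) (z : ℂ), AnalyticAt ℂ α z →
      HasDerivAt (fun z => T (α z)) (T (deriv α z)) z := fun T z hz =>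
    T.hasFDerivAt.comp_hasDerivAt z hz.differentiableAt.hasDerivAt
  -- first order
  have hd1 : HasDerivAt (fun z => ∑ i, Complex.exp (z * c i) • S i (α z))
      (∑ i, (c i • S i a) + ∑ i, S i (deriv α 0)) 0 := by
    have h1 := HasDerivAt.fun_sum (u := Finset.univ) (fun i _ =>
      (hexp i 0).fun_smul (hSα (S i) 0 hα))
    refine h1.congr_deriv ?_
    simp [hα0, Finset.sum_add_distrib, add_comm]
  have hd2 : HasDerivAt (fun z => μ z • α z) (deriv α 0 + deriv μ 0 • a) 0 := by
    have h1 := hμ.differentiableAt.hasDerivAt.fun_smul hα.differentiableAt.hasDerivAt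
    refine h1.congr_deriv ?_
    simp [hα0, hμ0]
  have hd3 : HasDerivAt (fun z => f (α z)) (f (deriv α 0)) 0 :=
    f.hasFDerivAt.comp_hasDerivAt 0 hα.differentiableAt.hasDerivAt
  have he1 := hd1.unique (hd2.congr_of_eventuallyEq (heq.mono fun z hz => hz.1))
  -- The normalization f(α) = 1 puts all derivatives of α in the kernel of f, so the differentiated
  -- eigenvalue equation is a bordered system and α'(0) is a Poisson solution.
  have hfα : ∀ᶠ z in 𝓝 (0 : ℂ), f (deriv α z) = 0 := by
    filter_upwards [hα.eventually_analyticAt, (heq.mono fun z hz => hz.2).eventually_nhds]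
      with z hz h1
    have h2 : HasDerivAt (fun z => f (α z)) (f (deriv α z)) z :=
      f.hasFDerivAt.comp_hasDerivAt z hz.differentiableAt.hasDerivAt
    exact h2.unique ((hasDerivAt_const z (1 : ℂ)).congr_of_eventuallyEq h1)
  have hfα0 : f (deriv α 0) = 0 := hfα.self_of_nhds
  have hkey : H.equiv (deriv α 0, deriv μ 0) = (-∑ i, c i • S i a, 0) := by
    rw [H.equiv_apply, hfα0, Prod.mk.injEq]
    refine ⟨?_, rfl⟩
    rw [sub_sub, ← he1]
    abel
  have hsol : (deriv α 0, deriv μ 0) = (H.poisson (∑ i, c i • S i a), f (∑ i, c i • S i a)) := by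
    rw [← H.equiv_symm, ← hkey, LinearEquiv.symm_apply_apply]
  rw [Prod.mk.injEq] at hsol
  refine ⟨by rw [hsol.2]; simp [_root_.map_sum], ?_⟩
  -- second order
  have hμeq : ∀ᶠ z in 𝓝 (0 : ℂ), μ z = ∑ i, Complex.exp (z * c i) * f (S i (α z)) := by
    filter_upwards [heq] with z hz
    have := congrArg f hz.1
    rw [map_smul, hz.2, smul_eq_mul, mul_one, _root_.map_sum] at this
    rw [← this]
    exact Finset.sum_congr rfl fun i _ => by rw [map_smul, smul_eq_mul]
  have hdμ : ∀ᶠ z in 𝓝 (0 : ℂ), deriv μ z =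
      ∑ i, (c i * Complex.exp (z * c i) * f (S i (α z)) +
        Complex.exp (z * c i) * f (S i (deriv α z))) := by
    filter_upwards [hα.eventually_analyticAt, hμeq.eventually_nhds] with z hz h1
    rw [Filter.EventuallyEq.deriv_eq h1]
    exact (HasDerivAt.fun_sum (u := Finset.univ) fun i _ => (hexp i z).fun_mul
      (hSα (S i) z hz |> fun h => f.hasFDerivAt.comp_hasDerivAt z h)).deriv
  rw [Filter.EventuallyEq.deriv_eq hdμ]
  have hdd : HasDerivAt (deriv α) (deriv (deriv α) 0) 0 := hα.deriv.differentiableAt.hasDerivAt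
  have hfdd : f (deriv (deriv α) 0) = 0 := by
    have h2 : HasDerivAt (fun z => f (deriv α z)) (f (deriv (deriv α) 0)) 0 :=
      f.hasFDerivAt.comp_hasDerivAt 0 hdd
    exact h2.unique ((hasDerivAt_const 0 (0 : ℂ)).congr_of_eventuallyEq hfα)
  have hfin := HasDerivAt.fun_sum (u := Finset.univ) fun i _ =>
    (((hexp i 0).const_mul (c i)).fun_mul
      (hSα (S i) 0 hα |> fun h => f.hasFDerivAt.comp_hasDerivAt (0 : ℂ) h)).fun_add
    ((hexp i 0).fun_mul ((S i).hasFDerivAt.comp_hasDerivAt (0 : ℂ) hdd |>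
      fun h => f.hasFDerivAt.comp_hasDerivAt (0 : ℂ) h))
  -- The contribution of α'' drops out, because f is a left eigenvector and f(α''(0)) = 0.
  have hS2 : ∑ i, f (S i (deriv (deriv α) 0)) = 0 := by
    rw [← _root_.map_sum, H.map_sum, hfdd]
  refine hfin.deriv.trans ?_
  simp only [zero_mul, Complex.exp_zero, mul_one, one_mul, hα0, Function.comp_apply,
    Finset.sum_add_distrib, hS2, hsol.1, pow_two, mul_assoc]
  ring

end Perturbation

/-! ### One-variable calculus for the eigenvalue -/

section Scalar

/-- A real function agreeing with an analytic function near `0`. -/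
theorem derivs_of_eventually_eq_ofReal {μ : ℂ → ℂ} (hμ : AnalyticAt ℂ μ 0) {g : ℝ → ℝ}
    (hg : ∀ᶠ t : ℝ in 𝓝 0, μ t = g t) :
    ContDiffAt ℝ 2 g 0 ∧ deriv μ 0 = deriv g 0 ∧ deriv (deriv μ) 0 = iteratedDeriv 2 g 0 := by
  -- Stated for a general pair and base point so that it applies twice: to μ at all small t, then to
  -- μ' at 0.
  have hstep : ∀ (ν : ℂ → ℂ) (k : ℝ → ℝ) (t : ℝ), AnalyticAt ℂ ν t →
      (∀ᶠ s : ℝ in 𝓝 t, ν s = k s) → deriv ν t = deriv k t := by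
    intro ν k t hν hk
    have h1 : HasDerivAt (fun s : ℝ => ν s) (deriv ν t) t :=
      hν.differentiableAt.hasDerivAt.comp_ofReal
    have h2 : HasDerivAt (fun s : ℝ => (ν s).re) (deriv ν t).re t :=
      hν.differentiableAt.hasDerivAt.real_of_complex
    have h3 : HasDerivAt k (deriv ν t).re t :=
      h2.congr_of_eventuallyEq (hk.mono fun s hs => by
        change k s = (ν s).re
        rw [hs, Complex.ofReal_re])
    have h4 := h3.ofReal_comp.congr_of_eventuallyEq hk
    rw [h3.deriv]
    exact h1.unique h4
  have hcast : Tendsto (fun t : ℝ => (t : ℂ)) (𝓝 0) (𝓝 0) := by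
    simpa using Complex.continuous_ofReal.tendsto 0
  have hev : ∀ᶠ t : ℝ in 𝓝 0, deriv μ t = deriv g t := by
    filter_upwards [hcast.eventually hμ.eventually_analyticAt, hg.eventually_nhds] with t h1 h2
    exact hstep μ g t h1 h2
  refine ⟨?_, by simpa using hev.self_of_nhds, ?_⟩
  · have h1 : ContDiffAt ℝ 2 (fun t : ℝ => (μ t).re) 0 := by
      have h2 : ContDiffAt ℂ 2 μ ((0 : ℝ) : ℂ) := by simpa using hμ.contDiffAt
      exact h2.real_of_complex
    exact h1.congr_of_eventuallyEq (hg.mono fun t ht => by simp [ht])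
  · rw [iteratedDeriv_succ, iteratedDeriv_one]
    have := hstep (deriv μ) (deriv g) 0 (by simpa using hμ.deriv) hev
    simpa using this

/-- The quadratic approximation of an eigenvalue gives the Gaussian limit. -/
theorem tendsto_pow_exp_of_analyticAt {μ : ℂ → ℂ} (hμ : AnalyticAt ℂ μ 0) (h0 : μ 0 = 1) :
    Tendsto (fun n : ℕ => (μ (((√(n : ℝ))⁻¹ : ℝ) * Complex.I) *
      Complex.exp (-(deriv μ 0) * (((√(n : ℝ))⁻¹ : ℝ) * Complex.I))) ^ n) atTop
      (𝓝 (Complex.exp (-(deriv (deriv μ) 0 - deriv μ 0 ^ 2) / 2))) := by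
  set m := deriv μ 0 with hm
  -- The exponential factor removes the linear term, so ν(z) = 1 + (μ'' - μ'²)z²/2 + O(z³). At z =
  -- i/√n we have n z² = -1, and the limit of (1 + c/n + o(1/n))^n applies.
  set ν : ℂ → ℂ := fun z => μ z * Complex.exp (-m * z) with hν
  have hexp : ∀ z, HasDerivAt (fun z : ℂ => Complex.exp (-m * z)) (-m * Complex.exp (-m * z)) z :=
    fun z => by
      have := ((hasDerivAt_id z).const_mul (-m)).cexp
      simpa [mul_comm] using this
  have hexpa : AnalyticAt ℂ (fun z : ℂ => Complex.exp (-m * z)) 0 := by fun_prop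
  have hνa : AnalyticAt ℂ ν 0 := hμ.mul hexpa
  have hν0 : ν 0 = 1 := by simp [hν, h0]
  have hν1 : ∀ᶠ z in 𝓝 (0 : ℂ), deriv ν z =
      deriv μ z * Complex.exp (-m * z) + μ z * (-m * Complex.exp (-m * z)) := by
    filter_upwards [hμ.eventually_analyticAt] with z hz
    exact (hz.differentiableAt.hasDerivAt.fun_mul (hexp z)).deriv
  have hν10 : deriv ν 0 = 0 := by
    rw [hν1.self_of_nhds, h0, ← hm]; simp
  have hν2 : deriv (deriv ν) 0 = deriv (deriv μ) 0 - m ^ 2 := by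
    rw [Filter.EventuallyEq.deriv_eq hν1]
    refine ((hμ.deriv.differentiableAt.hasDerivAt.fun_mul (hexp 0)).fun_add
      (hμ.differentiableAt.hasDerivAt.fun_mul ((hexp 0).const_mul (-m)))).deriv.trans ?_
    simp only [mul_zero, Complex.exp_zero, h0, ← hm]
    ring
  have htay := (hνa.hasFPowerSeriesAt.isBigO_sub_partialSum_pow 3)
  have hps : ∀ y, (FormalMultilinearSeries.ofScalars ℂ
      (fun n => iteratedDeriv n ν 0 / (n.factorial : ℂ))).partialSum 3 y =
      1 + (deriv (deriv μ) 0 - m ^ 2) / 2 * y ^ 2 := by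
    intro y
    simp only [FormalMultilinearSeries.partialSum, Finset.sum_range_succ, Finset.sum_range_zero,
      FormalMultilinearSeries.ofScalars_apply_eq, iteratedDeriv_zero, iteratedDeriv_one,
      iteratedDeriv_succ (n := 1), hν0, hν10, hν2]
    simp [Nat.factorial]
  simp only [hps, zero_add] at htay
  obtain ⟨C, hC⟩ := htay.bound
  have hz : Tendsto (fun n : ℕ => (((√(n : ℝ))⁻¹ : ℝ) : ℂ) * Complex.I) atTop (𝓝 0) := by
    have h1 : Tendsto (fun n : ℕ => (√(n : ℝ))⁻¹) atTop (𝓝 0) :=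
      tendsto_inv_atTop_zero.comp (Real.tendsto_sqrt_atTop.comp tendsto_natCast_atTop_atTop)
    have h2 := (Complex.continuous_ofReal.tendsto 0).comp h1
    have h3 := h2.mul_const Complex.I
    simpa using h3
  have hsq : ∀ n : ℕ, n ≠ 0 → ((((√(n : ℝ))⁻¹ : ℝ) : ℂ) * Complex.I) ^ 2 = -(n : ℂ)⁻¹ := by
    intro n hn
    rw [mul_pow, Complex.I_sq, ← Complex.ofReal_pow, inv_pow, Real.sq_sqrt (by positivity)]
    push_cast
    ring
  have hfin := Complex.tendsto_one_add_pow_exp_of_tendsto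
    (g := fun n : ℕ => ν (((√(n : ℝ))⁻¹ : ℝ) * Complex.I) - 1)
    (t := -(deriv (deriv μ) 0 - m ^ 2) / 2) ?_
  · refine hfin.congr fun n => ?_
    rw [add_sub_cancel]
  · rw [tendsto_iff_norm_sub_tendsto_zero]
    have h1 : Tendsto (fun n : ℕ => C * ‖(((√(n : ℝ))⁻¹ : ℝ) : ℂ) * Complex.I‖) atTop (𝓝 0) := by
      simpa using (hz.norm.const_mul C)
    refine squeeze_zero' (Eventually.of_forall fun n => norm_nonneg _) ?_ h1
    filter_upwards [hz.eventually hC, eventually_ne_atTop 0] with n hn hn0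
    have hn' : (n : ℂ) ≠ 0 := by exact_mod_cast hn0
    set z := (((√(n : ℝ))⁻¹ : ℝ) : ℂ) * Complex.I with hzdef
    have e1 : (n : ℂ) * (ν z - 1) - -(deriv (deriv μ) 0 - m ^ 2) / 2 =
        n * (ν z - (1 + (deriv (deriv μ) 0 - m ^ 2) / 2 * z ^ 2)) := by
      rw [hsq n hn0]
      field_simp
      ring
    have e2 : (n : ℝ) * ‖z‖ ^ 2 = 1 := by
      rw [← norm_pow, hsq n hn0, norm_neg, norm_inv, Complex.norm_natCast]
      field_simp
    rw [e1, norm_mul, Complex.norm_natCast]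
    rw [norm_pow, norm_norm] at hn
    calc (n : ℝ) * ‖ν z - (1 + (deriv (deriv μ) 0 - m ^ 2) / 2 * z ^ 2)‖
        ≤ n * (C * ‖z‖ ^ 3) := by gcongr
      _ = C * ‖z‖ * (n * ‖z‖ ^ 2) := by ring
      _ = C * ‖z‖ := by rw [e2, mul_one]

end Scalar

/-! ### Spectral radius from a strictly positive eigenvector -/

section SpectralRadius

variable {h : Type*} [NormedAddCommGroup h] [InnerProductSpace ℂ h] [FiniteDimensional ℂ h]
  [CompleteSpace h] {v : ℕ} (K : Fin v → h →L[ℂ] h)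

/-- The two maps are transposes for the bilinear trace pairing, so an eigenvector pairs to zero with
the range of the shifted transpose. Being bilinear, the pairing introduces no conjugation of κ. -/
theorem eq_zero_of_surjective_krausDual_sub {κ : ℂ} {σ : h →L[ℂ] h} (hσ : krausMap K σ = κ • σ)
    (hs : Function.Surjective (krausDual K - κ • (1 : Module.End ℂ (h →L[ℂ] h)))) : σ = 0 := by
  refine eq_of_tr_mul fun y => ?_
  obtain ⟨x, rfl⟩ := hs y
  rw [zero_mul, tr_zero, LinearMap.sub_apply, LinearMap.smul_apply, Module.End.one_apply, mul_sub,
    tr_sub, tr_mul_krausDual, hσ, smul_mul_assoc, mul_smul_comm, sub_self]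

theorem eq_zero_of_surjective_krausMap_sub {κ : ℂ} {x : h →L[ℂ] h} (hx : krausDual K x = κ • x)
    (hs : Function.Surjective (krausMap K - κ • (1 : Module.End ℂ (h →L[ℂ] h)))) : x = 0 := by
  refine eq_of_tr_mul fun y => ?_
  obtain ⟨σ, rfl⟩ := hs y
  rw [zero_mul, tr_zero, tr_mul_comm, LinearMap.sub_apply, LinearMap.smul_apply,
    Module.End.one_apply, sub_mul, tr_sub, ← tr_mul_krausDual, hx, smul_mul_assoc, mul_smul_comm,
    sub_self]

theorem exists_eigenvector_of_not_injective {E : Type*} [AddCommGroup E] [Module ℂ E]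
    {T : Module.End ℂ E} {κ : ℂ} (hT : ¬ Function.Injective (T - κ • (1 : Module.End ℂ E))) :
    ∃ x, x ≠ 0 ∧ T x = κ • x := by
  rw [injective_iff_map_eq_zero] at hT
  push Not at hT
  obtain ⟨x, h1, h2⟩ := hT
  refine ⟨x, h2, ?_⟩
  rwa [LinearMap.sub_apply, LinearMap.smul_apply, Module.End.one_apply, sub_eq_zero] at h1

theorem mem_spectrum_of_eigenvector {E : Type*} [AddCommGroup E] [Module ℂ E]
    [FiniteDimensional ℂ E] {T : Module.End ℂ E} {κ : ℂ} {x : E} (hx : x ≠ 0) (hT : T x = κ • x) :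
    κ ∈ spectrum ℂ T :=
  Module.End.hasEigenvalue_iff_mem_spectrum.1
    (Module.End.hasEigenvalue_of_hasEigenvector ⟨Module.End.mem_eigenspace_iff.2 hT, hx⟩)

theorem exists_eigenvector_of_mem_spectrum {E : Type*} [AddCommGroup E] [Module ℂ E]
    [FiniteDimensional ℂ E] {T : Module.End ℂ E} {κ : ℂ} (hκ : κ ∈ spectrum ℂ T) :
    ∃ x, x ≠ 0 ∧ T x = κ • x := by
  obtain ⟨x, h1, h2⟩ := (Module.End.hasEigenvalue_iff_mem_spectrum.2 hκ).exists_hasEigenvector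
  exact ⟨x, h2, Module.End.mem_eigenspace_iff.1 h1⟩

theorem exists_eigenvector_krausDual {κ : ℂ} (hκ : κ ∈ spectrum ℂ (krausMap K)) :
    ∃ x, x ≠ 0 ∧ krausDual K x = κ • x := by
  obtain ⟨σ, h0, hσ⟩ := exists_eigenvector_of_mem_spectrum hκ
  refine exists_eigenvector_of_not_injective fun hi => h0 ?_
  exact eq_zero_of_surjective_krausDual_sub K hσ (LinearMap.surjective_of_injective hi)

theorem mem_spectrum_krausMap {κ : ℂ} {x : h →L[ℂ] h} (hx : x ≠ 0) (hK : krausDual K x = κ • x) :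
    κ ∈ spectrum ℂ (krausMap K) := by
  obtain ⟨σ, h0, hσ⟩ := exists_eigenvector_of_not_injective (T := krausMap K) (κ := κ) fun hi =>
    hx (eq_zero_of_surjective_krausMap_sub K hK (LinearMap.surjective_of_injective hi))
  exact mem_spectrum_of_eigenvector h0 hσ

theorem pow_apply_eigenvector {E : Type*} [AddCommGroup E] [Module ℂ E]
    {T : Module.End ℂ E} {κ : ℂ} {x : E} (hT : T x = κ • x) (n : ℕ) : (T ^ n) x = κ ^ n • x := by
  induction n with
  | zero => simp
  | succ n ih => rw [pow_succ', Module.End.mul_apply, ih, map_smul, hT, smul_smul, pow_succ]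

/-- A strictly positive eigenvector of the dual map belongs to the spectral radius. -/
theorem spectralRadius_krausMap {μ : ℂ} {x : h →L[ℂ] h} {δ : ℝ} (hδ : 0 < δ) (U : Submodule ℂ h)
    (hU : ∀ b φ, ⟪φ, krausDual K b φ⟫_ℂ =
      ⟪U.starProjection φ, krausDual K b (U.starProjection φ)⟫_ℂ)
    (hx : x ≠ 0) (hμ : krausDual K x = μ • x)
    (hlow : ∀ φ, δ * ‖U.starProjection φ‖ ^ 2 ≤ (⟪φ, x φ⟫_ℂ).re) :
    (spectralRadius ℂ (krausMap K)).toReal = ‖μ‖ := by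
  suffices spectralRadius ℂ (krausMap K) = ‖μ‖₊ by rw [this]; rfl
  refine le_antisymm (iSup₂_le fun κ hκ => ?_)
    (le_iSup₂_of_le μ (mem_spectrum_krausMap K hx hμ) le_rfl)
  rw [ENNReal.coe_le_coe, ← NNReal.coe_le_coe, coe_nnnorm, coe_nnnorm]
  obtain ⟨y, hy, hκy⟩ := exists_eigenvector_krausDual K hκ
  by_contra! hlt
  have hκ0 : κ ≠ 0 := fun h0 => by
    rw [h0, norm_zero] at hlt
    exact absurd hlt (norm_nonneg _).not_gt
  have hyU : ∀ φ, ⟪φ, y φ⟫_ℂ = ⟪U.starProjection φ, y (U.starProjection φ)⟫_ℂ := fun φ => by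
    have := hU y φ
    rw [hκy, smul_apply, smul_apply, inner_smul_right, inner_smul_right] at this
    exact mul_left_cancel₀ hκ0 this
  -- Since κ ≠ 0, y lives on U, where x is bounded below, so a multiple of x dominates y. Iterating
  -- gives |κ|^n |⟪φ, y φ⟫| ≤ C |μ|^n, and |κ| > |μ| forces y = 0.
  have hdom : Dominated y (((‖y‖ / δ : ℝ) : ℂ) • x) := fun φ => by
    rw [hyU, smul_apply, inner_smul_right, Complex.re_ofReal_mul, div_mul_eq_mul_div,
      le_div_iff₀ hδ]
    calc _ ≤ ‖U.starProjection φ‖ * (‖y‖ * ‖U.starProjection φ‖) * δ := by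
          gcongr
          exact (norm_inner_le_norm _ _).trans (by gcongr; exact y.le_opNorm _)
      _ = ‖y‖ * (δ * ‖U.starProjection φ‖ ^ 2) := by ring
      _ ≤ _ := by gcongr; exact hlow φ
  apply hy
  refine ext_inner_map_self fun φ => ?_
  rw [zero_apply, inner_zero_right, ← norm_eq_zero]
  have h1 : ∀ n : ℕ, ‖⟪φ, y φ⟫_ℂ‖ ≤ (‖μ‖ / ‖κ‖) ^ n * (‖y‖ / δ * ‖⟪φ, x φ⟫_ℂ‖) := fun n => by
    have h2 := hdom.krausDual_pow (K := K) n φ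
    rw [map_smul, pow_apply_eigenvector hκy, pow_apply_eigenvector hμ, smul_apply,
      inner_smul_right, norm_mul, norm_pow, smul_apply, smul_apply, inner_smul_right,
      inner_smul_right, Complex.re_ofReal_mul] at h2
    have h3 : (μ ^ n * ⟪φ, x φ⟫_ℂ).re ≤ ‖μ‖ ^ n * ‖⟪φ, x φ⟫_ℂ‖ := by
      rw [← norm_pow, ← norm_mul]; exact Complex.re_le_norm _
    rw [div_pow, div_mul_eq_mul_div, le_div_iff₀ (by positivity), mul_comm]
    refine h2.trans ?_
    calc _ ≤ ‖y‖ / δ * (‖μ‖ ^ n * ‖⟪φ, x φ⟫_ℂ‖) := by gcongr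
      _ = _ := by ring
  have h4 : Tendsto (fun n : ℕ => (‖μ‖ / ‖κ‖) ^ n * (‖y‖ / δ * ‖⟪φ, x φ⟫_ℂ‖)) atTop (𝓝 0) := by
    have := (tendsto_pow_atTop_nhds_zero_of_lt_one (by positivity)
      ((div_lt_one (by positivity)).2 hlt)).mul_const (‖y‖ / δ * ‖⟪φ, x φ⟫_ℂ‖)
    simpa using this
  exact le_antisymm (ge_of_tendsto' h4 h1) (norm_nonneg _)

end SpectralRadius

/-! ### Compressed maps paired with an invariant state -/

section Tilted

variable {h : Type*} [NormedAddCommGroup h] [InnerProductSpace ℂ h] [FiniteDimensional ℂ h]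
  [CompleteSpace h] {v : ℕ} {L : Fin v → h →L[ℂ] h} {V : Submodule ℂ h}

local notation "P" => suppProj L V
local notation "A" => absorption L V

/-- The maps `b ↦ T i* b T i` for the compressed Kraus operators `T i`. -/
def sandwich (L : Fin v → h →L[ℂ] h) (V : Submodule ℂ h) (i : Fin v) :
    (h →L[ℂ] h) →L[ℂ] (h →L[ℂ] h) :=
  ContinuousLinearMap.mulLeftRight ℂ (h →L[ℂ] h)
    (ContinuousLinearMap.adjoint (compressed L V i)) (compressed L V i)

theorem sandwich_apply (i : Fin v) (b : h →L[ℂ] h) : sandwich L V i b =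
    ContinuousLinearMap.adjoint (compressed L V i) * b * compressed L V i := rfl

theorem sum_sandwich (b : h →L[ℂ] h) : ∑ i, sandwich L V i b = krausDual (compressed L V) b := rfl

theorem suppProj_sandwich (i : Fin v) (b : h →L[ℂ] h) :
    P * sandwich L V i b * P = sandwich L V i b := adjoint_compressed_mul b i

theorem apply_mem_supp {τ : h →L[ℂ] h} (hτ : τ.IsPositive) (φ : h) : τ φ ∈ supp τ := by
  rw [supp, Submodule.mem_orthogonal]
  intro ψ hψ
  have : τ ψ = 0 := hψ
  rw [← hτ.inner_left_eq_inner_right, this, inner_zero_left]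

/-- An invariant state supported in `V`. -/
structure InvariantState (L : Fin v → h →L[ℂ] h) (V : Submodule ℂ h) (τ : h →L[ℂ] h) : Prop where
  isState : IsState τ
  fixed : krausMap L τ = τ
  supp_le : supp τ ≤ V

namespace InvariantState

variable {τ : h →L[ℂ] h} (Hτ : InvariantState L V τ)
include Hτ

theorem apply_mem (φ : h) : τ φ ∈ V := Hτ.supp_le (apply_mem_supp Hτ.isState.1 φ)

theorem mul_of_eqOn {G : h →L[ℂ] h} (hG : ∀ x ∈ V, G x = x) (hL : ∀ i, ∀ x ∈ V, L i x ∈ V)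
    (i : Fin v) : G * (L i * τ) = L i * τ := by
  ext φ
  exact hG _ (hL i _ (Hτ.apply_mem φ))

/-- The range of τ lies in V, which the L i preserve and on which P is the identity, so the
projections around L i are invisible next to τ. -/
theorem tr_mul_sandwich (H : Invariant L V) (i : Fin v) (b : h →L[ℂ] h) :
    tr (τ * sandwich L V i b) = tr (τ * (ContinuousLinearMap.adjoint (L i) * b * L i)) := by
  have h1 : P * τ = τ := by
    ext φ; exact H.suppProj_eqOn (Hτ.apply_mem φ)
  have h2 : P * (L i * τ) = L i * τ := Hτ.mul_of_eqOn (fun x hx => H.suppProj_eqOn hx) H.map_mem i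
  have h3 : compressed L V i * τ = L i * τ := by
    rw [compressed, mul_assoc, h1, mul_assoc, h2]
  have h4 : τ * ContinuousLinearMap.adjoint (compressed L V i) =
      τ * ContinuousLinearMap.adjoint (L i) := by
    have := congrArg star h3
    rwa [star_mul, star_mul, Hτ.isState.1.isSelfAdjoint.star_eq] at this
  rw [sandwich_apply]
  rw [← mul_assoc, ← mul_assoc, h4, mul_assoc, ← tr_mul_comm, mul_assoc, ← mul_assoc _ τ, h3]
  rw [tr_mul_comm, ← mul_assoc, ← mul_assoc, tr_mul_comm (_ * _ * _) (L i)]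
  simp only [mul_assoc]

theorem tr_sandwich_absorption (H : Invariant L V) (i : Fin v) :
    tr (τ * sandwich L V i A) = tr (L i * τ * ContinuousLinearMap.adjoint (L i)) := by
  rw [Hτ.tr_mul_sandwich H, tr_mul_comm, mul_assoc _ (L i) τ, mul_assoc _ A,
    Hτ.mul_of_eqOn (fun x hx => H.absorption_eqOn hx) H.map_mem, tr_mul_comm]

theorem tr_absorption (H : Invariant L V) : tr (τ * A) = 1 := by
  have h1 : A * τ = τ := by
    ext φ; exact H.absorption_eqOn (Hτ.apply_mem φ)
  rw [tr_mul_comm, h1, Hτ.isState.2]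

theorem simpleFixed (H : MinimalInvariant L V) : SimpleFixed (sandwich L V) A (trMulL τ) where
  sum_apply := by
    rw [sum_sandwich, H.krausDual_compressed H.suppProj_absorption, H.krausDual_absorption]
  map_sum b := by
    simp only [trMulL_apply, Finset.mul_sum, tr_sum, Hτ.tr_mul_sandwich H.toInvariant]
    rw [← tr_sum, ← Finset.mul_sum, ← krausDual_apply, tr_mul_krausDual, Hτ.fixed]
  map_self := Hτ.tr_absorption H.toInvariant
  ker b hb := H.exists_eq_smul (by rwa [sum_sandwich] at hb)

/-- Pair the Poisson decomposition x = tr(τ x) A + coboundary with τ': coboundaries vanish and tr(τ'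
A) = 1, so tr(τ' x) = tr(τ x). -/
theorem unique (H : MinimalInvariant L V) {τ' : h →L[ℂ] h} (Hτ' : InvariantState L V τ') :
    τ' = τ := by
  refine eq_of_tr_mul fun x => ?_
  have h1 := (Hτ.simpleFixed H).sum_poisson x
  have h2 := congrArg (trMulL τ') h1
  rw [map_sub, map_add, (Hτ'.simpleFixed H).map_sum, add_sub_cancel_right, map_smul,
    (Hτ'.simpleFixed H).map_self, smul_eq_mul, mul_one] at h2
  exact h2

end InvariantState

end Tilted

/-! ### Symmetric matrices and quadratic forms -/

section QuadraticForms

variable {d : ℕ}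

theorem inner_toEuclideanLin_single (D : Matrix (Fin d) (Fin d) ℝ) (u : EuclideanSpace ℝ (Fin d)) :
    ⟪u, Matrix.toEuclideanLin D u⟫_ℝ = ∑ i, ∑ j, u i * (D i j * u j) := by
  simp only [PiLp.inner_apply, Matrix.toLpLin_apply, Matrix.mulVec, dotProduct,
    RCLike.inner_apply, conj_trivial, Finset.sum_mul]
  exact Finset.sum_congr rfl fun i _ => Finset.sum_congr rfl fun j _ => by ring

/-- The symmetric matrix of the quadratic form of a bilinear form. -/
theorem exists_matrix_of_bilin
    (B : EuclideanSpace ℝ (Fin d) →ₗ[ℝ] EuclideanSpace ℝ (Fin d) →ₗ[ℝ] ℝ) :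
    ∃ D : Matrix (Fin d) (Fin d) ℝ, D.IsSymm ∧
      ∀ u, ⟪u, Matrix.toEuclideanLin D u⟫_ℝ = B u u := by
  let e := EuclideanSpace.basisFun (Fin d) ℝ
  refine ⟨Matrix.of fun i j => (B (e i) (e j) + B (e j) (e i)) / 2, ?_, fun u => ?_⟩
  · ext i j
    simp [add_comm]
  · have hu : u = ∑ i, u i • e i := by
      simpa [e] using (e.sum_repr u).symm
    have hB : B u u = ∑ i, ∑ j, u i * (u j * B (e i) (e j)) := by
      conv_lhs => rw [hu]
      simp only [map_sum, LinearMap.sum_apply, map_smul, LinearMap.smul_apply, smul_eq_mul,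
        Finset.mul_sum]
      rw [Finset.sum_comm]
      exact Finset.sum_congr rfl fun i _ => Finset.sum_congr rfl fun j _ => by ring
    have hB' : B u u = ∑ i, ∑ j, u i * (u j * B (e j) (e i)) := by
      rw [hB, Finset.sum_comm]
      exact Finset.sum_congr rfl fun i _ => Finset.sum_congr rfl fun j _ => by ring
    have h2 : B u u = (B u u + B u u) / 2 := by ring
    rw [inner_toEuclideanLin_single, h2]
    nth_rewrite 1 [hB]
    rw [hB', ← Finset.sum_add_distrib, Finset.sum_div]
    refine Finset.sum_congr rfl fun i _ => ?_
    rw [← Finset.sum_add_distrib, Finset.sum_div]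
    refine Finset.sum_congr rfl fun j _ => ?_
    simp only [Matrix.of_apply]
    ring

theorem matrix_eq_of_quadraticForm_eq {D D' : Matrix (Fin d) (Fin d) ℝ} (hD : D.IsSymm)
    (hD' : D'.IsSymm) (heq : ∀ u, ⟪u, Matrix.toEuclideanLin D' u⟫_ℝ =
      ⟪u, Matrix.toEuclideanLin D u⟫_ℝ) : D' = D := by
  have hsym : (Matrix.toEuclideanLin (D' - D)).IsSymmetric := by
    rw [Matrix.isSymmetric_toEuclideanLin_iff]
    exact (hD'.sub hD : (D' - D).IsSymm)
  have h0 := (hsym.inner_map_self_eq_zero (𝕜 := ℝ)).1 fun u => by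
    rw [real_inner_comm, map_sub, LinearMap.sub_apply, inner_sub_right, heq, sub_self]
  rw [LinearEquiv.map_eq_zero_iff] at h0
  exact sub_eq_zero.1 h0

end QuadraticForms

/-! ### Tilted maps of the walk and the eigenvalue branch -/

namespace HOQRW

variable {d v : ℕ} {h : Type*} [NormedAddCommGroup h] [InnerProductSpace ℂ h]
  [FiniteDimensional ℂ h] [CompleteSpace h] {W : HOQRW d v h} {V : Submodule ℂ h}
  {τ : h →L[ℂ] h}

local notation "P" => suppProj W.L V
local notation "A" => absorption W.L V
local notation "S" => sandwich W.L V

theorem tilt_eq (u : EuclideanSpace ℝ (Fin d)) (i : Fin v) :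
    W.tilt V u i = (Real.exp (⟪u, W.s i⟫_ℝ / 2) : ℂ) • compressed W.L V i := rfl

/-- The half weights on the two sides of b multiply to exp(u·s i), which puts the tilted dual map in
the form treated by the perturbation theorem. -/
theorem krausDual_tilt (u : EuclideanSpace ℝ (Fin d)) (b : h →L[ℂ] h) :
    krausDual (W.tilt V u) b = ∑ i, Complex.exp (⟪u, W.s i⟫_ℝ) • S i b := by
  rw [krausDual_apply]
  refine Finset.sum_congr rfl fun i _ => ?_
  rw [tilt_eq, sandwich_apply, ← ContinuousLinearMap.star_eq_adjoint, star_smul,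
    Complex.star_def, Complex.conj_ofReal, smul_mul_assoc, smul_mul_assoc, mul_smul_comm, smul_smul,
    ← Complex.ofReal_mul, ← Real.exp_add, add_halves, Complex.ofReal_exp]
  rfl

theorem star_sandwich (i : Fin v) (b : h →L[ℂ] h) : star (S i b) = S i (star b) := by
  rw [sandwich_apply, sandwich_apply, ← ContinuousLinearMap.star_eq_adjoint, star_mul, star_mul,
    star_star, mul_assoc]

end HOQRW

theorem tr_star {h : Type*} [NormedAddCommGroup h] [InnerProductSpace ℂ h] [FiniteDimensional ℂ h]
    [CompleteSpace h] (x : h →L[ℂ] h) : tr (star x) = (starRingEnd ℂ) (tr x) := by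
  rw [tr, tr, LinearMap.trace_eq_sum_inner _ (stdOrthonormalBasis ℂ h),
    LinearMap.trace_eq_sum_inner _ (stdOrthonormalBasis ℂ h), map_sum]
  refine Finset.sum_congr rfl fun i _ => ?_
  rw [inner_conj_symm, ContinuousLinearMap.coe_coe, ContinuousLinearMap.coe_coe,
    ContinuousLinearMap.star_eq_adjoint, ContinuousLinearMap.adjoint_inner_right]

namespace HOQRW

variable {d v : ℕ} {h : Type*} [NormedAddCommGroup h] [InnerProductSpace ℂ h]
  [FiniteDimensional ℂ h] [CompleteSpace h] {W : HOQRW d v h} {V : Submodule ℂ h}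
  {τ : h →L[ℂ] h}

local notation "P" => suppProj W.L V
local notation "A" => absorption W.L V
local notation "S" => sandwich W.L V

/-- The analytic eigenvalue and eigenvector of the dual tilted maps along the direction `u`. -/
structure EigenBranch (W : HOQRW d v h) (V : Submodule ℂ h) (u : EuclideanSpace ℝ (Fin d))
    (α : ℂ → h →L[ℂ] h) (μ : ℂ → ℂ) : Prop where
  analytic_vec : AnalyticAt ℂ α 0
  analytic_val : AnalyticAt ℂ μ 0
  vec_zero : α 0 = absorption W.L V
  val_zero : μ 0 = 1
  eigen : ∀ᶠ z in 𝓝 0, ∑ i, Complex.exp (z * ⟪u, W.s i⟫_ℝ) • sandwich W.L V i (α z) = μ z • α z ∧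
    suppProj W.L V * α z * suppProj W.L V = α z
  val_eq_lam : ∀ᶠ t : ℝ in 𝓝 0, μ t = W.lam V (t • u)

/-- The perturbed branch is identified with λ along the real axis: μ(t) is real by a conjugation
symmetry and local uniqueness, it has positive real part near 0, and its eigenvector is positive on
the support of A, so it is the spectral radius. -/
theorem exists_eigenBranch (H : MinimalInvariant W.L V) (Hτ : InvariantState W.L V τ)
    (u : EuclideanSpace ℝ (Fin d)) : ∃ α μ, EigenBranch W V u α μ ∧
      deriv μ 0 = ∑ i, (⟪u, W.s i⟫_ℝ : ℂ) * trMulL τ (S i A) ∧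
      deriv (deriv μ) 0 = ∑ i, (⟪u, W.s i⟫_ℝ : ℂ) ^ 2 * trMulL τ (S i A) +
        2 * ∑ i, (⟪u, W.s i⟫_ℝ : ℂ) * trMulL τ (S i ((Hτ.simpleFixed H).poisson
          (∑ i, (⟪u, W.s i⟫_ℝ : ℂ) • S i A))) := by
  obtain ⟨α, μ, hα, hμ, hα0, hμ0, heq, huniq⟩ :=
    (Hτ.simpleFixed H).exists_perturbation fun i => (⟪u, W.s i⟫_ℝ : ℂ)
  refine ⟨α, μ, ⟨hα, hμ, hα0, hμ0, ?_, ?_⟩,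
    (Hτ.simpleFixed H).perturbation_deriv _ hα hμ hα0 hμ0 heq⟩
  · have h1 : ∀ᶠ z in 𝓝 (0 : ℂ), μ z ≠ 0 :=
      hμ.continuousAt.eventually_ne (by rw [hμ0]; exact one_ne_zero)
    filter_upwards [heq, h1] with z hz hz0
    refine ⟨hz.1, ?_⟩
    -- The tilted dual map only outputs operators b = P b P, so an eigenvector with nonzero
    -- eigenvalue is of this kind.
    have h2 : P * (μ z • α z) * P = μ z • α z := by
      rw [← hz.1, Finset.mul_sum, Finset.sum_mul]
      refine Finset.sum_congr rfl fun i _ => ?_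
      rw [mul_smul_comm, smul_mul_assoc, suppProj_sandwich]
    rw [mul_smul_comm, smul_mul_assoc] at h2
    exact smul_right_injective _ hz0 h2
  · have hcast : Tendsto (fun t : ℝ => (t : ℂ)) (𝓝 0) (𝓝 0) := by
      simpa using Complex.continuous_ofReal.tendsto 0
    have hαt : Tendsto (fun t : ℝ => α t) (𝓝 0) (𝓝 A) := by
      rw [← hα0]; exact hα.continuousAt.tendsto.comp hcast
    have hμt : Tendsto (fun t : ℝ => μ t) (𝓝 0) (𝓝 1) := by
      rw [← hμ0]; exact hμ.continuousAt.tendsto.comp hcast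
    -- For real t, (α(t)*, conj μ(t)) solves the same normalized equation and stays near (A, 1), so
    -- uniqueness makes it equal to (α(t), μ(t)).
    have hstar : Tendsto (fun t : ℝ => ((t : ℂ), star (α t), (starRingEnd ℂ) (μ t))) (𝓝 0)
        (𝓝 (0, A, 1)) := by
      refine hcast.prodMk_nhds (Tendsto.prodMk_nhds ?_ ?_)
      · have := (continuous_star.tendsto _).comp hαt
        rwa [H.absorption_isPositive.isSelfAdjoint.star_eq] at this
      · have := (Complex.continuous_conj.tendsto _).comp hμt
        rwa [map_one] at this
    obtain ⟨δ, hδ, hlow⟩ := exists_lower_bound_supp H.absorption_isPositive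
    -- Within δ/2 of A, the operator α(t) keeps at least half of the lower bound δ of A on its
    -- support.
    have hclose : ∀ᶠ t : ℝ in 𝓝 0, ‖α t - A‖ < δ / 2 := by
      have := tendsto_iff_norm_sub_tendsto_zero.1 hαt
      exact this.eventually (gt_mem_nhds (by positivity))
    have hre : ∀ᶠ t : ℝ in 𝓝 0, 0 < (μ t).re := by
      have := (Complex.continuous_re.tendsto _).comp hμt
      exact this.eventually (lt_mem_nhds (by simp))
    filter_upwards [hstar.eventually huniq, hcast.eventually heq, hclose, hre] with t h1 h2 h3 h4
    have hreal : (starRingEnd ℂ) (μ t) = μ t := by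
      refine (h1 ?_ ?_).2
      · have h5 := congrArg star h2.1
        rw [star_sum, star_smul] at h5
        rw [← Complex.star_def, ← h5]
        refine Finset.sum_congr rfl fun i _ => ?_
        rw [star_smul, star_sandwich, ← Complex.ofReal_mul, ← Complex.ofReal_exp, Complex.star_def,
          Complex.conj_ofReal]
      · have h5 : trMulL τ (star (α t)) = star (trMulL τ (α t)) := by
          rw [trMulL_apply, trMulL_apply, Complex.star_def, ← tr_star, star_mul,
            Hτ.isState.1.isSelfAdjoint.star_eq, tr_mul_comm]
        rw [h5, h2.2, star_one]
    have hμnorm : μ t = (‖μ t‖ : ℂ) := by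
      have h5 : μ t = ((μ t).re : ℂ) := (Complex.conj_eq_iff_re.1 hreal).symm
      rw [h5, Complex.norm_real, Real.norm_of_nonneg h4.le]
    have heig : krausDual (W.tilt V (t • u)) (α t) = μ t • α t := by
      rw [krausDual_tilt, ← h2.1]
      refine Finset.sum_congr rfl fun i _ => ?_
      rw [real_inner_smul_left, Complex.ofReal_mul]
    have hPk : ∀ b, P * krausDual (W.tilt V (t • u)) b * P = krausDual (W.tilt V (t • u)) b := by
      intro b
      rw [krausDual_tilt, Finset.mul_sum, Finset.sum_mul]
      refine Finset.sum_congr rfl fun i _ => ?_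
      rw [mul_smul_comm, smul_mul_assoc, suppProj_sandwich]
    have hμ0 : μ t ≠ 0 := fun h0 => by simp [h0] at h4
    have hα0 : α t ≠ 0 := fun h0 => by simpa [h0, tr_zero] using h2.2
    have hPα : P * α t * P = α t := by
      have h5 := hPk (α t)
      rw [heig, mul_smul_comm, smul_mul_assoc] at h5
      exact smul_right_injective _ hμ0 h5
    rw [lam, spectralRadius_krausMap (W.tilt V (t • u)) (half_pos hδ) (supp A)
      (fun b φ => inner_suppProj (hPk b) φ) hα0 heig fun φ => ?_]
    · exact hμnorm
    · have h5 := hlow (P φ)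
      have h6 : P (P φ) = P φ := by rw [← op_mul_apply, suppProj_mul_self]
      have h7 : ‖⟪P φ, (α t - A) (P φ)⟫_ℂ‖ ≤ δ / 2 * ‖P φ‖ ^ 2 := by
        calc _ ≤ ‖P φ‖ * (‖α t - A‖ * ‖P φ‖) :=
              (norm_inner_le_norm _ _).trans (by gcongr; exact (α t - A).le_opNorm _)
          _ ≤ ‖P φ‖ * (δ / 2 * ‖P φ‖) := by gcongr
          _ = _ := by ring
      have h8 := (abs_le.1 ((Complex.abs_re_le_norm _).trans h7)).1
      rw [inner_suppProj hPα]
      rw [sub_apply, inner_sub_right, Complex.sub_re] at h8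
      change δ * ‖P (P φ)‖ ^ 2 ≤ _ at h5
      rw [h6] at h5
      change δ / 2 * ‖P φ‖ ^ 2 ≤ _
      linarith

theorem trMulL_sandwich_absorption (H : MinimalInvariant W.L V) (Hτ : InvariantState W.L V τ)
    (i : Fin v) : trMulL τ (S i A) =
      ((tr (W.L i * τ * ContinuousLinearMap.adjoint (W.L i))).re : ℂ) := by
  rw [trMulL_apply, Hτ.tr_sandwich_absorption H.toInvariant]
  exact tr_eq_ofReal (Hτ.isState.1.conj_adjoint (W.L i))

theorem sum_inner_eq_inner_drift (H : MinimalInvariant W.L V) (Hτ : InvariantState W.L V τ)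
    (u : EuclideanSpace ℝ (Fin d)) :
    ∑ i, (⟪u, W.s i⟫_ℝ : ℂ) * trMulL τ (S i A) = (⟪u, W.drift τ⟫_ℝ : ℂ) := by
  simp only [trMulL_sandwich_absorption H Hτ]
  rw [drift, inner_sum]
  push_cast
  refine Finset.sum_congr rfl fun i _ => ?_
  rw [real_inner_smul_right, mul_comm, Complex.ofReal_mul]

theorem EigenBranch.derivs {u : EuclideanSpace ℝ (Fin d)} {α : ℂ → h →L[ℂ] h} {μ : ℂ → ℂ}
    (hb : EigenBranch W V u α μ) : ContDiffAt ℝ 2 (fun t : ℝ => W.lam V (t • u)) 0 ∧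
      deriv (deriv μ) 0 - deriv μ 0 ^ 2 = (W.quadForm V u : ℂ) := by
  obtain ⟨h1, h2, h3⟩ := derivs_of_eventually_eq_ofReal hb.analytic_val hb.val_eq_lam
  refine ⟨h1, ?_⟩
  rw [h2, h3, quadForm]
  push_cast
  rfl

/-- The bilinear form whose quadratic form is `quadForm`. -/
theorem exists_bilin (H : MinimalInvariant W.L V) (Hτ : InvariantState W.L V τ) :
    ∃ B : EuclideanSpace ℝ (Fin d) →ₗ[ℝ] EuclideanSpace ℝ (Fin d) →ₗ[ℝ] ℝ,
      ∀ u, B u u = W.quadForm V u := by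
  let c : EuclideanSpace ℝ (Fin d) → Fin v → ℂ := fun u i => (⟪u, W.s i⟫_ℝ : ℂ)
  have cadd : ∀ u w i, c (u + w) i = c u i + c w i := fun u w i => by
    simp only [c]; rw [inner_add_left, Complex.ofReal_add]
  have csmul : ∀ (r : ℝ) u i, c (r • u) i = r * c u i := fun r u i => by
    simp only [c]; rw [real_inner_smul_left, Complex.ofReal_mul]
  let D : EuclideanSpace ℝ (Fin d) → h →L[ℂ] h := fun u => ∑ i, c u i • S i A
  have Dadd : ∀ u w, D (u + w) = D u + D w := fun u w => by
    simp only [D, cadd, add_smul, Finset.sum_add_distrib]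
  have Dsmul : ∀ (r : ℝ) u, D (r • u) = (r : ℂ) • D u := fun r u => by
    simp only [D, csmul, mul_smul, Finset.smul_sum]
  let q := (Hτ.simpleFixed H).poisson
  -- A bilinear version of the second-order formula minus the product of first-order terms; the
  -- diagonal is μ'' - μ'². It need not be symmetric, and symmetrization happens when D is
  -- extracted.
  let F : EuclideanSpace ℝ (Fin d) → EuclideanSpace ℝ (Fin d) → ℂ := fun u w =>
    ∑ i, c u i * (c w i * trMulL τ (S i A) + 2 * trMulL τ (S i (q (D w)))) -
      (∑ i, c u i * trMulL τ (S i A)) * ∑ i, c w i * trMulL τ (S i A)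
  refine ⟨LinearMap.mk₂ ℝ (fun u w => (F u w).re) ?_ ?_ ?_ ?_, fun u => ?_⟩
  · intro u u' w
    rw [← Complex.add_re]
    congr 1
    simp only [F, cadd, add_mul, Finset.sum_add_distrib]
    ring
  · intro r u w
    rw [smul_eq_mul, ← Complex.re_ofReal_mul]
    congr 1
    simp only [F, csmul, mul_sub, Finset.mul_sum, Finset.sum_mul, mul_assoc]
  · intro u w w'
    rw [← Complex.add_re]
    congr 1
    simp only [F, cadd, Dadd, map_add, add_mul, mul_add, Finset.sum_add_distrib]
    ring
  · intro r u w
    rw [smul_eq_mul, ← Complex.re_ofReal_mul]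
    congr 1
    simp only [F, csmul, Dsmul, map_smul, smul_eq_mul, mul_sub, mul_add, Finset.mul_sum,
      Finset.sum_mul, Finset.sum_add_distrib]
    congr 1
    · congr 1 <;> refine Finset.sum_congr rfl fun i _ => ?_ <;> ring
    · refine Finset.sum_congr rfl fun i _ => Finset.sum_congr rfl fun j _ => ?_
      ring
  · obtain ⟨α, μ, hb, h1, h2⟩ := exists_eigenBranch H Hτ u
    have h3 := hb.derivs.2
    rw [LinearMap.mk₂_apply]
    have h4 : F u u = (W.quadForm V u : ℂ) := by
      rw [← h3, h1, h2]
      simp only [F, mul_add, Finset.sum_add_distrib, pow_two, Finset.mul_sum]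
      congr 1
      congr 1
      · exact Finset.sum_congr rfl fun i _ => by ring
      · exact Finset.sum_congr rfl fun i _ => by ring
    rw [h4, Complex.ofReal_re]

end HOQRW

namespace HOQRW

/-! ### Cylinder sets, path measure and one-step evolution -/

section Paths

variable {d v : ℕ} {h : Type*} [NormedAddCommGroup h] [InnerProductSpace ℂ h]
  [FiniteDimensional ℂ h] [CompleteSpace h] {W : HOQRW d v h}

/-- A discrete separable space is countable. This makes the space of initial path segments
countable. -/
instance (W : HOQRW d v h) : Countable W.V := by
  have := W.discrete
  exact TopologicalSpace.separableSpace_iff_countable.1 inferInstance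

/-- The starting point and the first `n` steps of a path. -/
def pre (W : HOQRW d v h) (n : ℕ) (ω : W.Omega) : W.V × (Fin n → Fin v) := (ω.1, fun i => ω.2 i)

theorem pre_eq_iff {n : ℕ} {ω ω' : W.Omega} :
    pre W n ω = pre W n ω' ↔ ω.1 = ω'.1 ∧ ∀ i < n, ω.2 i = ω'.2 i := by
  simp only [pre, Prod.mk.injEq, funext_iff, Fin.forall_iff]

theorem measurable_pre (n : ℕ) : Measurable (pre W n) := by
  unfold pre
  fun_prop

theorem pre_eq_of_le {m n : ℕ} (hmn : m ≤ n) {ω ω' : W.Omega} (hω : pre W n ω = pre W n ω') :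
    pre W m ω = pre W m ω' := by
  rw [pre_eq_iff] at hω ⊢
  exact ⟨hω.1, fun i hi => hω.2 i (hi.trans_le hmn)⟩

theorem factorsThrough_mono {β : Type*} {F : W.Omega → β} {m n : ℕ} (hmn : m ≤ n)
    (hF : F.FactorsThrough (pre W m)) : F.FactorsThrough (pre W n) :=
  fun _ _ hω => hF (pre_eq_of_le hmn hω)

/-- Initial segments range over a countable space with measurable points, where every function is
measurable. -/
theorem measurable_comap_of_factorsThrough {β : Type*} [Nonempty β] [MeasurableSpace β]
    {F : W.Omega → β} {n : ℕ} (hF : F.FactorsThrough (pre W n)) :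
    Measurable[MeasurableSpace.comap (pre W n) inferInstance] F := by
  obtain ⟨g, rfl⟩ : ∃ g, F = g ∘ pre W n :=
    ⟨Function.extend (pre W n) F fun _ => Classical.arbitrary β,
      funext fun ω => (hF.extend_apply _ ω).symm⟩
  exact (measurable_of_countable g).comp (comap_measurable _)

theorem measurable_of_factorsThrough {β : Type*} [Nonempty β] [MeasurableSpace β]
    {F : W.Omega → β} {n : ℕ} (hF : F.FactorsThrough (pre W n)) : Measurable F :=
  (measurable_comap_of_factorsThrough hF).mono (measurable_pre n).comap_le le_rfl

/-- The cylinder of the paths sharing the first `n` steps with `ω₀`. -/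
def cyl (W : HOQRW d v h) (n : ℕ) (ω₀ : W.Omega) : Set W.Omega := {ω | pre W n ω = pre W n ω₀}

theorem measurableSet_cyl (n : ℕ) (ω₀ : W.Omega) : MeasurableSet (cyl W n ω₀) :=
  measurable_pre n (measurableSet_singleton _)

variable {E : Type*} [NormedAddCommGroup E] [NormedSpace ℝ E]

/-- Integrals are determined by the integrals over the cylinders. -/
theorem integral_eq_of_cyl {μ : Measure W.Omega} {F G : W.Omega → E} (n : ℕ)
    (hF : Integrable F μ) (hG : Integrable G μ)
    (hFG : ∀ ω₀, ∫ ω in cyl W n ω₀, F ω ∂μ = ∫ ω in cyl W n ω₀, G ω ∂μ) :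
    ∫ ω, F ω ∂μ = ∫ ω, G ω ∂μ := by
  have hU : ⋃ a, pre W n ⁻¹' {a} = Set.univ := by
    ext ω; simp
  have hm : ∀ a, MeasurableSet (pre W n ⁻¹' {a}) := fun a =>
    measurable_pre n (measurableSet_singleton a)
  have hd : Pairwise (Function.onFun Disjoint fun a => pre W n ⁻¹' {a}) := fun a b hab =>
    Disjoint.preimage _ (Set.disjoint_singleton.2 hab)
  rw [← setIntegral_univ (f := F), ← setIntegral_univ (f := G), ← hU,
    integral_iUnion hm hd hF.integrableOn, integral_iUnion hm hd hG.integrableOn]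
  refine tsum_congr fun a => ?_
  by_cases ha : ∃ ω₀, pre W n ω₀ = a
  · obtain ⟨ω₀, rfl⟩ := ha
    exact hFG ω₀
  · have : pre W n ⁻¹' {a} = ∅ := by
      ext ω
      simp only [Set.mem_preimage, Set.mem_singleton_iff, Set.mem_empty_iff_false, iff_false]
      exact fun hω => ha ⟨ω, hω⟩
    rw [this, setIntegral_empty, setIntegral_empty]

/-- The path `ω₀` with step number `n` replaced by `i`. -/
def step (ω₀ : W.Omega) (n : ℕ) (i : Fin v) : W.Omega := (ω₀.1, Function.update ω₀.2 n i)

theorem pre_step (ω₀ : W.Omega) (n : ℕ) (i : Fin v) : pre W n (step ω₀ n i) = pre W n ω₀ := by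
  rw [pre_eq_iff]
  exact ⟨rfl, fun j hj => Function.update_of_ne hj.ne _ _⟩

theorem mem_cyl_step {ω₀ ω : W.Omega} {n : ℕ} {i : Fin v} :
    ω ∈ cyl W (n + 1) (step ω₀ n i) ↔ ω ∈ cyl W n ω₀ ∧ ω.2 n = i := by
  change pre W (n + 1) ω = pre W (n + 1) (step ω₀ n i) ↔ pre W n ω = pre W n ω₀ ∧ _
  rw [pre_eq_iff, pre_eq_iff, and_assoc, Nat.forall_lt_succ_right]
  refine and_congr_right fun _ => and_congr (forall₂_congr fun j hj => ?_) ?_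
  · have : (step ω₀ n i).2 j = ω₀.2 j := Function.update_of_ne hj.ne _ _
    rw [this]
  · have : (step ω₀ n i).2 n = i := Function.update_self ..
    rw [this]

theorem setIntegral_cyl_eq_sum {μ : Measure W.Omega} {F : W.Omega → E} (n : ℕ)
    (hF : Integrable F μ) (ω₀ : W.Omega) :
    ∫ ω in cyl W n ω₀, F ω ∂μ = ∑ i, ∫ ω in cyl W (n + 1) (step ω₀ n i), F ω ∂μ := by
  have hU : cyl W n ω₀ = ⋃ i, cyl W (n + 1) (step ω₀ n i) := by
    ext ω; simp [mem_cyl_step]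
  rw [hU, integral_iUnion_fintype (fun i => measurableSet_cyl _ _) ?_ fun i => hF.integrableOn]
  intro i j hij
  refine Set.disjoint_left.2 fun ω hi hj => hij ?_
  rw [mem_cyl_step] at hi hj
  rw [← hi.2, hj.2]

theorem setIntegral_cyl_of_factorsThrough [CompleteSpace E] {μ : Measure W.Omega} {F : W.Omega → E}
    {n : ℕ} (hF : F.FactorsThrough (pre W n)) (ω₀ : W.Omega) :
    ∫ ω in cyl W n ω₀, F ω ∂μ = μ.real (cyl W n ω₀) • F ω₀ := by
  rw [setIntegral_congr_fun (g := fun _ => F ω₀) (measurableSet_cyl n ω₀) fun ω hω => hF hω,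
    setIntegral_const]

theorem integrable_of_factorsThrough [MeasurableSpace E] [BorelSpace E]
    [SecondCountableTopology E] {μ : Measure W.Omega} [IsFiniteMeasure μ] {F : W.Omega → E} {n : ℕ}
    (hF : F.FactorsThrough (pre W n)) {C : ℝ} (hC : ∀ ω, ‖F ω‖ ≤ C) : Integrable F μ :=
  Integrable.of_bound (measurable_of_factorsThrough hF).aestronglyMeasurable C (ae_of_all _ hC)

variable (ρ : W.InitialState)

theorem measureReal_cyl (n : ℕ) (ω₀ : W.Omega) :
    (pathMeasure ρ).real (cyl W n ω₀) = (tr (W.branch (ρ.ρ ω₀.1) ω₀.2 n)).re := by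
  have h1 : cyl W n ω₀ = {ω | ω.1 = ω₀.1 ∧ ∀ i < n, ω.2 i = ω₀.2 i} := by
    ext ω; exact pre_eq_iff
  rw [measureReal_def, h1, isPathMeasure_pathMeasure ρ ω₀.1 n ω₀.2, ENNReal.toReal_ofReal]
  exact tr_re_nonneg (branch_isPositive (ρ.isPositive _) _ _)

theorem branch_factorsThrough (n : ℕ) :
    (fun ω : W.Omega => W.branch (ρ.ρ ω.1) ω.2 n).FactorsThrough (pre W n) := by
  intro ω ω' hω
  rw [pre_eq_iff] at hω
  change W.branch (ρ.ρ ω.1) ω.2 n = W.branch (ρ.ρ ω'.1) ω'.2 n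
  rw [hω.1, branch_congr _ hω.2]

/-- Normalizing at every step or once at the end gives the same operator. With the convention 0⁻¹ =
0 this holds on every path, including null branches, where a positive operator of trace zero is
zero. -/
theorem rho_eq (n : ℕ) (ω : W.Omega) : rho ρ n ω =
    (tr (W.branch (ρ.ρ ω.1) ω.2 n))⁻¹ • W.branch (ρ.ρ ω.1) ω.2 n := by
  induction n with
  | zero => rfl
  | succ n ih =>
    set b := W.branch (ρ.ρ ω.1) ω.2 n with hb
    have hbs : W.branch (ρ.ρ ω.1) ω.2 (n + 1) =
      W.L (ω.2 n) * b * ContinuousLinearMap.adjoint (W.L (ω.2 n)) := rfl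
    by_cases h0 : tr b = 0
    · have hb0 : b = 0 := eq_zero_of_tr_eq_zero (branch_isPositive (ρ.isPositive _) _ _) h0
      rw [hbs, rho, ih, hb0]
      simp
    · rw [hbs, rho, ih, mul_smul_comm, smul_mul_assoc, tr_smul, smul_smul, mul_inv, inv_inv,
        mul_right_comm, mul_inv_cancel₀ h0, one_mul]

theorem rho_factorsThrough (n : ℕ) : (rho ρ n).FactorsThrough (pre W n) := by
  intro ω ω' hω
  have h1 : W.branch (ρ.ρ ω.1) ω.2 n = W.branch (ρ.ρ ω'.1) ω'.2 n := branch_factorsThrough ρ n hω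
  rw [rho_eq, rho_eq, h1]

theorem rho_isPositive (n : ℕ) (ω : W.Omega) : (rho ρ n ω).IsPositive := by
  have hb : (W.branch (ρ.ρ ω.1) ω.2 n).IsPositive := branch_isPositive (ρ.isPositive _) _ _
  rw [rho_eq, tr_eq_ofReal hb]
  refine hb.smul_of_nonneg ?_
  rw [← Complex.ofReal_inv]
  exact Complex.zero_le_real.2 (inv_nonneg.2 (tr_re_nonneg hb))

theorem tr_rho_re_le (n : ℕ) (ω : W.Omega) : (tr (rho ρ n ω)).re ≤ 1 := by
  rw [rho_eq, tr_smul]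
  by_cases h0 : tr (W.branch (ρ.ρ ω.1) ω.2 n) = 0
  · simp [h0]
  · rw [inv_mul_cancel₀ h0, Complex.one_re]

theorem norm_rho_le (n : ℕ) (ω : W.Omega) : ‖rho ρ n ω‖ ≤ 1 :=
  (norm_le_tr (rho_isPositive ρ n ω)).trans (tr_rho_re_le ρ n ω)

theorem norm_tr_mul_rho_le (b : h →L[ℂ] h) (n : ℕ) (ω : W.Omega) :
    ‖tr (b * rho ρ n ω)‖ ≤ ‖trL (h := h)‖ * ‖b‖ := by
  rw [← trL_apply]
  refine ((trL (h := h)).le_opNorm (b * rho ρ n ω)).trans ?_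
  gcongr
  exact (norm_mul_le _ _).trans (mul_le_of_le_one_right (norm_nonneg _) (norm_rho_le ρ n ω))

/-- The cylinder's mass is the trace by which ρ_n was normalized, so expectations of ρ_n become
linear in the unnormalized branch. -/
theorem tr_mul_branch (b : h →L[ℂ] h) (n : ℕ) (ω : W.Omega) :
    (pathMeasure ρ).real (cyl W n ω) • tr (b * rho ρ n ω) =
      tr (b * W.branch (ρ.ρ ω.1) ω.2 n) := by
  have hb : (W.branch (ρ.ρ ω.1) ω.2 n).IsPositive := branch_isPositive (ρ.isPositive _) _ _
  rw [measureReal_cyl, rho_eq, mul_smul_comm, tr_smul, ← Complex.coe_smul, ← tr_eq_ofReal hb,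
    smul_eq_mul, ← mul_assoc]
  by_cases h0 : tr (W.branch (ρ.ρ ω.1) ω.2 n) = 0
  · rw [eq_zero_of_tr_eq_zero hb h0]; simp [tr_zero]
  · rw [mul_inv_cancel₀ h0, one_mul]

theorem mul_tr_factorsThrough {F : W.Omega → ℂ} {n : ℕ} (hF : F.FactorsThrough (pre W n))
    (b : h →L[ℂ] h) : (fun ω => F ω * tr (b * rho ρ n ω)).FactorsThrough (pre W n) :=
  fun ω ω' hω => by
    change F ω * tr (b * rho ρ n ω) = F ω' * tr (b * rho ρ n ω')
    rw [hF hω, rho_factorsThrough ρ n hω]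

theorem integrable_mul_tr {F : W.Omega → ℂ} {n : ℕ} (hF : F.FactorsThrough (pre W n)) {C : ℝ}
    (hC : ∀ ω, ‖F ω‖ ≤ C) (b : h →L[ℂ] h) :
    Integrable (fun ω => F ω * tr (b * rho ρ n ω)) (pathMeasure ρ) :=
  integrable_of_factorsThrough (mul_tr_factorsThrough ρ hF b)
    (C := C * (‖trL (h := h)‖ * ‖b‖)) fun ω => by
      rw [norm_mul]
      have := (norm_nonneg _).trans (hC ω)
      gcongr
      · exact hC ω
      · exact norm_tr_mul_rho_le ρ b n ω

/-- The one-step evolution of weighted expectations of the internal state. -/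
theorem integral_step {F : W.Omega → ℂ} {n : ℕ} (hF : F.FactorsThrough (pre W n)) {C : ℝ}
    (hC : ∀ ω, ‖F ω‖ ≤ C) (b : Fin v → h →L[ℂ] h) :
    ∫ ω, F ω * tr (b (ω.2 n) * rho ρ (n + 1) ω) ∂pathMeasure ρ =
      ∫ ω, F ω * tr ((∑ i, ContinuousLinearMap.adjoint (W.L i) * b i * W.L i) * rho ρ n ω)
        ∂pathMeasure ρ := by
  have hfac : (fun ω => F ω * tr (b (ω.2 n) * rho ρ (n + 1) ω)).FactorsThrough (pre W (n + 1)) := by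
    intro ω ω' hω
    have h1 := (pre_eq_iff.1 hω).2 n (Nat.lt_succ_self n)
    change F ω * tr (b (ω.2 n) * rho ρ (n + 1) ω) = F ω' * tr (b (ω'.2 n) * rho ρ (n + 1) ω')
    rw [factorsThrough_mono n.le_succ hF hω, rho_factorsThrough ρ (n + 1) hω, h1]
  have hint : Integrable (fun ω => F ω * tr (b (ω.2 n) * rho ρ (n + 1) ω)) (pathMeasure ρ) := by
    refine integrable_of_factorsThrough hfac (C := C * (‖trL (h := h)‖ * ∑ i, ‖b i‖)) fun ω => ?_
    rw [norm_mul]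
    have := (norm_nonneg _).trans (hC ω)
    gcongr
    · exact hC ω
    · refine (norm_tr_mul_rho_le ρ _ _ ω).trans ?_
      gcongr
      exact Finset.single_le_sum (f := fun i => ‖b i‖) (fun i _ => norm_nonneg _)
        (Finset.mem_univ (ω.2 n))
  refine integral_eq_of_cyl n hint (integrable_mul_tr ρ hF hC _) fun ω₀ => ?_
  -- On one cylinder, split according to the next step; each piece is an explicit trace of the
  -- extended branch, and cyclicity moves L i over to b i.
  rw [setIntegral_cyl_eq_sum n hint, setIntegral_cyl_of_factorsThrough
    (mul_tr_factorsThrough ρ hF _), mul_comm (F ω₀), ← smul_mul_assoc, tr_mul_branch,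
    Finset.sum_mul, tr_sum, Finset.sum_mul]
  refine Finset.sum_congr rfl fun i _ => ?_
  rw [setIntegral_cyl_of_factorsThrough hfac, mul_comm (F _), ← smul_mul_assoc, tr_mul_branch,
    hF (pre_step ω₀ n i)]
  congr 1
  have h1 : (step ω₀ n i).2 n = i := Function.update_self ..
  have h2 : W.branch (ρ.ρ (step ω₀ n i).1) (step ω₀ n i).2 n = W.branch (ρ.ρ ω₀.1) ω₀.2 n :=
    branch_factorsThrough ρ n (pre_step ω₀ n i)
  rw [branch, h1, h2, ← mul_assoc, tr_mul_comm]
  simp only [mul_assoc]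

end Paths

end HOQRW

namespace HOQRW

/-! ### The martingale of absorption probabilities and the absorbed measure -/

section Absorbed

variable {d v : ℕ} {h : Type*} [NormedAddCommGroup h] [InnerProductSpace ℂ h]
  [FiniteDimensional ℂ h] [CompleteSpace h] {W : HOQRW d v h} {V : Submodule ℂ h}
  (ρ : W.InitialState)

local notation "A" => absorption W.L V

/-- The natural filtration of the steps of the walk. -/
def stepFiltration (W : HOQRW d v h) :
    Filtration ℕ (inferInstance : MeasurableSpace W.Omega) where
  seq n := MeasurableSpace.comap (pre W n) inferInstance
  mono' m n hmn := by
    have hF : (pre W m).FactorsThrough (pre W n) := fun _ _ hω => pre_eq_of_le hmn hω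
    -- The path space is empty when v = 0, while the factorization lemma requires a nonempty target.
    rcases isEmpty_or_nonempty W.Omega with hE | hE
    · intro s _
      rw [Set.eq_empty_of_isEmpty s]
      exact MeasurableSpace.measurableSet_empty _
    · have : Nonempty (W.V × (Fin m → Fin v)) := hE.map (pre W m)
      rintro s ⟨t, ht, rfl⟩
      have h2 := measurable_comap_of_factorsThrough hF
      exact h2 ht
  le' n := (measurable_pre n).comap_le

theorem Y_factorsThrough (n : ℕ) : (Y ρ V n).FactorsThrough (pre W n) := fun ω ω' hω => by
  rw [Y, Y, rho_factorsThrough ρ n hω]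

variable (H : Invariant W.L V)
include H

theorem Y_nonneg (n : ℕ) (ω : W.Omega) : 0 ≤ Y ρ V n ω :=
  tr_mul_re_nonneg H.absorption_isPositive (rho_isPositive ρ n ω)

theorem Y_le_one (n : ℕ) (ω : W.Omega) : Y ρ V n ω ≤ 1 := by
  have h1 := tr_mul_re_nonneg H.one_sub_absorption_isPositive (rho_isPositive ρ n ω)
  rw [sub_mul, one_mul, tr_sub, Complex.sub_re] at h1
  have := tr_rho_re_le ρ n ω
  rw [Y]
  linarith

theorem norm_Y_le_one (n : ℕ) (ω : W.Omega) : ‖Y ρ V n ω‖ ≤ 1 := by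
  rw [Real.norm_of_nonneg (Y_nonneg ρ H n ω)]
  exact Y_le_one ρ H n ω

theorem ofReal_Y (n : ℕ) (ω : W.Omega) : (Y ρ V n ω : ℂ) = tr (A * rho ρ n ω) := by
  obtain ⟨m, u, hu⟩ := ContinuousLinearMap.isPositive_iff_eq_sum_rankOne.1 (rho_isPositive ρ n ω)
  rw [Y, hu, Finset.mul_sum, tr_sum, Complex.re_sum, Complex.ofReal_sum]
  refine Finset.sum_congr rfl fun i _ => ?_
  rw [tr_mul_rankOne]
  exact ((isPositive_iff_inner _).1 H.absorption_isPositive _).1.symm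

theorem integrable_Y (n : ℕ) : Integrable (Y ρ V n) (pathMeasure ρ) :=
  integrable_of_factorsThrough (Y_factorsThrough ρ n) (norm_Y_le_one ρ H n)

/-- Expectations against `tr (A ρ_n)` do not depend on `n`. -/
theorem integral_mul_absorption_succ {F : W.Omega → ℂ} {n : ℕ} (hF : F.FactorsThrough (pre W n))
    {C : ℝ} (hC : ∀ ω, ‖F ω‖ ≤ C) :
    ∫ ω, F ω * tr (A * rho ρ (n + 1) ω) ∂pathMeasure ρ =
      ∫ ω, F ω * tr (A * rho ρ n ω) ∂pathMeasure ρ := by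
  rw [integral_step ρ hF hC fun _ => A, ← krausDual_apply, H.krausDual_absorption]

/-- The martingale property is the dual invariance of A, tested against indicators of events
determined by the first n steps. -/
theorem martingale_Y : Martingale (Y ρ V) (stepFiltration W) (pathMeasure ρ) := by
  refine martingale_of_setIntegral_eq_succ (fun n => ?_) (integrable_Y ρ H) fun n s hs => ?_
  · exact (measurable_comap_of_factorsThrough (Y_factorsThrough ρ n)).stronglyMeasurable
  · obtain ⟨t, ht, rfl⟩ := hs
    have hs' : MeasurableSet (pre W n ⁻¹' t) := measurable_pre n ht
    have hF : ((pre W n ⁻¹' t).indicator (fun _ => (1 : ℂ))).FactorsThrough (pre W n) := by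
      intro ω ω' hω
      have h0 : ω ∈ pre W n ⁻¹' t ↔ ω' ∈ pre W n ⁻¹' t := by
        rw [Set.mem_preimage, Set.mem_preimage, hω]
      by_cases h1 : ω ∈ pre W n ⁻¹' t
      · rw [Set.indicator_of_mem h1, Set.indicator_of_mem (h0.1 h1)]
      · rw [Set.indicator_of_notMem h1, Set.indicator_of_notMem (mt h0.2 h1)]
    have h1 := integral_mul_absorption_succ ρ H hF (C := 1) fun ω => by
      by_cases hω : ω ∈ pre W n ⁻¹' t <;> simp [Set.indicator, hω]
    have h2 : ∀ m, ∫ ω, (pre W n ⁻¹' t).indicator (fun _ => (1 : ℂ)) ω * tr (A * rho ρ m ω)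
        ∂pathMeasure ρ = ((∫ ω in pre W n ⁻¹' t, Y ρ V m ω ∂pathMeasure ρ : ℝ) : ℂ) := by
      intro m
      rw [← integral_indicator hs', ← integral_complex_ofReal]
      congr 1
      ext ω
      rw [← ofReal_Y ρ H]
      by_cases hω : ω ∈ pre W n ⁻¹' t <;> simp [Set.indicator, hω]
    rw [h2, h2] at h1
    exact_mod_cast h1.symm

theorem ae_tendsto_Yinf :
    ∀ᵐ ω ∂pathMeasure ρ, Tendsto (fun n => Y ρ V n ω) atTop (𝓝 (Yinf ρ V ω)) := by
  have h1 := (martingale_Y ρ H).submartingale.exists_ae_tendsto_of_bdd (R := 1) fun n => by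
    refine (eLpNorm_le_of_ae_bound (C := 1) (ae_of_all _ (norm_Y_le_one ρ H n))).trans ?_
    simp
  filter_upwards [h1] with ω hω
  exact tendsto_nhds_limUnder hω

theorem aemeasurable_Yinf : AEMeasurable (Yinf ρ V) (pathMeasure ρ) :=
  aemeasurable_of_tendsto_metrizable_ae atTop
    (fun n => (measurable_of_factorsThrough (Y_factorsThrough ρ n)).aemeasurable)
    (ae_tendsto_Yinf ρ H)

theorem ae_Yinf_nonneg : ∀ᵐ ω ∂pathMeasure ρ, 0 ≤ Yinf ρ V ω := by
  filter_upwards [ae_tendsto_Yinf ρ H] with ω hω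
  exact ge_of_tendsto' hω fun n => Y_nonneg ρ H n ω

/-- For a weight known at time n, the means of F Y_m are constant in m ≥ n; as 0 ≤ Y_m ≤ 1,
dominated convergence passes to Y_∞. -/
theorem integral_mul_Yinf {F : W.Omega → ℂ} {n : ℕ} (hF : F.FactorsThrough (pre W n))
    {C : ℝ} (hC : ∀ ω, ‖F ω‖ ≤ C) :
    ∫ ω, F ω * (Yinf ρ V ω : ℂ) ∂pathMeasure ρ =
      ∫ ω, F ω * tr (A * rho ρ n ω) ∂pathMeasure ρ := by
  have h1 : ∀ m, ∫ ω, F ω * (Y ρ V (m + n) ω : ℂ) ∂pathMeasure ρ =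
      ∫ ω, F ω * tr (A * rho ρ n ω) ∂pathMeasure ρ := by
    intro m
    simp only [ofReal_Y ρ H]
    induction m with
    | zero => rw [zero_add]
    | succ m ih =>
      rw [add_right_comm, integral_mul_absorption_succ ρ H
        (factorsThrough_mono (Nat.le_add_left n m) hF) hC, ih]
  have h2 : Tendsto (fun m => ∫ ω, F ω * (Y ρ V (m + n) ω : ℂ) ∂pathMeasure ρ) atTop
      (𝓝 (∫ ω, F ω * (Yinf ρ V ω : ℂ) ∂pathMeasure ρ)) := by
    refine tendsto_integral_of_dominated_convergence (fun _ => C) (fun m => ?_)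
      (integrable_const C) (fun m => ae_of_all _ fun ω => ?_) ?_
    · have e1 := measurable_of_factorsThrough hF
      have e2 := measurable_of_factorsThrough (Y_factorsThrough (V := V) ρ (m + n))
      exact (e1.mul (Complex.measurable_ofReal.comp e2)).aestronglyMeasurable
    · rw [norm_mul, Complex.norm_real]
      exact (mul_le_of_le_one_right (norm_nonneg _) (norm_Y_le_one ρ H _ ω)).trans (hC ω)
    · filter_upwards [ae_tendsto_Yinf ρ H] with ω hω
      exact ((Complex.continuous_ofReal.tendsto _).comp
        (hω.comp (tendsto_add_atTop_nat n))).const_mul (F ω)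
  simp only [h1] at h2
  exact tendsto_nhds_unique h2 tendsto_const_nhds

theorem integral_Yinf : ∫ ω, Yinf ρ V ω ∂pathMeasure ρ = ∫ ω, Y ρ V 0 ω ∂pathMeasure ρ := by
  have h1 := integral_mul_Yinf ρ H (F := fun _ => 1) (n := 0) (fun _ _ _ => rfl) (C := 1) (by simp)
  simp only [one_mul, ← ofReal_Y ρ H] at h1
  rw [integral_complex_ofReal, integral_complex_ofReal] at h1
  exact_mod_cast h1

theorem integrable_Yinf : Integrable (Yinf ρ V) (pathMeasure ρ) := by
  refine Integrable.of_bound (aemeasurable_Yinf ρ H).aestronglyMeasurable 1 ?_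
  filter_upwards [ae_tendsto_Yinf ρ H] with ω hω
  exact le_of_tendsto' hω.norm fun n => norm_Y_le_one ρ H n ω

theorem isProbabilityMeasure_absorbedMeasure (hpos : 0 < ∫ ω, Y ρ V 0 ω ∂pathMeasure ρ) :
    IsProbabilityMeasure (absorbedMeasure ρ V) := by
  refine ⟨?_⟩
  rw [absorbedMeasure, withDensity_apply _ MeasurableSet.univ, Measure.restrict_univ,
    ← ofReal_integral_eq_lintegral_ofReal ((integrable_Yinf ρ H).div_const _), integral_div,
    integral_Yinf ρ H, div_self hpos.ne', ENNReal.ofReal_one]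
  filter_upwards [ae_Yinf_nonneg ρ H] with ω hω
  exact div_nonneg hω hpos.le

/-- Expectations with respect to the absorbed measure. -/
theorem integral_absorbedMeasure (hpos : 0 < ∫ ω, Y ρ V 0 ω ∂pathMeasure ρ)
    {F : W.Omega → ℂ} {n : ℕ} (hF : F.FactorsThrough (pre W n)) {C : ℝ} (hC : ∀ ω, ‖F ω‖ ≤ C) :
    ∫ ω, F ω ∂absorbedMeasure ρ V = ((∫ ω, Y ρ V 0 ω ∂pathMeasure ρ : ℝ) : ℂ)⁻¹ *
      ∫ ω, F ω * tr (A * rho ρ n ω) ∂pathMeasure ρ := by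
  rw [absorbedMeasure, integral_withDensity_eq_integral_toReal_smul₀
    (((aemeasurable_Yinf ρ H).div_const _).ennreal_ofReal) (by simp),
    ← integral_mul_Yinf ρ H hF hC, ← integral_const_mul]
  refine integral_congr_ae ?_
  filter_upwards [ae_Yinf_nonneg ρ H] with ω hω
  rw [ENNReal.toReal_ofReal (div_nonneg hω hpos.le), Complex.real_smul, Complex.ofReal_div]
  ring

end Absorbed

end HOQRW

namespace HOQRW

/-! ### Central limit theorem and mean displacement -/

section Limits

variable {d v : ℕ} {h : Type*} [NormedAddCommGroup h] [InnerProductSpace ℂ h]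
  [FiniteDimensional ℂ h] [CompleteSpace h] {W : HOQRW d v h} {V : Submodule ℂ h}
  {τ : h →L[ℂ] h} (ρ : W.InitialState)

local notation "A" => absorption W.L V
local notation "P" => suppProj W.L V
local notation "S" => sandwich W.L V

theorem X_succ_sub (n : ℕ) (ω : W.Omega) :
    W.X (n + 1) ω - W.X 0 ω = (W.X n ω - W.X 0 ω) + W.s (ω.2 n) := by
  change W.X n ω + W.s (ω.2 n) - W.X 0 ω = _
  rw [add_sub_right_comm]

theorem X_factorsThrough (n : ℕ) : (W.X n).FactorsThrough (pre W n) := by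
  intro ω ω' hω
  induction n with
  | zero =>
    rw [pre_eq_iff] at hω
    rw [X, X, hω.1]
  | succ n ih =>
    rw [X, X, ih (pre_eq_of_le n.le_succ hω), (pre_eq_iff.1 hω).2 n n.lt_succ_self]

theorem displacement_factorsThrough (n : ℕ) :
    (fun ω => W.X n ω - W.X 0 ω).FactorsThrough (pre W n) := fun ω ω' hω => by
  change W.X n ω - W.X 0 ω = W.X n ω' - W.X 0 ω'
  rw [X_factorsThrough n hω, X_factorsThrough 0 (pre_eq_of_le (Nat.zero_le n) hω)]

theorem measurable_rescaled (n : ℕ) (w : EuclideanSpace ℝ (Fin d)) :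
    Measurable fun ω : W.Omega => (√(n : ℝ))⁻¹ • (W.X n ω - W.X 0 ω - (n : ℝ) • w) := by
  refine measurable_of_factorsThrough (n := n) fun ω ω' hω => ?_
  have h1 : W.X n ω - W.X 0 ω = W.X n ω' - W.X 0 ω' := displacement_factorsThrough n hω
  change (√(n : ℝ))⁻¹ • (W.X n ω - W.X 0 ω - (n : ℝ) • w) =
    (√(n : ℝ))⁻¹ • (W.X n ω' - W.X 0 ω' - (n : ℝ) • w)
  rw [h1]

theorem norm_displacement_le (n : ℕ) (ω : W.Omega) :
    ‖W.X n ω - W.X 0 ω‖ ≤ n * ∑ i, ‖W.s i‖ := by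
  induction n with
  | zero => simp
  | succ n ih =>
    rw [X_succ_sub]
    refine (norm_add_le _ _).trans ?_
    have := Finset.single_le_sum (f := fun i => ‖W.s i‖) (fun i _ => norm_nonneg _)
      (Finset.mem_univ (ω.2 n))
    push_cast
    linarith

theorem inner_factorsThrough (u : EuclideanSpace ℝ (Fin d)) (n : ℕ) :
    (fun ω => (⟪u, W.X n ω - W.X 0 ω⟫_ℝ : ℂ)).FactorsThrough (pre W n) := fun ω ω' hω => by
  have h1 : W.X n ω - W.X 0 ω = W.X n ω' - W.X 0 ω' := displacement_factorsThrough n hω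
  change (⟪u, W.X n ω - W.X 0 ω⟫_ℝ : ℂ) = (⟪u, W.X n ω' - W.X 0 ω'⟫_ℝ : ℂ)
  rw [h1]

theorem norm_inner_displacement_le (u : EuclideanSpace ℝ (Fin d)) (n : ℕ) (ω : W.Omega) :
    ‖(⟪u, W.X n ω - W.X 0 ω⟫_ℝ : ℂ)‖ ≤ ‖u‖ * (n * ∑ i, ‖W.s i‖) := by
  rw [Complex.norm_real]
  exact (norm_inner_le_norm _ _).trans (by gcongr; exact norm_displacement_le n ω)

theorem exp_factorsThrough (z : ℂ) (u : EuclideanSpace ℝ (Fin d)) (n : ℕ) :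
    (fun ω => Complex.exp (z * ⟪u, W.X n ω - W.X 0 ω⟫_ℝ)).FactorsThrough (pre W n) :=
  fun _ _ hω => congrArg (fun y => Complex.exp (z * y)) (inner_factorsThrough u n hω)

theorem norm_exp_le (z : ℂ) (u : EuclideanSpace ℝ (Fin d)) (n : ℕ) (ω : W.Omega) :
    ‖Complex.exp (z * ⟪u, W.X n ω - W.X 0 ω⟫_ℝ)‖ ≤
      Real.exp (‖z‖ * (‖u‖ * (n * ∑ i, ‖W.s i‖))) := by
  refine (Complex.norm_exp_le_exp_norm _).trans (Real.exp_le_exp.2 ?_)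
  rw [norm_mul]
  gcongr
  exact norm_inner_displacement_le u n ω

/-- The weighted expectations `E[exp (z ⟨u, X_n - X_0⟩) tr (b ρ_n)]`. -/
def weighted (z : ℂ) (u : EuclideanSpace ℝ (Fin d)) (n : ℕ) (b : h →L[ℂ] h) : ℂ :=
  ∫ ω, Complex.exp (z * ⟪u, W.X n ω - W.X 0 ω⟫_ℝ) * tr (b * rho ρ n ω) ∂pathMeasure ρ

/-- One step of the walk acts on b by the tilted dual map: the new factor exp(z u·s i) joins the
Kraus term of the step taken. -/
theorem weighted_succ (z : ℂ) (u : EuclideanSpace ℝ (Fin d)) (n : ℕ) (b : h →L[ℂ] h) :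
    weighted ρ z u (n + 1) b = weighted ρ z u n (∑ i, Complex.exp (z * ⟪u, W.s i⟫_ℝ) •
      (ContinuousLinearMap.adjoint (W.L i) * b * W.L i)) := by
  have h1 := integral_step ρ (exp_factorsThrough z u n) (norm_exp_le z u n)
    fun i => Complex.exp (z * ⟪u, W.s i⟫_ℝ) • b
  simp only [mul_smul_comm, smul_mul_assoc] at h1
  rw [weighted, weighted, ← h1]
  congr 1
  ext ω
  rw [X_succ_sub, inner_add_right, Complex.ofReal_add, mul_add, Complex.exp_add, tr_smul]
  ring

theorem weighted_sub (z : ℂ) (u : EuclideanSpace ℝ (Fin d)) (n : ℕ) (a b : h →L[ℂ] h) :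
    weighted ρ z u n (a - b) = weighted ρ z u n a - weighted ρ z u n b := by
  rw [weighted, weighted, weighted, ← integral_sub
    (integrable_mul_tr ρ (exp_factorsThrough z u n) (norm_exp_le z u n) a)
    (integrable_mul_tr ρ (exp_factorsThrough z u n) (norm_exp_le z u n) b)]
  simp only [sub_mul, tr_sub, mul_sub]

theorem weighted_smul (z : ℂ) (u : EuclideanSpace ℝ (Fin d)) (n : ℕ) (c : ℂ) (b : h →L[ℂ] h) :
    weighted ρ z u n (c • b) = c * weighted ρ z u n b := by
  rw [weighted, weighted, ← integral_const_mul]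
  simp only [smul_mul_assoc, tr_smul, mul_left_comm]

theorem weighted_eigen (H : Invariant W.L V) {z μ : ℂ} {u : EuclideanSpace ℝ (Fin d)}
    {a : h →L[ℂ] h} (ha : ∑ i, Complex.exp (z * ⟪u, W.s i⟫_ℝ) • S i a = μ • a) (hP : P * a * P = a)
    (n : ℕ) : weighted ρ z u n a = μ ^ n * weighted ρ z u 0 a := by
  induction n with
  | zero => simp
  | succ n ih =>
    have h1 : ∑ i, Complex.exp (z * ⟪u, W.s i⟫_ℝ) •
        (ContinuousLinearMap.adjoint (W.L i) * a * W.L i) = μ • a := by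
      rw [← ha]
      exact Finset.sum_congr rfl fun i _ => by
        rw [sandwich_apply, H.adjoint_compressed_mul_eq hP]
    rw [weighted_succ, h1, weighted_smul, ih, pow_succ']
    ring

/-- For imaginary z the exponential weights have modulus 1, so the bound is uniform in n. -/
theorem norm_weighted_le {z : ℂ} (hz : z.re = 0) (u : EuclideanSpace ℝ (Fin d)) (n : ℕ)
    (b : h →L[ℂ] h) : ‖weighted ρ z u n b‖ ≤ ‖trL (h := h)‖ * ‖b‖ := by
  have h1 := norm_integral_le_of_norm_le_const (μ := pathMeasure ρ)
    (f := fun ω => Complex.exp (z * ⟪u, W.X n ω - W.X 0 ω⟫_ℝ) * tr (b * rho ρ n ω))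
    (C := ‖trL (h := h)‖ * ‖b‖) (ae_of_all _ fun ω => by
      rw [norm_mul, Complex.norm_exp, Complex.re_mul_ofReal, hz, zero_mul, Real.exp_zero, one_mul]
      exact norm_tr_mul_rho_le ρ b n ω)
  simpa [weighted] using h1

theorem weighted_zero_absorption (H : Invariant W.L V) (z : ℂ) (u : EuclideanSpace ℝ (Fin d)) :
    weighted ρ z u 0 A = ((∫ ω, Y ρ V 0 ω ∂pathMeasure ρ : ℝ) : ℂ) := by
  rw [weighted, ← integral_complex_ofReal]
  congr 1
  ext ω
  rw [sub_self, inner_zero_right, Complex.ofReal_zero, mul_zero, Complex.exp_zero, one_mul,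
    ofReal_Y ρ H]

/-- The limit of the characteristic functions. -/
theorem tendsto_charFun (H : MinimalInvariant W.L V) (Hτ : InvariantState W.L V τ)
    (hpos : 0 < ∫ ω, Y ρ V 0 ω ∂pathMeasure ρ) (u : EuclideanSpace ℝ (Fin d)) :
    Tendsto (fun n : ℕ => charFun ((absorbedMeasure ρ V).map fun ω =>
        (√(n : ℝ))⁻¹ • (W.X n ω - W.X 0 ω - (n : ℝ) • W.drift τ)) u) atTop
      (𝓝 (Complex.exp (-(W.quadForm V u : ℂ) / 2))) := by
  obtain ⟨α, μ, hb, h1, -⟩ := exists_eigenBranch H Hτ u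
  rw [sum_inner_eq_inner_drift H Hτ] at h1
  set E₀ : ℝ := ∫ ω, Y ρ V 0 ω ∂pathMeasure ρ with hE₀
  have hE0 : (E₀ : ℂ) ≠ 0 := by exact_mod_cast hpos.ne'
  set m : ℝ := ⟪u, W.drift τ⟫_ℝ with hm
  set z : ℕ → ℂ := fun n => (((√(n : ℝ))⁻¹ : ℝ) : ℂ) * Complex.I with hzdef
  have hzre : ∀ n, (z n).re = 0 := fun n => by simp [hzdef]
  have hz : Tendsto z atTop (𝓝 0) := by
    have h2 : Tendsto (fun n : ℕ => (√(n : ℝ))⁻¹) atTop (𝓝 0) :=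
      tendsto_inv_atTop_zero.comp (Real.tendsto_sqrt_atTop.comp tendsto_natCast_atTop_atTop)
    have h3 := ((Complex.continuous_ofReal.tendsto 0).comp h2).mul_const Complex.I
    rw [Complex.ofReal_zero, zero_mul] at h3
    exact h3
  have hchar : ∀ n : ℕ, charFun ((absorbedMeasure ρ V).map fun ω =>
        (√(n : ℝ))⁻¹ • (W.X n ω - W.X 0 ω - (n : ℝ) • W.drift τ)) u =
      (E₀ : ℂ)⁻¹ * (Complex.exp (-(m : ℂ) * z n) ^ n * weighted ρ (z n) u n A) := by
    intro n
    have hmeas := measurable_rescaled (W := W) n (W.drift τ)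
    rw [charFun_apply, integral_map hmeas.aemeasurable (by fun_prop)]
    have h2 : ∀ ω : W.Omega, Complex.exp (⟪(√(n : ℝ))⁻¹ • (W.X n ω - W.X 0 ω -
        (n : ℝ) • W.drift τ), u⟫_ℝ * Complex.I) = Complex.exp (-(m : ℂ) * z n) ^ n *
          Complex.exp (z n * ⟪u, W.X n ω - W.X 0 ω⟫_ℝ) := by
      intro ω
      rw [← Complex.exp_nat_mul, ← Complex.exp_add, real_inner_comm, real_inner_smul_right,
        inner_sub_right, real_inner_smul_right, ← hm]
      congr 1
      simp only [hzdef]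
      push_cast
      ring
    simp only [h2]
    rw [integral_const_mul, integral_absorbedMeasure ρ H.toInvariant hpos
      (exp_factorsThrough (z n) u n) (norm_exp_le (z n) u n), weighted]
    ring
  simp only [hchar]
  have hαz : Tendsto (fun n => ‖trL (h := h)‖ * ‖A - α (z n)‖) atTop (𝓝 0) := by
    have h2 : Tendsto (fun n => α (z n)) atTop (𝓝 A) := by
      rw [← hb.vec_zero]; exact hb.analytic_vec.continuousAt.tendsto.comp hz
    have h3 := ((tendsto_const_nhds (x := A)).sub h2).norm.const_mul ‖trL (h := h)‖
    simpa using h3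
  have hexpn : ∀ n, ‖Complex.exp (-(m : ℂ) * z n) ^ n‖ = 1 := fun n => by
    have : (-(m : ℂ) * z n).re = 0 := by
      rw [← Complex.ofReal_neg, Complex.re_ofReal_mul, hzre, mul_zero]
    rw [norm_pow, Complex.norm_exp, this, Real.exp_zero, one_pow]
  have herr : Tendsto (fun n => Complex.exp (-(m : ℂ) * z n) ^ n *
      weighted ρ (z n) u n (A - α (z n))) atTop (𝓝 0) := by
    refine squeeze_zero_norm (fun n => ?_) hαz
    rw [norm_mul, hexpn, one_mul]
    exact norm_weighted_le ρ (hzre n) u n _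
  have hstart : Tendsto (fun n => weighted ρ (z n) u 0 (α (z n))) atTop (𝓝 (E₀ : ℂ)) := by
    rw [← tendsto_sub_nhds_zero_iff]
    refine squeeze_zero_norm (fun n => ?_) hαz
    rw [← weighted_zero_absorption ρ H.toInvariant (z n) u, ← weighted_sub, norm_sub_rev A]
    exact norm_weighted_le ρ (hzre n) u 0 _
  have hpow := tendsto_pow_exp_of_analyticAt hb.analytic_val hb.val_zero
  rw [hb.derivs.2, h1] at hpow
  -- Write A = α(z_n) + (A - α(z_n)): the eigenvector part evolves exactly by μ(z_n)^n, and the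
  -- remainder tends to 0 by the uniform bound.
  have hmain : Tendsto (fun n => (E₀ : ℂ)⁻¹ * ((μ (z n) * Complex.exp (-(m : ℂ) * z n)) ^ n *
      weighted ρ (z n) u 0 (α (z n)) + Complex.exp (-(m : ℂ) * z n) ^ n *
      weighted ρ (z n) u n (A - α (z n)))) atTop
      (𝓝 ((E₀ : ℂ)⁻¹ * (Complex.exp (-(W.quadForm V u : ℂ) / 2) * E₀ + 0))) :=
    ((hpow.mul hstart).add herr).const_mul _
  rw [add_zero, mul_comm (Complex.exp _), inv_mul_cancel_left₀ hE0] at hmain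
  refine hmain.congr' ?_
  filter_upwards [hz.eventually hb.eigen] with n hn
  rw [weighted_sub, weighted_eigen ρ H.toInvariant hn.1 hn.2 n, mul_pow]
  ring

/-- The weighted means `E[⟨u, X_n - X_0⟩ tr (A ρ_n)]` grow linearly up to a bounded error. -/
theorem integral_inner_mul_tr (H : MinimalInvariant W.L V) (Hτ : InvariantState W.L V τ)
    (u : EuclideanSpace ℝ (Fin d)) : ∃ b : h →L[ℂ] h, ∀ n : ℕ,
      ∫ ω, (⟪u, W.X n ω - W.X 0 ω⟫_ℝ : ℂ) * tr (A * rho ρ n ω) ∂pathMeasure ρ =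
        n * (⟪u, W.drift τ⟫_ℝ * ((∫ ω, Y ρ V 0 ω ∂pathMeasure ρ : ℝ) : ℂ)) +
          (∫ ω, tr (b * rho ρ 0 ω) ∂pathMeasure ρ - ∫ ω, tr (b * rho ρ n ω) ∂pathMeasure ρ) := by
  set D : h →L[ℂ] h := ∑ i, (⟪u, W.s i⟫_ℝ : ℂ) • S i A with hD
  set b := (Hτ.simpleFixed H).poisson D with hbdef
  have hDb := (Hτ.simpleFixed H).sum_poisson D
  rw [← hbdef] at hDb
  have hfD : trMulL τ D = (⟪u, W.drift τ⟫_ℝ : ℂ) := by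
    rw [← sum_inner_eq_inner_drift H Hτ, hD, map_sum]
    exact Finset.sum_congr rfl fun i _ => by rw [map_smul, smul_eq_mul]
  rw [hfD] at hDb
  clear_value D b
  have hPS : ∀ x, P * (∑ i, S i x) * P = ∑ i, S i x := fun x => by
    rw [Finset.mul_sum, Finset.sum_mul]
    exact Finset.sum_congr rfl fun i _ => suppProj_sandwich i x
  have hPD : P * D * P = D := by
    rw [hD, Finset.mul_sum, Finset.sum_mul]
    exact Finset.sum_congr rfl fun i _ => by
      rw [mul_smul_comm, smul_mul_assoc, suppProj_sandwich]
  -- The Poisson equation expresses b through operators supported by P, so the original dual map may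
  -- replace the compressed one on b.
  have hPb : P * b * P = b := by
    have h1 : b = D - (⟪u, W.drift τ⟫_ℝ : ℂ) • A + ∑ i, S i b := by
      rw [hDb]; abel
    rw [h1, mul_add, add_mul, mul_sub, sub_mul, hPD, hPS, mul_smul_comm, smul_mul_assoc,
      H.suppProj_absorption]
  have hSL : ∀ x, P * x * P = x → ∀ i, S i x =
      ContinuousLinearMap.adjoint (W.L i) * x * W.L i := fun x hx i => by
    rw [sandwich_apply, H.adjoint_compressed_mul_eq hx]
  have hone' : ∀ n, (fun _ : W.Omega => (1 : ℂ)).FactorsThrough (pre W n) := fun _ _ _ _ => rfl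
  have hint : ∀ n (x : h →L[ℂ] h), Integrable (fun ω => tr (x * rho ρ n ω)) (pathMeasure ρ) :=
    fun n x => by simpa using integrable_mul_tr ρ (hone' n) (C := 1) (by simp) x
  have hκ : ∀ n, ∫ ω, tr (b * rho ρ (n + 1) ω) ∂pathMeasure ρ =
      ∫ ω, tr ((∑ i, S i b) * rho ρ n ω) ∂pathMeasure ρ := fun n => by
    have h1 := integral_step ρ (hone' n) (C := 1) (by simp) fun _ => b
    simp only [one_mul, ← hSL b hPb] at h1
    exact h1
  have hY : ∀ n, ∫ ω, tr (A * rho ρ n ω) ∂pathMeasure ρ =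
      ((∫ ω, Y ρ V 0 ω ∂pathMeasure ρ : ℝ) : ℂ) := fun n => by
    induction n with
    | zero => rw [← integral_complex_ofReal]; simp only [ofReal_Y ρ H.toInvariant]
    | succ n ih =>
      have h1 := integral_mul_absorption_succ ρ H.toInvariant (hone' n) (C := 1) (by simp)
      simp only [one_mul] at h1
      rw [h1, ih]
  refine ⟨b, fun n => ?_⟩
  induction n with
  | zero => simp
  | succ n ih =>
    have e1 := integral_mul_absorption_succ ρ H.toInvariant (inner_factorsThrough u n)
      (norm_inner_displacement_le u n)
    have e2 := integral_step ρ (hone' n) (C := 1) (by simp) fun i => (⟪u, W.s i⟫_ℝ : ℂ) • A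
    simp only [one_mul, mul_smul_comm, smul_mul_assoc, ← hSL _ H.suppProj_absorption] at e2
    rw [← hD] at e2
    have e3 : ∫ ω, (⟪u, W.X (n + 1) ω - W.X 0 ω⟫_ℝ : ℂ) * tr (A * rho ρ (n + 1) ω) ∂pathMeasure ρ =
        ∫ ω, (⟪u, W.X n ω - W.X 0 ω⟫_ℝ : ℂ) * tr (A * rho ρ (n + 1) ω) ∂pathMeasure ρ +
        ∫ ω, tr ((⟪u, W.s (ω.2 n)⟫_ℝ : ℂ) • (A * rho ρ (n + 1) ω)) ∂pathMeasure ρ := by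
      have i1 := integrable_mul_tr ρ (factorsThrough_mono n.le_succ
        (inner_factorsThrough (W := W) u n)) (norm_inner_displacement_le u n) A
      have i2 := integrable_mul_tr ρ (inner_factorsThrough (W := W) u (n + 1))
        (norm_inner_displacement_le u (n + 1)) A
      have e4 : ∀ ω : W.Omega, tr ((⟪u, W.s (ω.2 n)⟫_ℝ : ℂ) • (A * rho ρ (n + 1) ω)) =
          (⟪u, W.X (n + 1) ω - W.X 0 ω⟫_ℝ : ℂ) * tr (A * rho ρ (n + 1) ω) -
          (⟪u, W.X n ω - W.X 0 ω⟫_ℝ : ℂ) * tr (A * rho ρ (n + 1) ω) := fun ω => by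
        rw [X_succ_sub, inner_add_right, tr_smul]
        push_cast
        ring
      simp only [e4]
      rw [integral_sub i2 i1]
      ring
    -- The expected increment splits by the Poisson equation into the drift term and a difference of
    -- b-expectations at times n and n + 1, which telescopes.
    have e5 : ∫ ω, tr (D * rho ρ n ω) ∂pathMeasure ρ =
        ⟪u, W.drift τ⟫_ℝ * ((∫ ω, Y ρ V 0 ω ∂pathMeasure ρ : ℝ) : ℂ) +
        ∫ ω, tr (b * rho ρ n ω) ∂pathMeasure ρ - ∫ ω, tr (b * rho ρ (n + 1) ω) ∂pathMeasure ρ := by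
      have i1 := (hint n A).const_mul (⟪u, W.drift τ⟫_ℝ : ℂ)
      have e6 : ∀ ω, tr (D * rho ρ n ω) = ⟪u, W.drift τ⟫_ℝ * tr (A * rho ρ n ω) +
          tr (b * rho ρ n ω) - tr ((∑ i, S i b) * rho ρ n ω) := fun ω => by
        rw [hDb, sub_mul, add_mul, tr_sub, tr_add, smul_mul_assoc, tr_smul]
      have i2 : Integrable (fun ω => ⟪u, W.drift τ⟫_ℝ * tr (A * rho ρ n ω) +
          tr (b * rho ρ n ω)) (pathMeasure ρ) := i1.add (hint n b)
      simp only [e6]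
      rw [hκ, ← hY n, ← integral_const_mul, ← integral_add i1 (hint n b),
        ← integral_sub i2 (hint n _)]
    rw [e3, e1, e2, ih, e5]
    push_cast
    ring

theorem integrable_displacement [IsFiniteMeasure (absorbedMeasure ρ V)] (n : ℕ) :
    Integrable (fun ω => W.X n ω - W.X 0 ω) (absorbedMeasure ρ V) :=
  integrable_of_factorsThrough (displacement_factorsThrough n) (norm_displacement_le n)

/-- The mean displacement differs from `n` times the drift by a bounded amount. -/
theorem exists_norm_integral_displacement_sub_le (H : MinimalInvariant W.L V)
    (Hτ : InvariantState W.L V τ) (hpos : 0 < ∫ ω, Y ρ V 0 ω ∂pathMeasure ρ) :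
    ∃ C : ℝ, ∀ n : ℕ, ‖∫ ω, (W.X n ω - W.X 0 ω) ∂absorbedMeasure ρ V -
      (n : ℝ) • W.drift τ‖ ≤ C := by
  have := isProbabilityMeasure_absorbedMeasure ρ H.toInvariant hpos
  have hE0 : ((∫ ω, Y ρ V 0 ω ∂pathMeasure ρ : ℝ) : ℂ) ≠ 0 := by exact_mod_cast hpos.ne'
  -- In each direction the error is a difference of two expectations of tr(b ρ_k), bounded since
  -- ‖ρ_k‖ ≤ 1; an orthonormal basis then bounds the vector.
  have key : ∀ u : EuclideanSpace ℝ (Fin d), ∃ C : ℝ, ∀ n : ℕ,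
      ‖⟪u, ∫ ω, (W.X n ω - W.X 0 ω) ∂absorbedMeasure ρ V - (n : ℝ) • W.drift τ⟫_ℝ‖ ≤ C := by
    intro u
    obtain ⟨b, hb⟩ := integral_inner_mul_tr ρ H Hτ u
    refine ⟨‖((∫ ω, Y ρ V 0 ω ∂pathMeasure ρ : ℝ) : ℂ)⁻¹‖ *
      (‖trL (h := h)‖ * ‖b‖ + ‖trL (h := h)‖ * ‖b‖), fun n => ?_⟩
    have h1 := integral_absorbedMeasure ρ H.toInvariant hpos (inner_factorsThrough u n)
      (norm_inner_displacement_le u n)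
    rw [hb, integral_complex_ofReal, integral_inner (integrable_displacement ρ n)] at h1
    have hκ : ∀ k, ‖∫ ω, tr (b * rho ρ k ω) ∂pathMeasure ρ‖ ≤ ‖trL (h := h)‖ * ‖b‖ := fun k => by
      simpa using norm_integral_le_of_norm_le_const (μ := pathMeasure ρ)
        (ae_of_all _ (norm_tr_mul_rho_le ρ b k))
    have h2 : ((⟪u, ∫ ω, (W.X n ω - W.X 0 ω) ∂absorbedMeasure ρ V -
        (n : ℝ) • W.drift τ⟫_ℝ : ℝ) : ℂ) = ((∫ ω, Y ρ V 0 ω ∂pathMeasure ρ : ℝ) : ℂ)⁻¹ *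
        (∫ ω, tr (b * rho ρ 0 ω) ∂pathMeasure ρ - ∫ ω, tr (b * rho ρ n ω) ∂pathMeasure ρ) := by
      rw [inner_sub_right, real_inner_smul_right, Complex.ofReal_sub, h1]
      push_cast
      field_simp
      ring
    rw [← Complex.norm_real, h2, norm_mul]
    gcongr
    exact (norm_sub_le _ _).trans (add_le_add (hκ 0) (hκ n))
  choose C hC using key
  let e := EuclideanSpace.basisFun (Fin d) ℝ
  refine ⟨∑ j, C (e j), fun n => ?_⟩
  rw [← e.sum_repr' (∫ ω, (W.X n ω - W.X 0 ω) ∂absorbedMeasure ρ V - (n : ℝ) • W.drift τ)]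
  refine (norm_sum_le _ _).trans (Finset.sum_le_sum fun j _ => ?_)
  rw [norm_smul, e.orthonormal.1 j, mul_one]
  exact hC (e j) n

/-- The limit exp(-q/2) of characteristic functions of probability measures has modulus at most 1.
-/
theorem quadForm_nonneg (H : MinimalInvariant W.L V) (Hτ : InvariantState W.L V τ)
    (hpos : 0 < ∫ ω, Y ρ V 0 ω ∂pathMeasure ρ) (u : EuclideanSpace ℝ (Fin d)) :
    0 ≤ W.quadForm V u := by
  have := isProbabilityMeasure_absorbedMeasure ρ H.toInvariant hpos
  have h1 := (tendsto_charFun ρ H Hτ hpos u).norm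
  have h2 := le_of_tendsto' h1 fun n : ℕ => by
    have hmeas := measurable_rescaled (W := W) n (W.drift τ)
    have := Measure.isProbabilityMeasure_map (μ := absorbedMeasure ρ V) hmeas.aemeasurable
    exact norm_charFun_le_one u
  have h3 : (-(W.quadForm V u : ℂ) / 2).re = -W.quadForm V u / 2 := by
    rw [← Complex.ofReal_neg, Complex.div_ofNat_re, Complex.ofReal_re]
  rw [Complex.norm_exp, h3, Real.exp_le_one_iff] at h2
  linarith

/-- Lévy's continuity theorem; positive semidefiniteness of D is what makes the Gaussian have the
expected characteristic function. -/
theorem tendstoInDistribution (H : MinimalInvariant W.L V) (Hτ : InvariantState W.L V τ)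
    (hpos : 0 < ∫ ω, Y ρ V 0 ω ∂pathMeasure ρ) [IsProbabilityMeasure (absorbedMeasure ρ V)]
    {D : Matrix (Fin d) (Fin d) ℝ} (hD : D.PosSemidef)
    (hq : ∀ u, ⟪u, Matrix.toEuclideanLin D u⟫_ℝ = W.quadForm V u) :
    TendstoInDistribution (fun (n : ℕ) (ω : W.Omega) =>
        (√(n : ℝ))⁻¹ • (W.X n ω - W.X 0 ω - (n : ℝ) • W.drift τ))
      atTop (id : EuclideanSpace ℝ (Fin d) → EuclideanSpace ℝ (Fin d))
      (fun _ => absorbedMeasure ρ V) (multivariateGaussian 0 D) where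
  forall_aemeasurable n :=
    (measurable_rescaled n (W.drift τ)).aemeasurable
  aemeasurable_limit := aemeasurable_id
  tendsto := by
    refine ProbabilityMeasure.tendsto_of_tendsto_charFun fun u => ?_
    have h1 : charFun ((multivariateGaussian 0 D).map
        (id : EuclideanSpace ℝ (Fin d) → EuclideanSpace ℝ (Fin d))) u =
        Complex.exp (-(W.quadForm V u : ℂ) / 2) := by
      rw [Measure.map_id, charFun_multivariateGaussian hD, ← hq u, inner_toEuclideanLin_single,
        inner_zero_right]
      congr 1
      simp only [dotProduct, Matrix.mulVec, Finset.mul_sum]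
      push_cast
      ring
    change Tendsto _ atTop (𝓝 (charFun ((multivariateGaussian 0 D).map id) u))
    rw [h1]
    exact tendsto_charFun ρ H Hτ hpos u

end Limits

end HOQRW

end OQW

end

/-! ### The theorem -/

open OQW OQW.HOQRW

theorem theorem3p5 {d v : ℕ} {h : Type*} [NormedAddCommGroup h] [InnerProductSpace ℂ h]
    [FiniteDimensional ℂ h] [CompleteSpace h] (W : OQW.HOQRW d v h) (ρ : W.InitialState)
    (𝓥 : Submodule ℂ h) (h𝓥 : OQW.IsMinimalEnclosure (OQW.krausMap W.L) 𝓥)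
    (hpos : 0 < ∫ ω, OQW.HOQRW.Y ρ 𝓥 0 ω ∂OQW.HOQRW.pathMeasure ρ) :
    -- the measure with density `Y_∞ / 𝔼[Y_0]` is a probability measure
    ∃ _ : IsProbabilityMeasure (OQW.HOQRW.absorbedMeasure ρ 𝓥),
    -- `τ₀` is the unique invariant state supported in `𝓥`, and its support is `𝓥`
    ∃ τ₀ : h →L[ℂ] h, (OQW.IsState τ₀ ∧ OQW.krausMap W.L τ₀ = τ₀ ∧ OQW.supp τ₀ = 𝓥) ∧
      (∀ τ : h →L[ℂ] h, OQW.IsState τ → OQW.krausMap W.L τ = τ → OQW.supp τ ≤ 𝓥 → τ = τ₀) ∧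
      -- `λ'_u` and `λ''_u` exist
      (∀ u, ContDiffAt ℝ 2 (fun t : ℝ => W.lam 𝓥 (t • u)) 0) ∧
      -- `D` is the unique symmetric matrix with `⟨u, D u⟩ = λ''_u - (λ'_u)²`
      ∃ D : Matrix (Fin d) (Fin d) ℝ, D.PosSemidef ∧
        (∀ u, ⟪u, Matrix.toEuclideanLin D u⟫_ℝ = W.quadForm 𝓥 u) ∧
        (∀ D' : Matrix (Fin d) (Fin d) ℝ, D'.IsSymm →
          (∀ u, ⟪u, Matrix.toEuclideanLin D' u⟫_ℝ = W.quadForm 𝓥 u) → D' = D) ∧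
        -- the central limit theorem
        TendstoInDistribution
          (fun (n : ℕ) (ω : W.Omega) =>
            (√(n : ℝ))⁻¹ • (W.X n ω - W.X 0 ω - (n : ℝ) • W.drift τ₀))
          atTop (id : EuclideanSpace ℝ (Fin d) → EuclideanSpace ℝ (Fin d))
          (fun _ => OQW.HOQRW.absorbedMeasure ρ 𝓥) (multivariateGaussian 0 D) ∧
        -- the rate of convergence of the mean
        (∀ n, Integrable (fun ω => W.X n ω - W.X 0 ω) (OQW.HOQRW.absorbedMeasure ρ 𝓥)) ∧
        (fun n : ℕ => ‖(n : ℝ)⁻¹ • (∫ ω, (W.X n ω - W.X 0 ω)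
            ∂OQW.HOQRW.absorbedMeasure ρ 𝓥) - W.drift τ₀‖)
          =O[atTop] (fun n : ℕ => (n : ℝ)⁻¹) := by
  have H := IsMinimalEnclosure.minimalInvariant W.normalized h𝓥
  have hprob := isProbabilityMeasure_absorbedMeasure ρ H.toInvariant hpos
  obtain ⟨τ, hτ, hfix, hsupp⟩ := H.exists_fixed_state
  have Hτ : InvariantState W.L 𝓥 τ := ⟨hτ, hfix, hsupp.le⟩
  obtain ⟨B, hB⟩ := exists_bilin H Hτ
  obtain ⟨D, hD, hDB⟩ := exists_matrix_of_bilin B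
  have hq : ∀ u, ⟪u, Matrix.toEuclideanLin D u⟫_ℝ = W.quadForm 𝓥 u := fun u =>
    (hDB u).trans (hB u)
  have hpsd : D.PosSemidef := by
    refine Matrix.PosSemidef.of_dotProduct_mulVec_nonneg hD fun x => ?_
    have h1 := quadForm_nonneg ρ H Hτ hpos (WithLp.toLp 2 x)
    rw [← hq, inner_toEuclideanLin_single] at h1
    simpa only [dotProduct, Matrix.mulVec, Finset.mul_sum, star_trivial] using h1
  refine ⟨hprob, τ, ⟨hτ, hfix, hsupp⟩, fun τ' h1 h2 h3 => Hτ.unique H ⟨h1, h2, h3⟩, fun u => ?_,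
    D, hpsd, hq, fun D' hD' hq' => matrix_eq_of_quadraticForm_eq hD hD' fun u => ?_,
    tendstoInDistribution ρ H Hτ hpos hpsd hq, fun n => integrable_displacement ρ n, ?_⟩
  · obtain ⟨α, μ, hb, -⟩ := exists_eigenBranch H Hτ u
    exact hb.derivs.1
  · rw [hq, hq']
  · obtain ⟨C, hC⟩ := exists_norm_integral_displacement_sub_le ρ H Hτ hpos
    refine Asymptotics.IsBigO.of_bound C ?_
    filter_upwards [eventually_gt_atTop 0] with n hn
    have hn' : (n : ℝ) ≠ 0 := Nat.cast_ne_zero.2 hn.ne'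
    have h1 : (n : ℝ)⁻¹ • (∫ ω, (W.X n ω - W.X 0 ω) ∂absorbedMeasure ρ 𝓥) - W.drift τ =
        (n : ℝ)⁻¹ • (∫ ω, (W.X n ω - W.X 0 ω) ∂absorbedMeasure ρ 𝓥 - (n : ℝ) • W.drift τ) := by
      rw [smul_sub, inv_smul_smul₀ hn']
    rw [h1, norm_norm, norm_smul, mul_comm]
    exact mul_le_mul_of_nonneg_right (hC n) (norm_nonneg _)
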